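/- Let $(\Omega,\mathcal F,P)$ be a probability space with a filtration $\mathbb F=(\mathcal F_t)_{t\ge0}$ satisfying the usual conditions, and let $J=(J_t)_{t\ge0}$ be a subordinator with respect to $\mathbb F$ (adapted, nondecreasing, right-continuous, $J_0=0$, with stationary increments $J_{s+t}-J_s$ independent of $\mathcal F_s$) with finite mean $\rho=EJ_1<\infty$, drift $c\ge 0$ and Lévy measure $\nu$, where $\int_{(0,\infty)}(x\wedge 1)\,\nu(dx)<\infty$; that is, $Ee^{-\alpha J_t}=e^{-\eta(\alpha)t}$ for $\alpha,t\ge0$ with $$\eta(\alpha)=c\alpha+\int_{(0,\infty)}(1-e^{-\alpha x})\,\nu(dx).$$ Let $\tau$ be an $\mathbb F$-stopping time with $E\tau<\infty$ such that $V=J_\tau>0$ a.s., and let $R$ be an $\mathcal F_\tau$-measurable random variable with $R>\rho$ a.s. and $E\frac{V}{R-\rho}<\infty$. A storage system has independent and identically distributed cycles. Each consists of an off period $[0,\tau)$, in which the workload is $J_t$, followed by an on period of length $T^\tau=\inf\{s\ge0: J_{\tau+s}-Rs=0\}$, in which the workload at $s$ time units after its beginning is $J_{\tau+s}-Rs$.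 Let $Y^\tau$ be the process obtained by putting the on periods of the successive cycles one after the other. Its steady-state law is the probability measure $\pi$ on $[0,\infty)$ such that, for every Borel set $B$, almost surely the long-run fraction of time that $Y^\tau$ spends in $B$ equals $\pi(B)$; let $\tilde Y^\tau$ denote a random variable with this law. On an extension of the probability space (still denoted $P$, $E$) let $U$, $e_1,e_2,\dots$ and $(N,V,R)$ be independent, where $U$ is uniform on $[0,1]$, the $e_i\ge0$ are identically distributed with $Ee^{-\alpha e_1}=\frac{\eta(\alpha)}{\rho\alpha}$ for $\alpha>0$, and $P(N=n\mid V,R)=\left(1-\frac{\rho}{R}\right)\left(\frac{\rho}{R}\right)^n$ for $n=0,1,2,\dots$. Write $E_{V,R}S=E\left(\frac{V}{R-\rho}S\right)\big/E\left(\frac{V}{R-\rho}\right)$ for $S\ge 0$. Then $\pi$ exists and is unique. Moreover, with $$\mu=\frac{\int_{(0,\infty)}x^2\,\nu(dx)}{2\rho}\in[0,\infty],$$ one has $\mu=Ee_1=-\frac{\eta''(0)}{2\rho}$, where $\eta''(0)=\lim_{\alpha\downarrow0}\frac{\eta'(\alpha)-\eta'(0)}{\alpha}$ with $\eta'$ one-sided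 at $0$, and $$E\tilde Y^\tau=E_{V,R}\left(UV+\sum_{i=1}^Ne_i\right)=\frac{E\left[\frac{V^2}{2(R-\rho)}+\mu\rho\,\frac{V}{(R-\rho)^2}\right]}{E\left(\frac{V}{R-\rho}\right)},$$ where all these quantities may be $+\infty$. -/

import Mathlib

open MeasureTheory ProbabilityTheory Filter Topology Set
open scoped NNReal ENNReal

noncomputable section

namespace LevyStorage

/-- The exponent `η(α) = c α + ∫_{(0,∞)} (1 - e^{-α x}) ν(dx)`. -/
def levyExponent (c : ℝ) (ν : Measure ℝ) (α : ℝ) : ℝ :=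
  c * α + ∫ x in Ioi (0 : ℝ), (1 - Real.exp (-(α * x))) ∂ν

/-- A subordinator with respect to the filtration `𝓕`: an adapted nondecreasing right-continuous
process, started at the origin, with stationary increments that are independent of the past. -/
structure IsSubordinator {Ω : Type*} {m : MeasurableSpace Ω} (P : Measure Ω)
    (𝓕 : Filtration ℝ≥0 m) (J : ℝ≥0 → Ω → ℝ) : Prop where
  adapted : Adapted 𝓕 J
  zero : ∀ ω, J 0 ω = 0
  mono : ∀ ω, Monotone fun t => J t ω
  right_continuous : ∀ ω t, ContinuousWithinAt (fun t => J t ω) (Ici t) t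
  indep : ∀ s t : ℝ≥0, Indep (𝓕 s)
    (MeasurableSpace.comap (fun ω => J (s + t) ω - J s ω) inferInstance) P
  stationary : ∀ s t : ℝ≥0, IdentDistrib (fun ω => J (s + t) ω - J s ω) (J t) P P

/-- `c` is the drift and `ν` (restricted to `(0,∞)`) the Lévy measure of the subordinator `J`:
`E e^{-α J_t} = e^{-η(α) t}`. -/
structure HasLevyCharacteristics {Ω : Type*} {m : MeasurableSpace Ω} (P : Measure Ω)
    (J : ℝ≥0 → Ω → ℝ) (c : ℝ) (ν : Measure ℝ) : Prop where
  drift_nonneg : 0 ≤ c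
  levy : ∫⁻ x in Ioi (0 : ℝ), ENNReal.ofReal (min x 1) ∂ν < ∞
  lst : ∀ α : ℝ, 0 ≤ α → ∀ t : ℝ≥0,
    ∫ ω, Real.exp (-(α * J t ω)) ∂P = Real.exp (-(levyExponent c ν α * t))

/-- The usual conditions: the filtration is right-continuous and `𝓕 0` contains all null sets. -/
structure UsualConditions {Ω : Type*} {m : MeasurableSpace Ω} (P : Measure Ω)
    (𝓕 : Filtration ℝ≥0 m) : Prop where
  right_continuous : 𝓕.IsRightContinuous
  augmented : ∀ s : Set Ω, P s = 0 → MeasurableSet[𝓕 0] s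

section Cycle

variable {Ω : Type*} (J : ℝ≥0 → Ω → ℝ) (τ : Ω → ℝ≥0∞) (R : Ω → ℝ)

/-- The workload `V = J_τ` at the beginning of the on period (`τ` is almost surely finite). -/
def initialLoad (ω : Ω) : ℝ := J (τ ω).toNNReal ω

/-- The workload `J_{τ+s} - R s` at `s` units of time after the beginning of the on period. -/
def onLevel (ω : Ω) (s : ℝ≥0) : ℝ := J ((τ ω).toNNReal + s) ω - R ω * s

/-- The duration of the on period: the first time that the workload hits the origin. -/
def onDuration (ω : Ω) : ℝ≥0∞ := ⨅ (s : ℝ≥0) (_ : onLevel J τ R ω s = 0), (s : ℝ≥0∞)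

/-- A point of `ℕ → Ω` describes an infinite sequence of cycles; this is the total duration of the
first `n` on periods. -/
def onStart (ω : ℕ → Ω) (n : ℕ) : ℝ≥0∞ := ∑ k ∈ Finset.range n, onDuration J τ R (ω k)

/-- The index of the on period that is running at time `t` of the clock which only counts the time
spent in on periods. -/
def onIndex (ω : ℕ → Ω) (t : ℝ≥0) : ℕ := sSup {n : ℕ | onStart J τ R ω n ≤ t}

/-- The workload process restricted to on periods: the on periods of the successive cycles are put
one after the other. -/
def onProcess (t : ℝ≥0) (ω : ℕ → Ω) : ℝ :=
  onLevel J τ R (ω (onIndex J τ R ω t)) (t - (onStart J τ R ω (onIndex J τ R ω t)).toNNReal)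

end Cycle

/-- `π` is the steady-state law of the process `X`: for every Borel set `B`, almost surely, the
long-run fraction of time that `X` spends in `B` is `π B`. -/
def IsSteadyStateLaw {Ω : Type*} {m : MeasurableSpace Ω} (P : Measure Ω) (X : ℝ≥0 → Ω → ℝ)
    (π : Measure ℝ) : Prop :=
  ∀ B : Set ℝ, MeasurableSet B → ∀ᵐ ω ∂P,
    Tendsto (fun t : ℝ =>
        volume {s : ℝ | 0 ≤ s ∧ s < t ∧ X s.toNNReal ω ∈ B} / ENNReal.ofReal t)
      atTop (𝓝 (π B))

/-- The law of the regenerative system: its cycles are independent copies of the first one. -/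
def cycleMeasure {Ω : Type*} {m : MeasurableSpace Ω} (P : Measure Ω) : Measure (ℕ → Ω) :=
  Measure.infinitePi fun _ : ℕ => P

/-- The measure `P_{V,R}(A) = E[V/(R-ρ) 1_A] / E[V/(R-ρ)]`. -/
def biasedMeasure {Ω : Type*} {m : MeasurableSpace Ω} (P : Measure Ω) (V R : Ω → ℝ) (ρ : ℝ) :
    Measure Ω :=
  (∫⁻ ω, ENNReal.ofReal (V ω / (R ω - ρ)) ∂P)⁻¹ •
    P.withDensity fun ω => ENNReal.ofReal (V ω / (R ω - ρ))

/-- `U`, `e 0`, `e 1`, … and `(N, V, R)` are independent, `U` is uniform on `[0,1]`, each `e n` is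
nonnegative with Laplace-Stieltjes transform `η(α) / (ρ α)`, and given `(V, R)` the variable `N + 1`
is geometric on `{1, 2, …}` with success probability `1 - ρ / R`. -/
structure IsAuxiliaryFamily {Ω : Type*} {m : MeasurableSpace Ω} (P : Measure Ω) (ρ : ℝ)
    (η : ℝ → ℝ) (V R U : Ω → ℝ) (N : Ω → ℕ) (e : ℕ → Ω → ℝ) : Prop where
  measurable_U : Measurable U
  measurable_N : Measurable N
  measurable_e : ∀ n, Measurable (e n)
  uniform : P.map U = volume.restrict (Icc (0 : ℝ) 1)
  nonneg : ∀ n, ∀ᵐ ω ∂P, 0 ≤ e n ω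
  lst : ∀ n, ∀ α : ℝ, 0 < α → ∫ ω, Real.exp (-(α * e n ω)) ∂P = η α / (ρ * α)
  geometric : ∀ n : ℕ,
    P⟦N ⁻¹' {n} | MeasurableSpace.comap (fun ω => (V ω, R ω)) inferInstance⟧
      =ᵐ[P] fun ω => (1 - ρ / R ω) * (ρ / R ω) ^ n
  indep_e : iIndepFun e P
  indep_e_NVR : IndepFun (fun ω n => e n ω) (fun ω => (N ω, V ω, R ω)) P
  indep_U : IndepFun U (fun ω => ((fun n => e n ω), N ω, V ω, R ω)) P

end LevyStorage

end

/-! Let `X_s = V + (J_{τ+s} - J_τ) - R s` be the level during an on period and `T` the length of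
that period. By the strong law applied to the independent cycles, the steady-state law is the mean
occupation measure of one on period divided by `E T` (`isSteadyStateLaw_onProcess`). Hence its mean
is `E ∫_0^T X_s ds / E T`, and both expectations are read off near `α = 0` from the identity of
`lintegral_occupation`, `E ∫_0^T e^{-α X_s} ds = E [(1 - e^{-α V}) / φ]` with `φ = α R - η(α)`.

The identity holds because `X` has no downward jumps, so that it vanishes when it first passes below
zero. For the free process, the strong Markov property gives `E e^{-α X_t} = E e^{-α V + φ t}`, and
the paths with `T < t` contribute `e^{φ (t - T)}`. Integrating this decomposition over time and
comparing it with the decomposition at the horizon, weighted by `1/φ`, eliminates everything after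
`T`; then the horizon tends to infinity.

As `α ↓ 0` the identity yields `E T = E [V / (R - ρ)]`. The next order is obtained by splitting the
difference quotient of `(1 - e^{-α V}) / φ` with `ratio_difference`: one term tends to `V² / (2 (R -
ρ))`, the other to `V / (R - ρ)²` times `∫ x²/2 ν(dx) = μ ρ`. The variable `U V + e_1 + … + e_N` has
the same mean under the biased measure, since `E U = 1/2`, `E [N | V, R] = ρ / (R - ρ)`, and the
transform of `e_i` gives `E e_i = μ` by the same expansion of `η`.

The moments may be infinite, so limits are taken in `ℝ≥0∞` with integrands that stay below their
limits (`tendsto_lintegral_of_le_limit`). The passage below zero is used because it is an optional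
time; it agrees almost surely with the hitting time of zero that ends the on period
(`ae_hitting_eq_drainTime`). -/

namespace LevyStorage

/-! ### Limits of Laplace transforms at the origin -/

/-- Convergence of integrals for nonnegative functions that stay below their limit. -/
theorem tendsto_lintegral_of_le_limit {α ι : Type*} {m : MeasurableSpace α} {μ : Measure α}
    {l : Filter ι} [l.IsCountablyGenerated] {F : ι → α → ℝ≥0∞} {f : α → ℝ≥0∞}
    (hF : ∀ i, AEMeasurable (F i) μ) (hle : ∀ᶠ i in l, ∀ᵐ a ∂μ, F i a ≤ f a)
    (hlim : ∀ᵐ a ∂μ, Tendsto (fun i => F i a) l (𝓝 (f a))) :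
    Tendsto (fun i => ∫⁻ a, F i a ∂μ) l (𝓝 (∫⁻ a, f a ∂μ)) := by
  rcases l.eq_or_neBot with rfl | hl
  · exact tendsto_bot
  -- Fatou's lemma gives the lower half and the bound by the limit gives the upper half; no
  -- integrability is needed, and the limit may be infinite.
  refine tendsto_of_le_liminf_of_limsup_le ?_ ?_
  · calc ∫⁻ a, f a ∂μ = ∫⁻ a, liminf (fun i => F i a) l ∂μ :=
          lintegral_congr_ae (hlim.mono fun a ha => ha.liminf_eq.symm)
      _ ≤ _ := lintegral_liminf_le' hF
  · refine limsup_le_of_le (by isBoundedDefault) ?_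
    exact hle.mono fun i hi => lintegral_mono_ae hi

theorem one_sub_exp_neg_le (y : ℝ) : 1 - Real.exp (-y) ≤ y := by
  linarith [Real.one_sub_le_exp_neg y]

/-- Multiply by `e^y ≥ 1 + y + y²/2` and use `(1 - y + y²/2)(1 + y + y²/2) = 1 + y⁴/4`. -/
theorem exp_neg_le_quadratic {y : ℝ} (hy : 0 ≤ y) : Real.exp (-y) ≤ 1 - y + y ^ 2 / 2 := by
  have h := Real.quadratic_le_exp_of_nonneg hy
  rw [Real.exp_neg, inv_le_iff_one_le_mul₀ (Real.exp_pos y)]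
  nlinarith [mul_le_mul_of_nonneg_left h (by nlinarith [sq_nonneg (1 - y)] : 0 ≤ 1 - y + y ^ 2 / 2),
    sq_nonneg (y ^ 2)]

/-- Taylor remainder of order three. `Real.exp_bound` gives the constant `2/9`; the cruder `1`
suffices because only the order `y³` matters for the squeeze below. -/
theorem cubic_le_exp_neg {y : ℝ} (hy : 0 ≤ y) (hy1 : y ≤ 1) :
    1 - y + y ^ 2 / 2 - y ^ 3 ≤ Real.exp (-y) := by
  have h := Real.exp_bound (x := -y) (by rw [abs_neg, abs_of_nonneg hy]; exact hy1)
    (n := 3) (by norm_num)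
  rw [abs_neg, abs_of_nonneg hy] at h
  have h2 := (abs_le.1 h).1
  simp [Finset.sum_range_succ, Nat.factorial] at h2
  nlinarith [pow_nonneg hy 3]

theorem tendsto_mul_nhdsGT_zero (x : ℝ) : Tendsto (fun α : ℝ => α * x) (𝓝[>] 0) (𝓝 0) := by
  have : Tendsto (fun α : ℝ => α * x) (𝓝 0) (𝓝 (0 * x)) := tendsto_id.mul_const x
  rw [zero_mul] at this
  exact this.mono_left nhdsWithin_le_nhds

theorem tendsto_one_sub_exp_div {x : ℝ} (hx : 0 ≤ x) :
    Tendsto (fun α : ℝ => (1 - Real.exp (-(α * x))) / α) (𝓝[>] 0) (𝓝 x) := by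
  have h0 : Tendsto (fun α : ℝ => x - α * x * x / 2) (𝓝[>] 0) (𝓝 x) := by
    have := ((tendsto_mul_nhdsGT_zero x).mul_const (x / 2)).const_sub x
    simpa [mul_div_assoc] using this
  refine tendsto_of_tendsto_of_tendsto_of_le_of_le' h0 tendsto_const_nhds ?_ ?_
  · filter_upwards [self_mem_nhdsWithin] with α (hα : 0 < α)
    rw [le_div_iff₀ hα]
    nlinarith [exp_neg_le_quadratic (mul_nonneg hα.le hx)]
  · filter_upwards [self_mem_nhdsWithin] with α (hα : 0 < α)
    rw [div_le_iff₀ hα]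
    linarith [one_sub_exp_neg_le (α * x)]

theorem tendsto_exp_second_order {x : ℝ} (hx : 0 ≤ x) :
    Tendsto (fun α : ℝ => (x - (1 - Real.exp (-(α * x))) / α) / α) (𝓝[>] 0) (𝓝 (x ^ 2 / 2)) := by
  have h0 : Tendsto (fun α : ℝ => x ^ 2 / 2 - α * x * x ^ 2) (𝓝[>] 0) (𝓝 (x ^ 2 / 2)) := by
    have := ((tendsto_mul_nhdsGT_zero x).mul_const (x ^ 2)).const_sub (x ^ 2 / 2)
    simpa using this
  have h1 : ∀ᶠ α in 𝓝[>] (0 : ℝ), α * x ≤ 1 :=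
    (tendsto_mul_nhdsGT_zero x).eventually (eventually_le_nhds zero_lt_one)
  refine tendsto_of_tendsto_of_tendsto_of_le_of_le' h0 tendsto_const_nhds ?_ ?_
  · filter_upwards [self_mem_nhdsWithin, h1] with α (hα : 0 < α) h1
    rw [le_div_iff₀ hα, le_sub_iff_add_le, ← le_sub_iff_add_le', div_le_iff₀ hα]
    nlinarith [cubic_le_exp_neg (mul_nonneg hα.le hx) h1]
  · filter_upwards [self_mem_nhdsWithin] with α (hα : 0 < α)
    rw [div_le_iff₀ hα, sub_le_iff_le_add, ← sub_le_iff_le_add', le_div_iff₀ hα]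
    nlinarith [exp_neg_le_quadratic (mul_nonneg hα.le hx)]

theorem exp_second_order_le {x α : ℝ} (hx : 0 ≤ x) (hα : 0 < α) :
    (x - (1 - Real.exp (-(α * x))) / α) / α ≤ x ^ 2 / 2 := by
  rw [div_le_iff₀ hα, sub_le_iff_le_add, ← sub_le_iff_le_add', le_div_iff₀ hα]
  nlinarith [exp_neg_le_quadratic (mul_nonneg hα.le hx)]

theorem one_sub_exp_div_le {α : ℝ} (x : ℝ) (hα : 0 < α) :
    (1 - Real.exp (-(α * x))) / α ≤ x := by
  rw [div_le_iff₀ hα]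
  linarith [one_sub_exp_neg_le (α * x)]

theorem one_sub_exp_div_nonneg {x α : ℝ} (hx : 0 ≤ x) (hα : 0 < α) :
    0 ≤ (1 - Real.exp (-(α * x))) / α := by
  have : Real.exp (-(α * x)) ≤ 1 := Real.exp_le_one_iff.2 (by nlinarith)
  exact div_nonneg (by linarith) hα.le

theorem abs_exp_neg_sub_exp_neg_le {a b : ℝ} (ha : 0 ≤ a) (hb : 0 ≤ b) :
    |Real.exp (-a) - Real.exp (-b)| ≤ |a - b| := by
  wlog h : a ≤ b generalizing a b
  · rw [abs_sub_comm, abs_sub_comm a b]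
    exact this hb ha (le_of_not_ge h)
  have h1 : Real.exp (-b) ≤ Real.exp (-a) := Real.exp_le_exp.2 (by linarith)
  rw [abs_of_nonneg (by linarith), abs_sub_comm, abs_of_nonneg (by linarith)]
  have h2 : Real.exp (-b) = Real.exp (-a) * Real.exp (-(b - a)) := by
    rw [← Real.exp_add]; ring_nf
  have h3 : Real.exp (-a) ≤ 1 := Real.exp_le_one_iff.2 (by linarith)
  nlinarith [one_sub_exp_neg_le (b - a), Real.exp_pos (-a)]

/-! ### Laplace functionals of a nonnegative function -/

section Laplace

variable {E : Type*} {mE : MeasurableSpace E} {κ : Measure E} {f : E → ℝ}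

theorem integrable_one_sub_exp (hf : Integrable f κ) (h0 : 0 ≤ᵐ[κ] f) {α : ℝ} (hα : 0 ≤ α) :
    Integrable (fun x => 1 - Real.exp (-(α * f x))) κ := by
  refine (hf.const_mul α).mono' ?_ ?_
  · have : Continuous fun y : ℝ => 1 - Real.exp (-(α * y)) := by fun_prop
    exact this.comp_aestronglyMeasurable hf.1
  · filter_upwards [h0] with x hx
    have hx : 0 ≤ α * f x := mul_nonneg hα hx
    rw [Real.norm_eq_abs, abs_of_nonneg]
    · exact one_sub_exp_neg_le _
    · linarith [Real.exp_le_one_iff.2 (neg_nonpos.2 hx)]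

/-- One-sided differentiation of a Laplace functional under the integral sign. -/
theorem hasDerivWithinAt_integral_one_sub_exp (hf : Integrable f κ) (h0 : 0 ≤ᵐ[κ] f) {α : ℝ}
    (hα : 0 ≤ α) :
    HasDerivWithinAt (fun a => ∫ x, (1 - Real.exp (-(a * f x))) ∂κ)
      (∫ x, f x * Real.exp (-(α * f x)) ∂κ) (Ici 0) α := by
  rw [hasDerivWithinAt_iff_tendsto_slope]
  have hmem : ∀ᶠ b in 𝓝[Ici 0 \ {α}] α, b ∈ Ici (0 : ℝ) \ {α} := self_mem_nhdsWithin
  have key : Tendsto (fun b => ∫ x, slope (fun a => 1 - Real.exp (-(a * f x))) α b ∂κ)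
      (𝓝[Ici 0 \ {α}] α) (𝓝 (∫ x, f x * Real.exp (-(α * f x)) ∂κ)) := by
    -- On the nonnegative half-line `e^{-y}` is 1-Lipschitz, so every slope in the parameter is
    -- dominated by `f` itself.
    refine tendsto_integral_filter_of_dominated_convergence f ?_ ?_ hf ?_
    · refine Eventually.of_forall fun b => ?_
      have : Continuous fun y : ℝ => slope (fun a => 1 - Real.exp (-(a * y))) α b := by
        simp only [slope_def_field]; fun_prop
      exact this.comp_aestronglyMeasurable hf.1
    · filter_upwards [hmem] with b hb
      filter_upwards [h0] with x hx
      have hx : 0 ≤ f x := hx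
      have hb0 : (0 : ℝ) ≤ b := hb.1
      have hne : 0 < |b - α| := abs_pos.2 (sub_ne_zero.2 hb.2)
      rw [slope_def_field, Real.norm_eq_abs, abs_div, div_le_iff₀ hne]
      have := abs_exp_neg_sub_exp_neg_le (mul_nonneg hα hx) (mul_nonneg hb0 hx)
      rw [← sub_mul, abs_mul, abs_of_nonneg hx, abs_sub_comm α b] at this
      rw [show 1 - Real.exp (-(b * f x)) - (1 - Real.exp (-(α * f x)))
        = Real.exp (-(α * f x)) - Real.exp (-(b * f x)) by ring]
      linarith
    · refine Eventually.of_forall fun x => ?_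
      have h : HasDerivAt (fun a => 1 - Real.exp (-(a * f x))) (f x * Real.exp (-(α * f x))) α := by
        have h1 : HasDerivAt (fun a : ℝ => -(a * f x)) (-(1 * f x)) α :=
          ((hasDerivAt_id α).mul_const (f x)).neg
        have := (h1.exp).const_sub 1
        rwa [mul_neg, neg_neg, one_mul, mul_comm] at this
      exact hasDerivWithinAt_iff_tendsto_slope.1 h.hasDerivWithinAt
  refine key.congr' ?_
  filter_upwards [hmem] with b hb
  simp only [slope_def_field]
  rw [integral_div, integral_sub (integrable_one_sub_exp hf h0 hb.1)
    (integrable_one_sub_exp hf h0 hα)]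

theorem tendsto_lintegral_one_sub_exp_div (hf : AEMeasurable f κ) (h0 : 0 ≤ᵐ[κ] f) :
    Tendsto (fun α : ℝ => ∫⁻ x, ENNReal.ofReal ((1 - Real.exp (-(α * f x))) / α) ∂κ) (𝓝[>] 0)
      (𝓝 (∫⁻ x, ENNReal.ofReal (f x) ∂κ)) := by
  refine tendsto_lintegral_of_le_limit (fun α => ?_) ?_ ?_
  · fun_prop
  · filter_upwards [self_mem_nhdsWithin] with α (hα : 0 < α)
    exact Eventually.of_forall fun x => ENNReal.ofReal_le_ofReal (one_sub_exp_div_le _ hα)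
  · filter_upwards [h0] with x hx
    exact (ENNReal.continuous_ofReal.tendsto _).comp (tendsto_one_sub_exp_div hx)

end Laplace

/-! ### First and second order behaviour of the exponent at the origin -/

section Exponent

variable {c ρ : ℝ} {ν : Measure ℝ}

theorem ae_pos_restrict_Ioi : ∀ᵐ x ∂ν.restrict (Ioi (0 : ℝ)), 0 < x :=
  ae_restrict_mem measurableSet_Ioi

theorem ae_nonneg_restrict_Ioi : 0 ≤ᵐ[ν.restrict (Ioi (0 : ℝ))] fun x : ℝ => x :=
  ae_pos_restrict_Ioi.mono fun _ h => h.le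

theorem integrable_levy_of_min (h : ∫⁻ x in Ioi (0 : ℝ), ENNReal.ofReal (min x 1) ∂ν < ∞) {α : ℝ}
    (hα : 0 ≤ α) : IntegrableOn (fun x => 1 - Real.exp (-(α * x))) (Ioi 0) ν := by
  refine ⟨by fun_prop, ?_⟩
  rw [hasFiniteIntegral_iff_norm]
  refine lt_of_le_of_lt (lintegral_mono_ae
    (g := fun x => ENNReal.ofReal (max α 1) * ENNReal.ofReal (min x 1)) ?_) ?_
  · filter_upwards [ae_pos_restrict_Ioi] with x hx
    have h1 : 0 ≤ α * x := mul_nonneg hα hx.le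
    have h2 := Real.exp_le_one_iff.2 (neg_nonpos.2 h1)
    rw [← ENNReal.ofReal_mul (by positivity), Real.norm_eq_abs, abs_of_nonneg (by linarith)]
    refine ENNReal.ofReal_le_ofReal ?_
    rcases le_total x 1 with h | h
    · rw [min_eq_left h]
      nlinarith [one_sub_exp_neg_le (α * x), le_max_left α 1]
    · rw [min_eq_right h]
      linarith [Real.exp_pos (-(α * x)), le_max_right α 1]
  · rw [lintegral_const_mul _ (by fun_prop)]
    exact ENNReal.mul_lt_top ENNReal.ofReal_lt_top h

variable (hx : IntegrableOn (fun x : ℝ => x) (Ioi 0) ν)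

include hx in
theorem hasDerivWithinAt_levyExponent {α : ℝ} (hα : 0 ≤ α) :
    HasDerivWithinAt (levyExponent c ν)
      (c + ∫ x in Ioi (0 : ℝ), x * Real.exp (-(α * x)) ∂ν) (Ici 0) α := by
  have h := hasDerivWithinAt_integral_one_sub_exp hx ae_nonneg_restrict_Ioi hα
  have h1 : HasDerivWithinAt (fun a : ℝ => c * a) c (Ici 0) α := by
    simpa using ((hasDerivAt_id α).const_mul c).hasDerivWithinAt
  exact h1.add h

theorem levyExponent_zero : levyExponent c ν 0 = 0 := by simp [levyExponent]

/-- The mean of a subordinator in terms of its characteristics. -/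
theorem mean_eq_drift_add_integral {Ω : Type*} {m : MeasurableSpace Ω} {P : Measure Ω}
    [IsProbabilityMeasure P] {J : ℝ≥0 → Ω → ℝ} (h0 : 0 ≤ᵐ[P] J 1) (hmean : Integrable (J 1) P)
    (hcν : HasLevyCharacteristics P J c ν) :
    IntegrableOn (fun x : ℝ => x) (Ioi 0) ν ∧
      ∫ ω, J 1 ω ∂P = c + ∫ x in Ioi (0 : ℝ), x ∂ν := by
  have hd := hasDerivWithinAt_integral_one_sub_exp hmean h0 le_rfl
  -- The exponent is `-log E e^{-a J_1}`, whose right derivative at `0` is the mean of `J 1`.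
  have hη : HasDerivWithinAt (levyExponent c ν) (∫ ω, J 1 ω ∂P) (Ici 0) 0 := by
    have h1 := ((hd.const_sub 1).log (by simp)).neg
    have h2 : HasDerivWithinAt (fun a => -Real.log (1 - ∫ x, (1 - Real.exp (-(a * J 1 x))) ∂P))
        (∫ ω, J 1 ω ∂P) (Ici 0) 0 := by
      simp only [zero_mul, neg_zero, Real.exp_zero, mul_one, sub_self, integral_zero, sub_zero,
        div_one, neg_neg] at h1
      exact h1
    have heq : ∀ a ∈ Ici (0 : ℝ), levyExponent c ν a
        = -Real.log (1 - ∫ x, (1 - Real.exp (-(a * J 1 x))) ∂P) := by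
      intro a ha
      have hintg : Integrable (fun ω => Real.exp (-(a * J 1 ω))) P := by
        have := (integrable_const (1 : ℝ)).sub (integrable_one_sub_exp hmean h0 ha)
        refine this.congr (Eventually.of_forall fun ω => ?_)
        simp
      rw [integral_sub (integrable_const _) hintg, hcν.lst a ha 1]
      simp
    exact h2.congr heq (heq 0 self_mem_Ici)
  have hslope := hasDerivWithinAt_iff_tendsto_slope.1 hη
  have hset : Ici (0 : ℝ) \ {0} = Ioi 0 := by ext; simp [lt_iff_le_and_ne, eq_comm]
  rw [hset] at hslope
  -- The Lévy condition only controls `min x 1`. Finiteness of `∫ x dν` follows because the slope of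
  -- the exponent minus `c` is the integral of `(1 - e^{-a x})/a`, which stays below its limit `x`,
  -- while that slope has a finite limit.
  have hfin : ∫⁻ x in Ioi (0 : ℝ), ENNReal.ofReal x ∂ν < ∞ := by
    have h1 := tendsto_lintegral_one_sub_exp_div (κ := ν.restrict (Ioi 0)) (f := fun x : ℝ => x)
      aemeasurable_id ae_nonneg_restrict_Ioi
    have h2 : Tendsto (fun a : ℝ => ENNReal.ofReal (slope (levyExponent c ν) 0 a - c)) (𝓝[>] 0)
        (𝓝 (ENNReal.ofReal (∫ ω, J 1 ω ∂P - c))) :=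
      (ENNReal.continuous_ofReal.tendsto _).comp (hslope.sub_const c)
    have h3 := tendsto_nhds_unique h1 (h2.congr' ?_)
    · rw [h3]; exact ENNReal.ofReal_lt_top
    filter_upwards [self_mem_nhdsWithin] with a (ha : 0 < a)
    rw [← ofReal_integral_eq_lintegral_ofReal ((integrable_levy_of_min hcν.levy ha.le).div_const a)]
    · rw [slope_def_field, levyExponent_zero, integral_div, levyExponent]
      rw [sub_zero, sub_zero, add_div, mul_div_cancel_right₀ _ ha.ne', add_sub_cancel_left]
    · filter_upwards [ae_pos_restrict_Ioi] with x hx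
      exact one_sub_exp_div_nonneg (le_of_lt hx) ha
  have hintg : IntegrableOn (fun x : ℝ => x) (Ioi 0) ν := by
    refine ⟨by fun_prop, ?_⟩
    rw [hasFiniteIntegral_iff_norm]
    refine lt_of_le_of_lt (lintegral_mono_ae ?_) hfin
    filter_upwards [ae_pos_restrict_Ioi] with x hx
    rw [Real.norm_eq_abs, abs_of_pos hx]
  refine ⟨hintg, ?_⟩
  have h4 := hasDerivWithinAt_levyExponent (c := c) hintg le_rfl
  have := UniqueDiffWithinAt.eq_deriv _ (uniqueDiffOn_Ici 0 0 self_mem_Ici) hη h4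
  simpa using this

variable (hρ : ρ = c + ∫ x in Ioi (0 : ℝ), x ∂ν)

include hx hρ in
-- The drift cancels against its share of `ρ`. What is left is the second order term of the exponent
-- as the integral of a nonnegative function that is at most `x²/2`.
theorem mean_sub_levyExponent_div {α : ℝ} (hα : 0 < α) :
    (ρ - levyExponent c ν α / α) / α
      = ∫ x in Ioi (0 : ℝ), (x - (1 - Real.exp (-(α * x))) / α) / α ∂ν := by
  have hi := integrable_one_sub_exp hx ae_nonneg_restrict_Ioi hα.le
  rw [integral_div, integral_sub hx (hi.div_const α), integral_div, hρ, levyExponent]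
  congr 1
  field_simp
  ring

include hx hρ in
theorem ofReal_mean_sub_levyExponent_div {α : ℝ} (hα : 0 < α) :
    ENNReal.ofReal ((ρ - levyExponent c ν α / α) / α)
      = ∫⁻ x in Ioi (0 : ℝ), ENNReal.ofReal ((x - (1 - Real.exp (-(α * x))) / α) / α) ∂ν := by
  have hi := integrable_one_sub_exp hx ae_nonneg_restrict_Ioi hα.le
  rw [mean_sub_levyExponent_div hx hρ hα,
    ofReal_integral_eq_lintegral_ofReal
      (f := fun x => (x - (1 - Real.exp (-(α * x))) / α) / α)
      ((hx.sub (hi.div_const α)).div_const α)]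
  filter_upwards with x
  exact div_nonneg (sub_nonneg.2 (one_sub_exp_div_le x hα)) hα.le

include hx hρ in
-- The second order quotient above is nonnegative. This keeps the denominators `α R - η(α)` at least
-- `α (R - ρ) > 0`.
theorem levyExponent_le {α : ℝ} (hα : 0 ≤ α) : levyExponent c ν α ≤ ρ * α := by
  rcases hα.eq_or_lt with rfl | hα
  · simp [levyExponent_zero]
  have h : 0 ≤ (ρ - levyExponent c ν α / α) / α := by
    rw [mean_sub_levyExponent_div hx hρ hα]
    exact integral_nonneg fun x => div_nonneg (sub_nonneg.2 (one_sub_exp_div_le x hα)) hα.le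
  have h2 : 0 ≤ ρ - levyExponent c ν α / α := by
    by_contra hneg
    exact absurd h (not_le.2 (div_neg_of_neg_of_pos (not_le.1 hneg) hα))
  rw [sub_nonneg, div_le_iff₀ hα] at h2
  exact h2

theorem levyExponent_nonneg (hc : 0 ≤ c) {α : ℝ} (hα : 0 ≤ α) : 0 ≤ levyExponent c ν α := by
  refine add_nonneg (mul_nonneg hc hα) (setIntegral_nonneg measurableSet_Ioi fun x hx => ?_)
  have : Real.exp (-(α * x)) ≤ 1 :=
    Real.exp_le_one_iff.2 (neg_nonpos.2 (mul_nonneg hα (le_of_lt hx)))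
  linarith

include hx hρ in
theorem ofReal_mean_sub_levyExponent_div_le {α : ℝ} (hα : 0 < α) :
    ENNReal.ofReal ((ρ - levyExponent c ν α / α) / α)
      ≤ ∫⁻ x in Ioi (0 : ℝ), ENNReal.ofReal (x ^ 2 / 2) ∂ν := by
  rw [ofReal_mean_sub_levyExponent_div hx hρ hα]
  refine lintegral_mono_ae ?_
  filter_upwards [ae_pos_restrict_Ioi] with x hx
  exact ENNReal.ofReal_le_ofReal (exp_second_order_le hx.le hα)

include hx hρ in
theorem tendsto_ofReal_mean_sub_levyExponent_div :
    Tendsto (fun α : ℝ => ENNReal.ofReal ((ρ - levyExponent c ν α / α) / α)) (𝓝[>] 0)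
      (𝓝 (∫⁻ x in Ioi (0 : ℝ), ENNReal.ofReal (x ^ 2 / 2) ∂ν)) := by
  have h : Tendsto (fun α : ℝ => ∫⁻ x in Ioi (0 : ℝ),
      ENNReal.ofReal ((x - (1 - Real.exp (-(α * x))) / α) / α) ∂ν) (𝓝[>] 0)
      (𝓝 (∫⁻ x in Ioi (0 : ℝ), ENNReal.ofReal (x ^ 2 / 2) ∂ν)) := by
    refine tendsto_lintegral_of_le_limit (fun α => by fun_prop) ?_ ?_
    · filter_upwards [self_mem_nhdsWithin] with α (hα : 0 < α)
      filter_upwards [ae_pos_restrict_Ioi] with x hx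
      exact ENNReal.ofReal_le_ofReal (exp_second_order_le hx.le hα)
    · filter_upwards [ae_pos_restrict_Ioi] with x hx
      exact (ENNReal.continuous_ofReal.tendsto _).comp (tendsto_exp_second_order hx.le)
  refine h.congr' ?_
  filter_upwards [self_mem_nhdsWithin] with α (hα : 0 < α)
  exact (ofReal_mean_sub_levyExponent_div hx hρ hα).symm

include hx hρ in
theorem tendsto_levyExponent_div :
    Tendsto (fun α : ℝ => levyExponent c ν α / α) (𝓝[>] 0) (𝓝 ρ) := by
  have h := hasDerivWithinAt_iff_tendsto_slope.1 (hasDerivWithinAt_levyExponent (c := c) hx le_rfl)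
  have hset : Ici (0 : ℝ) \ {0} = Ioi 0 := by ext; simp [lt_iff_le_and_ne, eq_comm]
  rw [hset] at h
  have hfun : slope (levyExponent c ν) 0 = fun α => levyExponent c ν α / α := by
    ext α
    simp [slope_def_field, levyExponent_zero]
  rw [hfun] at h
  simpa [hρ] using h

include hx in
/-- The one-sided second derivative of the exponent at the origin, possibly infinite. -/
theorem tendsto_second_derivative_levyExponent :
    Tendsto (fun α : ℝ => ENNReal.ofReal
        (-((derivWithin (levyExponent c ν) (Ici 0) α
          - derivWithin (levyExponent c ν) (Ici 0) 0) / α)))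
      (𝓝[>] 0) (𝓝 (∫⁻ x in Ioi (0 : ℝ), ENNReal.ofReal (x ^ 2) ∂ν)) := by
  -- The drift disappears from the difference of derivatives, and minus the quotient is the integral
  -- of `x (1 - e^{-α x})/α ≤ x²`.
  have h : Tendsto (fun α : ℝ => ∫⁻ x in Ioi (0 : ℝ),
      ENNReal.ofReal (x * ((1 - Real.exp (-(α * x))) / α)) ∂ν) (𝓝[>] 0)
      (𝓝 (∫⁻ x in Ioi (0 : ℝ), ENNReal.ofReal (x ^ 2) ∂ν)) := by
    refine tendsto_lintegral_of_le_limit (fun α => by fun_prop) ?_ ?_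
    · filter_upwards [self_mem_nhdsWithin] with α (hα : 0 < α)
      filter_upwards [ae_pos_restrict_Ioi] with x hx
      refine ENNReal.ofReal_le_ofReal ?_
      nlinarith [one_sub_exp_div_le x hα]
    · filter_upwards [ae_pos_restrict_Ioi] with x hx
      rw [sq]
      exact (ENNReal.continuous_ofReal.tendsto _).comp
        ((tendsto_one_sub_exp_div hx.le).const_mul x)
  refine h.congr' ?_
  filter_upwards [self_mem_nhdsWithin] with α (hα : 0 < α)
  have hder : ∀ a : ℝ, 0 ≤ a → derivWithin (levyExponent c ν) (Ici 0) a
      = c + ∫ x in Ioi (0 : ℝ), x * Real.exp (-(a * x)) ∂ν := fun a ha =>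
    (hasDerivWithinAt_levyExponent hx ha).derivWithin (uniqueDiffOn_Ici 0 a ha)
  have hintg : IntegrableOn (fun x => x * Real.exp (-(α * x))) (Ioi 0) ν := by
    refine Integrable.mono' hx (by fun_prop) ?_
    filter_upwards [ae_pos_restrict_Ioi] with x hx
    rw [Real.norm_eq_abs, abs_of_nonneg (by positivity)]
    have := Real.exp_le_one_iff.2 (neg_nonpos.2 (mul_nonneg hα.le hx.le))
    nlinarith
  have heq : ∀ x : ℝ, x * ((1 - Real.exp (-(α * x))) / α) = (x - x * Real.exp (-(α * x))) / α :=
    fun x => by ring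
  simp only [heq]
  rw [← ofReal_integral_eq_lintegral_ofReal (f := fun x => (x - x * Real.exp (-(α * x))) / α)
    ((hx.sub hintg).div_const α)]
  · rw [integral_div, integral_sub hx hintg, hder α hα.le, hder 0 le_rfl]
    congr 1
    simp
    ring
  · filter_upwards [ae_pos_restrict_Ioi] with x hx
    rw [Pi.zero_apply, ← heq]
    exact mul_nonneg hx.le (one_sub_exp_div_nonneg hx.le hα)

theorem lintegral_sq_div_two :
    ∫⁻ x in Ioi (0 : ℝ), ENNReal.ofReal (x ^ 2 / 2) ∂ν
      = (∫⁻ x in Ioi (0 : ℝ), ENNReal.ofReal (x ^ 2) ∂ν) / 2 := by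
  rw [ENNReal.div_eq_inv_mul, ← lintegral_const_mul _ (by fun_prop)]
  refine lintegral_congr fun x => ?_
  rw [div_eq_inv_mul, ENNReal.ofReal_mul (by norm_num), ENNReal.ofReal_inv_of_pos (by norm_num),
    ENNReal.ofReal_ofNat]

include hx hρ in
/-- The mean of a variable whose Laplace transform is that of the equilibrium law of `ν`. -/
theorem lintegral_of_equilibrium_transform {Ω : Type*} {m : MeasurableSpace Ω} {P : Measure Ω}
    [IsProbabilityMeasure P] {e : Ω → ℝ} (he : Measurable e) (h0 : ∀ᵐ ω ∂P, 0 ≤ e ω)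
    (hρ0 : 0 < ρ)
    (hlst : ∀ α : ℝ, 0 < α → ∫ ω, Real.exp (-(α * e ω)) ∂P = levyExponent c ν α / (ρ * α)) :
    ∫⁻ ω, ENNReal.ofReal (e ω) ∂P
      = (∫⁻ x in Ioi (0 : ℝ), ENNReal.ofReal (x ^ 2 / 2) ∂ν) / ENNReal.ofReal ρ := by
  have h1 := tendsto_lintegral_one_sub_exp_div he.aemeasurable h0
  have h2 := ENNReal.Tendsto.div_const (b := ENNReal.ofReal ρ)
    (tendsto_ofReal_mean_sub_levyExponent_div hx hρ) (Or.inr (by simpa using hρ0))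
  -- By the prescribed transform, `E (1 - e^{-α e})/α` equals `((ρ - η(α)/α)/α) / ρ`.
  refine tendsto_nhds_unique h1 (h2.congr' ?_)
  filter_upwards [self_mem_nhdsWithin] with α (hα : 0 < α)
  have hintg : Integrable (fun ω => Real.exp (-(α * e ω))) P := by
    refine (integrable_const (1 : ℝ)).mono' (by fun_prop) ?_
    filter_upwards [h0] with ω hω
    rw [Real.norm_eq_abs, abs_of_pos (Real.exp_pos _)]
    exact Real.exp_le_one_iff.2 (neg_nonpos.2 (mul_nonneg hα.le hω))
  rw [← ENNReal.ofReal_div_of_pos hρ0, ← ofReal_integral_eq_lintegral_ofReal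
    (f := fun ω => (1 - Real.exp (-(α * e ω))) / α) (((integrable_const (1 : ℝ)).sub hintg).div_const α)]
  · rw [integral_div, integral_sub (integrable_const _) hintg, hlst α hα]
    congr 1
    simp
    field_simp
  · filter_upwards [h0] with ω hω
    exact one_sub_exp_div_nonneg hω hα

end Exponent

end LevyStorage

namespace LevyStorage

/-! ### Optional times and the strong Markov property -/

/-- A finite random time `S` such that `{S < q}` belongs to the information at time `q`. -/
def IsOptionalTime {Ω : Type*} {m : MeasurableSpace Ω} (𝓕 : Filtration ℝ≥0 m) (S : Ω → ℝ≥0) :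
    Prop :=
  ∀ q, MeasurableSet[𝓕 q] {ω | S ω < q}

/-- The upper approximation of `x` by a multiple of `1 / (n + 1)`. -/
noncomputable def upperGrid (n : ℕ) (x : ℝ≥0) : ℝ≥0 := (⌊x * (n + 1)⌋₊ + 1) / (n + 1)

theorem lt_upperGrid (n : ℕ) (x : ℝ≥0) : x < upperGrid n x := by
  rw [upperGrid, lt_div_iff₀ (by positivity)]
  exact Nat.lt_floor_add_one _

theorem upperGrid_le (n : ℕ) (x : ℝ≥0) : upperGrid n x ≤ x + 1 / (n + 1) := by
  rw [upperGrid, add_div, ← NNReal.coe_le_coe]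
  gcongr
  rw [div_le_iff₀ (by positivity)]
  exact Nat.floor_le (zero_le)

theorem tendsto_upperGrid (x : ℝ≥0) : Tendsto (fun n => upperGrid n x) atTop (𝓝 x) := by
  refine tendsto_of_tendsto_of_tendsto_of_le_of_le tendsto_const_nhds ?_
    (fun n => (lt_upperGrid n x).le) (fun n => upperGrid_le n x)
  have := (tendsto_one_div_add_atTop_nhds_zero_nat (𝕜 := ℝ≥0)).const_add x
  simpa using this

/-- On a whole cell the grid point is one constant lying strictly above `x`. With `x = S ω`, a cell
is thus contained in an event `{S < s}` for a deterministic `s`. -/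
theorem lt_upperGrid_of_floor_eq {n k : ℕ} {x : ℝ≥0} (h : ⌊x * (n + 1)⌋₊ = k) :
    x < ((k : ℝ≥0) + 1) / (n + 1) := by
  have := lt_upperGrid n x
  rwa [upperGrid, h] at this

theorem measurable_floor_grid (n : ℕ) : Measurable fun x : ℝ≥0 => ⌊x * ((n : ℝ≥0) + 1)⌋₊ :=
  Nat.measurable_floor.comp (measurable_id.mul_const _)

section

variable {Ω : Type*} {m : MeasurableSpace Ω} {𝓕 : Filtration ℝ≥0 m} {S S' L : Ω → ℝ≥0}

namespace IsOptionalTime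

/-- The events whose intersection with `{S < q}` belongs to the information at time `q`. -/
@[reducible]
def measurableSpace (hS : IsOptionalTime 𝓕 S) : MeasurableSpace Ω where
  MeasurableSet' A := ∀ q, MeasurableSet[𝓕 q] (A ∩ {ω | S ω < q})
  measurableSet_empty q := by simp
  measurableSet_compl A hA q := by
    have : Aᶜ ∩ {ω | S ω < q} = {ω | S ω < q} \ (A ∩ {ω | S ω < q}) := by
      ext ω; simp only [mem_inter_iff, mem_compl_iff, Set.mem_sdiff]; tauto
    rw [this]
    exact (hS q).diff (hA q)
  measurableSet_iUnion A hA q := by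
    rw [iUnion_inter]
    exact MeasurableSet.iUnion fun i => hA i q

theorem measurableSpace_le (hS : IsOptionalTime 𝓕 S) : hS.measurableSpace ≤ m := by
  intro A hA
  have : A = ⋃ n : ℕ, A ∩ {ω | S ω < n} := by
    rw [← inter_iUnion]
    refine (inter_eq_left.2 fun ω _ => ?_).symm
    obtain ⟨n, hn⟩ := exists_nat_gt (S ω)
    exact mem_iUnion.2 ⟨n, hn⟩
  rw [this]
  exact MeasurableSet.iUnion fun n => 𝓕.le _ _ (hA n)

theorem measurableSpace_mono (hS : IsOptionalTime 𝓕 S) (hS' : IsOptionalTime 𝓕 S')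
    (h : ∀ ω, S ω ≤ S' ω) : hS.measurableSpace ≤ hS'.measurableSpace := by
  intro A hA q
  have : A ∩ {ω | S' ω < q} = (A ∩ {ω | S ω < q}) ∩ {ω | S' ω < q} := by
    ext ω
    simp only [mem_inter_iff, mem_ofPred_eq]
    exact ⟨fun ⟨a, b⟩ => ⟨⟨a, (h ω).trans_lt b⟩, b⟩, fun ⟨⟨a, _⟩, b⟩ => ⟨a, b⟩⟩
  rw [this]
  exact (hA q).inter (hS' q)

theorem measurable_self (hS : IsOptionalTime 𝓕 S) : Measurable[hS.measurableSpace] S := by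
  refine measurable_of_Iio fun a q => ?_
  have : S ⁻¹' Iio a ∩ {ω | S ω < q} = {ω | S ω < min a q} := by
    ext ω; simp
  rw [this]
  exact 𝓕.mono (min_le_right a q) _ (hS _)

theorem measurable_min (hS : IsOptionalTime 𝓕 S) (q : ℝ≥0) :
    Measurable[𝓕 q] fun ω => min (S ω) q := by
  refine measurable_of_Iio fun a => ?_
  rcases le_or_gt a q with h | h
  · have : (fun ω => min (S ω) q) ⁻¹' Iio a = {ω | S ω < a} := by
      ext ω; simp [h.not_gt]
    rw [this]
    exact 𝓕.mono h _ (hS _)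
  · have : (fun ω => min (S ω) q) ⁻¹' Iio a = univ := by
      ext ω; simp [h]
    rw [this]
    exact MeasurableSet.univ

theorem measurable_indicator (hS : IsOptionalTime 𝓕 S) {G : Ω → ℝ≥0∞}
    (hG : Measurable[hS.measurableSpace] G) (q : ℝ≥0) :
    Measurable[𝓕 q] ({ω | S ω < q}.indicator G) := by
  intro B hB
  rw [indicator_preimage, Set.ite]
  refine MeasurableSet.union (hG hB q) (MeasurableSet.diff ?_ (hS q))
  exact (measurable_const (a := (0 : ℝ≥0∞))) hB

/-- An optional time delayed by a time that is known when it occurs. -/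
theorem add (hS : IsOptionalTime 𝓕 S) (hL : Measurable[hS.measurableSpace] L) :
    IsOptionalTime 𝓕 fun ω => S ω + L ω := by
  intro q
  have hm : MeasurableSet[hS.measurableSpace] {ω | S ω + L ω < q} :=
    measurableSet_lt (hS.measurable_self.add hL) measurable_const
  have : {ω | S ω + L ω < q} = {ω | S ω + L ω < q} ∩ {ω | S ω < q} := by
    refine (inter_eq_left.2 fun ω h => ?_).symm
    exact lt_of_le_of_lt (le_self_add (b := L ω)) h
  rw [this]
  exact hm q

theorem add_const (hS : IsOptionalTime 𝓕 S) (t : ℝ≥0) : IsOptionalTime 𝓕 fun ω => S ω + t :=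
  hS.add measurable_const

end IsOptionalTime

variable {P : Measure Ω} {J : ℝ≥0 → Ω → ℝ}

/-- The value at `M` is the limit from the right of values at grid times, of which there are
countably many at each stage. Capping them at `q` ensures that only times up to `q` are sampled, so
the lemma applies with `𝓕 q`. -/
theorem measurable_eval_grid {m₀ : MeasurableSpace Ω} {Z : ℝ≥0 → Ω → ℝ} {q : ℝ≥0}
    (hZ : ∀ t ≤ q, Measurable (Z t)) (hr : ∀ ω t, ContinuousWithinAt (fun t => Z t ω) (Ici t) t)
    {M : Ω → ℝ≥0} (hM : Measurable M) (hMq : ∀ ω, M ω ≤ q) :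
    Measurable fun ω => Z (M ω) ω := by
  refine measurable_of_tendsto_metrizable (f := fun n ω => Z (min (upperGrid n (M ω)) q) ω)
    (fun n => ?_) ?_
  · have h1 : Measurable fun p : Ω × ℕ => Z (min (((p.2 : ℝ≥0) + 1) / (n + 1)) q) p.1 :=
      measurable_from_prod_countable_left fun k =>
        hZ (min (((k : ℝ≥0) + 1) / (n + 1)) q) (min_le_right _ _)
    have h2 : Measurable fun ω => (ω, ⌊M ω * ((n : ℝ≥0) + 1)⌋₊) :=
      measurable_id.prodMk ((measurable_floor_grid n).comp hM)
    have h3 := h1.comp h2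
    simp only [Function.comp_def] at h3
    simpa only [upperGrid] using h3
  · rw [tendsto_pi_nhds]
    intro ω
    refine (hr ω (M ω)).tendsto.comp (tendsto_nhdsWithin_iff.2 ⟨?_, ?_⟩)
    · have := (tendsto_upperGrid (M ω)).min (tendsto_const_nhds (x := q))
      rwa [min_eq_left (hMq ω)] at this
    · exact Eventually.of_forall fun n => le_min (lt_upperGrid n _).le (hMq ω)

namespace IsSubordinator

variable (hJ : IsSubordinator P 𝓕 J)

include hJ

theorem measurable (t : ℝ≥0) : Measurable (J t) := (hJ.adapted t).mono (𝓕.le t) le_rfl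

theorem nonneg (t : ℝ≥0) (ω : Ω) : 0 ≤ J t ω := by
  rw [← hJ.zero ω]
  exact hJ.mono ω zero_le

/-- On `{S < q}` the time `S` agrees with `min (S ω) q`, which is bounded by `q` and known at `q`.
-/
theorem measurable_eval_optional (hS : IsOptionalTime 𝓕 S) :
    Measurable[hS.measurableSpace] fun ω => J (S ω) ω := by
  intro B hB q
  have h := measurable_eval_grid (m₀ := 𝓕 q) (q := q) (Z := J)
    (fun t ht => (hJ.adapted t).mono (𝓕.mono ht) le_rfl) hJ.right_continuous
    (hS.measurable_min q) (fun ω => min_le_right _ _)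
  have : (fun ω => J (S ω) ω) ⁻¹' B ∩ {ω | S ω < q}
      = (fun ω => J (min (S ω) q) ω) ⁻¹' B ∩ {ω | S ω < q} := by
    ext ω
    simp only [mem_inter_iff, mem_preimage, mem_ofPred_eq, and_congr_left_iff]
    intro h
    rw [min_eq_left h.le]
  rw [this]
  exact (h hB).inter (hS q)

/-- A subordinator is jointly measurable in time and randomness. -/
theorem measurable_uncurry : Measurable fun p : Ω × ℝ≥0 => J p.2 p.1 := by
  refine measurable_of_tendsto_metrizable (f := fun n p => J (upperGrid n p.2) p.1)
    (fun n => ?_) ?_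
  · have h1 : Measurable fun p : Ω × ℕ => J (((p.2 : ℝ≥0) + 1) / (n + 1)) p.1 :=
      measurable_from_prod_countable_left fun k =>
        hJ.measurable (((k : ℝ≥0) + 1) / (n + 1))
    have h2 : Measurable fun p : Ω × ℝ≥0 => (p.1, ⌊p.2 * ((n : ℝ≥0) + 1)⌋₊) :=
      measurable_fst.prodMk ((measurable_floor_grid n).comp measurable_snd)
    have h3 := h1.comp h2
    simp only [Function.comp_def] at h3
    simpa only [upperGrid] using h3
  · rw [tendsto_pi_nhds]
    rintro ⟨ω, t⟩
    refine (hJ.right_continuous ω t).tendsto.comp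
      (tendsto_nhdsWithin_iff.2 ⟨tendsto_upperGrid t, ?_⟩)
    exact Eventually.of_forall fun n => (lt_upperGrid n _).le

theorem lintegral_exp_increment [IsProbabilityMeasure P] {α η : ℝ} (hα : 0 ≤ α)
    (hlst : ∀ t : ℝ≥0, ∫ ω, Real.exp (-(α * J t ω)) ∂P = Real.exp (-(η * t))) (s t : ℝ≥0) :
    ∫⁻ ω, ENNReal.ofReal (Real.exp (-(α * (J (s + t) ω - J s ω)))) ∂P
      = ENNReal.ofReal (Real.exp (-(η * t))) := by
  have h1 : ∫⁻ ω, ENNReal.ofReal (Real.exp (-(α * (J (s + t) ω - J s ω)))) ∂P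
      = ∫⁻ ω, ENNReal.ofReal (Real.exp (-(α * J t ω))) ∂P :=
    ((hJ.stationary s t).comp (u := fun x => ENNReal.ofReal (Real.exp (-(α * x))))
      (by fun_prop)).lintegral_eq
  rw [h1, ← hlst t, ofReal_integral_eq_lintegral_ofReal]
  · refine (integrable_const (1 : ℝ)).mono' ?_ (Eventually.of_forall fun ω => ?_)
    · have := hJ.measurable t
      fun_prop
    · rw [Real.norm_eq_abs, abs_of_pos (Real.exp_pos _)]
      exact Real.exp_le_one_iff.2 (neg_nonpos.2 (mul_nonneg hα (hJ.nonneg t ω)))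
  · exact Eventually.of_forall fun ω => (Real.exp_pos _).le

/-- Split according to the grid cells of `S` and `L`. On a cell the increment runs over a
deterministic interval from `s` to `s + t`, and the cell lies in `{S < s}`; hence `G` restricted to
it is known at `s` and independent of the increment. -/
theorem lintegral_mul_exp_increment_grid [IsProbabilityMeasure P] {α η : ℝ} (hα : 0 ≤ α)
    (hlst : ∀ t : ℝ≥0, ∫ ω, Real.exp (-(α * J t ω)) ∂P = Real.exp (-(η * t)))
    (hS : IsOptionalTime 𝓕 S) (hL : Measurable[hS.measurableSpace] L) {G : Ω → ℝ≥0∞}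
    (hG : Measurable[hS.measurableSpace] G) (n : ℕ) :
    ∫⁻ ω, G ω * ENNReal.ofReal (Real.exp
        (-(α * (J (upperGrid n (S ω) + upperGrid n (L ω)) ω - J (upperGrid n (S ω)) ω)))) ∂P
      = ∫⁻ ω, G ω * ENNReal.ofReal (Real.exp (-(η * upperGrid n (L ω)))) ∂P := by
  set K : Ω → ℕ × ℕ := fun ω => (⌊S ω * ((n : ℝ≥0) + 1)⌋₊, ⌊L ω * ((n : ℝ≥0) + 1)⌋₊) with hK
  have hKm : Measurable[hS.measurableSpace] K :=
    ((measurable_floor_grid n).comp hS.measurable_self).prodMk ((measurable_floor_grid n).comp hL)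
  have hKset : ∀ k, MeasurableSet (K ⁻¹' {k}) := fun k =>
    hS.measurableSpace_le _ (hKm (measurableSet_singleton k))
  have hdisj : Pairwise (Function.onFun Disjoint fun k => K ⁻¹' {k}) := fun a b hab =>
    Disjoint.preimage _ (disjoint_singleton.2 hab)
  have huniv : ⋃ k, K ⁻¹' {k} = univ := by
    rw [← preimage_iUnion, iUnion_of_singleton, preimage_univ]
  rw [← setLIntegral_univ, ← setLIntegral_univ (f := fun ω => _ * ENNReal.ofReal (Real.exp (-(η * _)))),
    ← huniv, lintegral_iUnion hKset hdisj, lintegral_iUnion hKset hdisj]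
  refine tsum_congr fun ⟨k, l⟩ => ?_
  set s : ℝ≥0 := ((k : ℝ≥0) + 1) / (n + 1) with hs
  set t : ℝ≥0 := ((l : ℝ≥0) + 1) / (n + 1) with ht
  have hmem : ∀ ω ∈ K ⁻¹' {(k, l)}, upperGrid n (S ω) = s ∧ upperGrid n (L ω) = t ∧ S ω < s := by
    intro ω hω
    simp only [hK, mem_preimage, mem_singleton_iff, Prod.mk.injEq] at hω
    exact ⟨by rw [upperGrid, hω.1], by rw [upperGrid, hω.2], lt_upperGrid_of_floor_eq hω.1⟩
  set G' : Ω → ℝ≥0∞ := (K ⁻¹' {(k, l)}).indicator G with hG'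
  have hG'm : Measurable[𝓕 s] G' := by
    have h1 : Measurable[hS.measurableSpace] G' :=
      hG.indicator (hKm (measurableSet_singleton (k, l)))
    have h2 : {ω | S ω < s}.indicator G' = G' := by
      rw [indicator_eq_self]
      intro ω hω
      by_contra h
      refine hω (indicator_of_notMem (fun h' => h (hmem ω h').2.2) _)
    rw [← h2]
    exact hS.measurable_indicator h1 s
  set Δ : Ω → ℝ := fun ω => J (s + t) ω - J s ω with hΔ
  have hΔm : Measurable Δ := (hJ.measurable _).sub (hJ.measurable _)
  have hprod := lintegral_mul_eq_lintegral_mul_lintegral_of_independent_measurableSpace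
    (𝓕.le s) hΔm.comap_le (hJ.indep s t) hG'm
    (g := fun ω => ENNReal.ofReal (Real.exp (-(α * Δ ω))))
    ((by fun_prop : Measurable fun x : ℝ => ENNReal.ofReal (Real.exp (-(α * x)))).comp
      (comap_measurable Δ))
  rw [hJ.lintegral_exp_increment hα hlst s t] at hprod
  calc ∫⁻ ω in K ⁻¹' {(k, l)}, G ω * ENNReal.ofReal (Real.exp
        (-(α * (J (upperGrid n (S ω) + upperGrid n (L ω)) ω - J (upperGrid n (S ω)) ω)))) ∂P
      = ∫⁻ ω in K ⁻¹' {(k, l)}, G ω * ENNReal.ofReal (Real.exp (-(α * Δ ω))) ∂P := by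
        refine setLIntegral_congr_fun (hKset _) fun ω hω => ?_
        obtain ⟨h1, h2, -⟩ := hmem ω hω
        simp only [h1, h2, hΔ]
    _ = ∫⁻ ω, (G' * fun ω => ENNReal.ofReal (Real.exp (-(α * Δ ω)))) ω ∂P := by
        rw [← lintegral_indicator (hKset _)]
        refine lintegral_congr fun ω => ?_
        by_cases h : ω ∈ K ⁻¹' {(k, l)}
        · simp only [hG', Pi.mul_apply, indicator_of_mem h]
        · simp only [hG', Pi.mul_apply, indicator_of_notMem h, zero_mul]
    _ = (∫⁻ ω, G' ω ∂P) * ENNReal.ofReal (Real.exp (-(η * t))) := hprod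
    _ = ∫⁻ ω in K ⁻¹' {(k, l)}, G ω * ENNReal.ofReal (Real.exp (-(η * t))) ∂P := by
        rw [lintegral_mul_const' _ _ ENNReal.ofReal_ne_top, hG', lintegral_indicator (hKset _)]
    _ = _ := by
        refine setLIntegral_congr_fun (hKset _) fun ω hω => ?_
        obtain ⟨h1, h2, -⟩ := hmem ω hω
        simp only [h2]

theorem exp_increment_le_one {α : ℝ} (hα : 0 ≤ α) {s t : ℝ≥0} (hst : s ≤ t) (ω : Ω) :
    ENNReal.ofReal (Real.exp (-(α * (J t ω - J s ω)))) ≤ 1 := by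
  rw [ENNReal.ofReal_le_one, Real.exp_le_one_iff, neg_nonpos]
  exact mul_nonneg hα (sub_nonneg.2 (hJ.mono ω hst))

/-- The strong Markov property, for exponential functionals of an increment over a period whose
length is known at its beginning. -/
theorem lintegral_mul_exp_increment [IsProbabilityMeasure P] {α η : ℝ} (hα : 0 ≤ α) (hη : 0 ≤ η)
    (hlst : ∀ t : ℝ≥0, ∫ ω, Real.exp (-(α * J t ω)) ∂P = Real.exp (-(η * t)))
    (hS : IsOptionalTime 𝓕 S) (hL : Measurable[hS.measurableSpace] L) {G : Ω → ℝ≥0∞}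
    (hG : Measurable[hS.measurableSpace] G) :
    ∫⁻ ω, G ω * ENNReal.ofReal (Real.exp (-(α * (J (S ω + L ω) ω - J (S ω) ω)))) ∂P
      = ∫⁻ ω, G ω * ENNReal.ofReal (Real.exp (-(η * L ω))) ∂P := by
  have hSm : Measurable S := hS.measurable_self.mono hS.measurableSpace_le le_rfl
  have hLm : Measurable L := hL.mono hS.measurableSpace_le le_rfl
  have hJm : ∀ {M : Ω → ℝ≥0}, Measurable M → Measurable fun ω => J (M ω) ω := fun hM =>
    hJ.measurable_uncurry.comp (measurable_id.prodMk hM)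
  have hgrid : ∀ n, Measurable (upperGrid n) := fun n =>
    (((measurable_from_nat (f := fun k : ℕ => (k : ℝ≥0))).comp (measurable_floor_grid n)).add_const
      1).div_const _
  -- Dominated convergence along the grid needs an integrable weight, so bounded weights come first;
  -- the general `G` is the supremum of its truncations `min (G ω) k`.
  have hbdd : ∀ k : ℕ, ∀ H : Ω → ℝ≥0∞, Measurable[hS.measurableSpace] H → (∀ ω, H ω ≤ k) →
      ∫⁻ ω, H ω * ENNReal.ofReal (Real.exp (-(α * (J (S ω + L ω) ω - J (S ω) ω)))) ∂P
        = ∫⁻ ω, H ω * ENNReal.ofReal (Real.exp (-(η * L ω))) ∂P := by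
    intro k H hH hHk
    have hHm : Measurable H := hH.mono hS.measurableSpace_le le_rfl
    have hfin : ∀ ω, H ω ≠ ∞ := fun ω => ((hHk ω).trans_lt (ENNReal.natCast_lt_top k)).ne
    have hHint : ∫⁻ ω, H ω ∂P ≠ ∞ := by
      refine ((lintegral_mono hHk).trans_lt ?_).ne
      simp
    have lim1 : Tendsto (fun n => ∫⁻ ω, H ω * ENNReal.ofReal (Real.exp
        (-(α * (J (upperGrid n (S ω) + upperGrid n (L ω)) ω - J (upperGrid n (S ω)) ω)))) ∂P) atTop
        (𝓝 (∫⁻ ω, H ω * ENNReal.ofReal (Real.exp (-(α * (J (S ω + L ω) ω - J (S ω) ω)))) ∂P)) := by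
      refine tendsto_lintegral_of_dominated_convergence H (fun n => ?_) (fun n => ?_) hHint ?_
      · have h1 := hJm (((hgrid n).comp hSm).add ((hgrid n).comp hLm))
        have h2 := hJm ((hgrid n).comp hSm)
        exact hHm.mul (((h1.sub h2).const_mul α).neg.exp.ennreal_ofReal)
      · refine Eventually.of_forall fun ω => ?_
        exact mul_le_of_le_one_right' (hJ.exp_increment_le_one hα le_self_add ω)
      · refine Eventually.of_forall fun ω => ?_
        have h1 : Tendsto (fun n => J (upperGrid n (S ω)) ω) atTop (𝓝 (J (S ω) ω)) :=
          (hJ.right_continuous ω _).tendsto.comp (tendsto_nhdsWithin_iff.2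
            ⟨tendsto_upperGrid _, Eventually.of_forall fun n => (lt_upperGrid n _).le⟩)
        have h2 : Tendsto (fun n => J (upperGrid n (S ω) + upperGrid n (L ω)) ω) atTop
            (𝓝 (J (S ω + L ω) ω)) :=
          (hJ.right_continuous ω _).tendsto.comp (tendsto_nhdsWithin_iff.2
            ⟨(tendsto_upperGrid _).add (tendsto_upperGrid _), Eventually.of_forall fun n =>
              add_le_add (lt_upperGrid n _).le (lt_upperGrid n _).le⟩)
        refine ENNReal.Tendsto.const_mul ?_ (Or.inr (hfin ω))
        exact ENNReal.tendsto_ofReal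
          ((Real.continuous_exp.tendsto _).comp ((h2.sub h1).const_mul α).neg)
    have lim2 : Tendsto (fun n => ∫⁻ ω, H ω * ENNReal.ofReal (Real.exp
        (-(η * upperGrid n (L ω)))) ∂P) atTop
        (𝓝 (∫⁻ ω, H ω * ENNReal.ofReal (Real.exp (-(η * L ω))) ∂P)) := by
      refine tendsto_lintegral_of_dominated_convergence H (fun n => ?_) (fun n => ?_) hHint ?_
      · have h1 := ((hgrid n).comp hLm).coe_nnreal_real
        exact hHm.mul ((h1.const_mul η).neg.exp.ennreal_ofReal)
      · refine Eventually.of_forall fun ω => mul_le_of_le_one_right' ?_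
        rw [ENNReal.ofReal_le_one, Real.exp_le_one_iff, neg_nonpos]
        positivity
      · refine Eventually.of_forall fun ω => ENNReal.Tendsto.const_mul ?_ (Or.inr (hfin ω))
        have h1 : Tendsto (fun n => ((upperGrid n (L ω) : ℝ≥0) : ℝ)) atTop (𝓝 (L ω : ℝ)) :=
          NNReal.tendsto_coe.2 (tendsto_upperGrid _)
        exact ENNReal.tendsto_ofReal ((Real.continuous_exp.tendsto _).comp (h1.const_mul η).neg)
    refine tendsto_nhds_unique lim1 (lim2.congr fun n => ?_)
    exact (hJ.lintegral_mul_exp_increment_grid hα hlst hS hL hH n).symm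
  have hsup : ∀ ω, G ω = ⨆ k : ℕ, min (G ω) k := fun ω => by
    rw [← inf_iSup_eq, ENNReal.iSup_natCast, inf_top_eq]
  have hGm : Measurable G := hG.mono hS.measurableSpace_le le_rfl
  have hlift : ∀ F : Ω → ℝ≥0∞, Measurable F → ∫⁻ ω, G ω * F ω ∂P
      = ⨆ k : ℕ, ∫⁻ ω, min (G ω) k * F ω ∂P := by
    intro F hF
    rw [← lintegral_iSup (f := fun (k : ℕ) ω => min (G ω) k * F ω)
      (fun k => (hGm.min measurable_const).mul hF)]
    · refine lintegral_congr fun ω => ?_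
      rw [← ENNReal.iSup_mul, ← hsup]
    · intro i j hij ω
      exact mul_le_mul_left (min_le_min le_rfl (by exact_mod_cast hij)) _
  have hJL : Measurable fun ω => J (S ω + L ω) ω := hJm (hSm.add hLm)
  have hJS : Measurable fun ω => J (S ω) ω := hJm hSm
  rw [hlift (fun ω => ENNReal.ofReal (Real.exp (-(α * (J (S ω + L ω) ω - J (S ω) ω)))))
    ((hJL.sub hJS).const_mul α).neg.exp.ennreal_ofReal, hlift (fun ω => ENNReal.ofReal (Real.exp (-(η * L ω)))) (by fun_prop)]
  exact iSup_congr fun k => hbdd k _ (hG.min measurable_const) fun ω => min_le_right _ _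

end IsSubordinator

end

end LevyStorage

namespace LevyStorage

/-! ### First passage of a drained subordinator -/

section Paths

variable {Ω : Type*} (J : ℝ≥0 → Ω → ℝ) (S : Ω → ℝ≥0) (W R : Ω → ℝ)

/-- The level, `s` units of time after `S`, of a store that contains `W` at `S`, is fed by `J` and
drained at rate `R`. -/
def drain (ω : Ω) (s : ℝ≥0) : ℝ := W ω + (J (S ω + s) ω - J (S ω) ω) - R ω * s

/-- The time that the free level process needs to become negative. -/
noncomputable def drainTime (ω : Ω) : ℝ≥0∞ :=
  ⨅ (s : ℝ≥0) (_ : drain J S W R ω s < 0), (s : ℝ≥0∞)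

variable {J S W R}

theorem drain_zero (ω : Ω) : drain J S W R ω 0 = W ω := by simp [drain]

theorem continuousWithinAt_drain
    (hJ : ∀ ω t, ContinuousWithinAt (fun t => J t ω) (Ici t) t) (ω : Ω) (s : ℝ≥0) :
    ContinuousWithinAt (drain J S W R ω) (Ici s) s := by
  have h1 : ContinuousWithinAt (fun s => J (S ω + s) ω) (Ici s) s := by
    refine ContinuousWithinAt.comp (t := Ici (S ω + s)) (hJ ω (S ω + s)) ?_ ?_
    · exact (continuous_const.add continuous_id).continuousWithinAt
    · intro x hx
      exact add_le_add le_rfl (mem_Ici.1 hx)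
  have h2 : ContinuousWithinAt (fun s : ℝ≥0 => R ω * (s : ℝ)) (Ici s) s := by
    apply Continuous.continuousWithinAt
    fun_prop
  exact (continuousWithinAt_const.add (h1.sub continuousWithinAt_const)).sub h2

theorem drainTime_lt_iff {ω : Ω} {t : ℝ≥0∞} :
    drainTime J S W R ω < t ↔ ∃ s : ℝ≥0, drain J S W R ω s < 0 ∧ (s : ℝ≥0∞) < t := by
  simp [drainTime, iInf_lt_iff]

theorem drainTime_le {ω : Ω} {s : ℝ≥0} (h : drain J S W R ω s < 0) :
    drainTime J S W R ω ≤ s := iInf₂_le s h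

theorem drain_nonneg_of_lt {ω : Ω} {s : ℝ≥0} (h : (s : ℝ≥0∞) < drainTime J S W R ω) :
    0 ≤ drain J S W R ω s := by
  by_contra hneg
  exact absurd (drainTime_le (not_le.1 hneg)) (not_le.2 h)

/-- By right-continuity a negative level stays negative for a while, and this interval meets the
dense set. Countably many times therefore decide whether the passage has occurred, which is the
reason to use the strict inequality in `drainTime`. -/
theorem drainTime_lt_iff_dense
    (hJ : ∀ ω t, ContinuousWithinAt (fun t => J t ω) (Ici t) t) {D : Set ℝ≥0} (hD : Dense D)
    {ω : Ω} {t : ℝ≥0} :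
    drainTime J S W R ω < t ↔ ∃ d ∈ D, drain J S W R ω d < 0 ∧ d < t := by
  rw [drainTime_lt_iff]
  constructor
  · rintro ⟨s, hs, hst⟩
    have hst : s < t := by exact_mod_cast hst
    have h1 : ∀ᶠ u in 𝓝[≥] s, drain J S W R ω u < 0 :=
      (continuousWithinAt_drain hJ ω s).eventually (eventually_lt_nhds hs)
    obtain ⟨u, hsu, hu⟩ := (mem_nhdsGE_iff_exists_Ico_subset' hst).1 h1
    obtain ⟨d, hdD, hsd, hdu⟩ := hD.exists_between (lt_min (mem_Ioi.1 hsu) hst)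
    exact ⟨d, hdD, hu ⟨hsd.le, hdu.trans_le (min_le_left _ _)⟩, hdu.trans_le (min_le_right _ _)⟩
  · rintro ⟨d, -, hd, hdt⟩
    exact ⟨d, hd, by exact_mod_cast hdt⟩

/-- The level does not jump downwards, so that it vanishes at the first passage. -/
theorem drain_drainTime (hmono : ∀ ω, Monotone fun t => J t ω)
    (hJ : ∀ ω t, ContinuousWithinAt (fun t => J t ω) (Ici t) t) {ω : Ω} (hW : 0 ≤ W ω) {t : ℝ≥0}
    (ht : drainTime J S W R ω = t) : drain J S W R ω t = 0 := by
  refine le_antisymm ?_ ?_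
  -- A positive level at `t` would remain positive just after `t`, where negative levels have to
  -- occur.
  · by_contra! hpos
    have h1 : ∀ᶠ u in 𝓝[≥] t, 0 < drain J S W R ω u :=
      (continuousWithinAt_drain hJ ω t).eventually (eventually_gt_nhds hpos)
    obtain ⟨u, htu, hu⟩ := (mem_nhdsGE_iff_exists_Ico_subset' (lt_add_one t)).1 h1
    have hlt : drainTime J S W R ω < u := by rw [ht]; exact_mod_cast mem_Ioi.1 htu
    obtain ⟨s, hs, hsu⟩ := drainTime_lt_iff.1 hlt
    have hts : t ≤ s := by
      have := drainTime_le hs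
      rw [ht] at this
      exact_mod_cast this
    exact absurd (hu ⟨hts, by exact_mod_cast hsu⟩) (not_lt.2 hs.le)
  · by_contra! hneg
    rcases eq_or_ne t 0 with rfl | ht0
    · rw [drain_zero] at hneg
      exact absurd hW (not_le.2 hneg)
    -- Freeze the input at its value at `S + t`. This continuous function dominates the level before
    -- `t` because `J` is nondecreasing; if it is negative at `t`, then the level is already
    -- negative slightly earlier.
    have hcont : Continuous fun s : ℝ≥0 => W ω + (J (S ω + t) ω - J (S ω) ω) - R ω * (s : ℝ) := by
      fun_prop
    have h1 : ∀ᶠ s : ℝ≥0 in 𝓝 t, W ω + (J (S ω + t) ω - J (S ω) ω) - R ω * (s : ℝ) < 0 :=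
      (hcont.tendsto t).eventually (eventually_lt_nhds hneg)
    obtain ⟨l, hl, hls⟩ := exists_Ioc_subset_of_mem_nhds h1 ⟨0, pos_iff_ne_zero.2 ht0⟩
    obtain ⟨s, hs1, hs2⟩ := exists_between hl
    have hs : W ω + (J (S ω + t) ω - J (S ω) ω) - R ω * (s : ℝ) < 0 := hls ⟨hs1, hs2.le⟩
    have hm : J (S ω + s) ω ≤ J (S ω + t) ω := hmono ω (add_le_add le_rfl hs2.le)
    have h0 : 0 ≤ drain J S W R ω s := drain_nonneg_of_lt (by rw [ht]; exact_mod_cast hs2)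
    rw [drain] at h0
    linarith

theorem drain_nonneg_of_le (hmono : ∀ ω, Monotone fun t => J t ω)
    (hJ : ∀ ω t, ContinuousWithinAt (fun t => J t ω) (Ici t) t) {ω : Ω} (hW : 0 ≤ W ω) {s : ℝ≥0}
    (h : (s : ℝ≥0∞) ≤ drainTime J S W R ω) : 0 ≤ drain J S W R ω s := by
  rcases h.lt_or_eq with h | h
  · exact drain_nonneg_of_lt h
  · exact (drain_drainTime hmono hJ hW h.symm).ge

end Paths

/-! ### First passage as an optional time and its Laplace transform -/

section Optional

variable {Ω : Type*} {m : MeasurableSpace Ω} {P : Measure Ω} {𝓕 : Filtration ℝ≥0 m}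
  {J : ℝ≥0 → Ω → ℝ} {S : Ω → ℝ≥0} {W R : Ω → ℝ}
  (hJ : IsSubordinator P 𝓕 J) (hS : IsOptionalTime 𝓕 S)
  (hW : Measurable[hS.measurableSpace] W) (hR : Measurable[hS.measurableSpace] R)

theorem toNNReal_min_drainTime_lt_iff {ω : Ω} {t : ℝ≥0} :
    (min (drainTime J S W R ω) t).toNNReal < t ↔ drainTime J S W R ω < t := by
  rw [← ENNReal.coe_lt_coe, ENNReal.coe_toNNReal (by simp)]
  simp

theorem toNNReal_min_drainTime_le {ω : Ω} {t : ℝ≥0} :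
    (min (drainTime J S W R ω) t).toNNReal ≤ t := by
  rw [← ENNReal.coe_le_coe, ENNReal.coe_toNNReal (by simp)]
  exact min_le_right _ _

include hJ hW hR

theorem measurable_drain (s : ℝ≥0) :
    Measurable[(hS.add_const s).measurableSpace] fun ω => drain J S W R ω s := by
  have hle : hS.measurableSpace ≤ (hS.add_const s).measurableSpace :=
    hS.measurableSpace_mono _ fun ω => le_self_add
  have h1 := hJ.measurable_eval_optional (hS.add_const s)
  have h2 := (hJ.measurable_eval_optional hS).mono hle le_rfl
  exact ((hW.mono hle le_rfl).add (h1.sub h2)).sub ((hR.mono hle le_rfl).mul_const _)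

/-- The cap `t` makes the time finite. The time is below `q` if `S + t < q`, or if the level is
negative at some `d` in a countable dense set with `S + d < q`; the level at `d` is known at `S +
d`. -/
theorem isOptionalTime_add_min_drainTime (t : ℝ≥0) :
    IsOptionalTime 𝓕 fun ω => S ω + (min (drainTime J S W R ω) t).toNNReal := by
  intro q
  obtain ⟨D, hDc, hD⟩ := TopologicalSpace.exists_countable_dense ℝ≥0
  have hset : {ω | S ω + (min (drainTime J S W R ω) t).toNNReal < q}
      = {ω | S ω + t < q} ∪ ⋃ d ∈ D, {ω | drain J S W R ω d < 0} ∩ {ω | S ω + d < q} := by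
    ext ω
    simp only [mem_ofPred_eq, mem_union, mem_iUnion, mem_inter_iff, exists_prop]
    constructor
    · intro h
      rcases le_or_gt (t : ℝ≥0∞) (drainTime J S W R ω) with hle | hlt
      · left
        rwa [min_eq_right hle, ENNReal.toNNReal_coe] at h
      · right
        rw [min_eq_left hlt.le] at h
        have hlt' : drainTime J S W R ω < (q - S ω : ℝ≥0) := by
          rw [← ENNReal.coe_toNNReal (ne_top_of_lt hlt), ENNReal.coe_lt_coe]
          exact lt_tsub_iff_left.2 h
        obtain ⟨d, hdD, hd, hdq⟩ := (drainTime_lt_iff_dense hJ.right_continuous hD).1 hlt'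
        exact ⟨d, hdD, hd, lt_tsub_iff_left.1 hdq⟩
    · rintro (h | ⟨d, -, hd, hdq⟩)
      · exact lt_of_le_of_lt (add_le_add le_rfl toNNReal_min_drainTime_le) h
      · refine lt_of_le_of_lt (add_le_add le_rfl ?_) hdq
        rw [← ENNReal.coe_le_coe, ENNReal.coe_toNNReal (by simp)]
        exact (min_le_left _ _).trans (drainTime_le hd)
  rw [hset]
  refine (hS.add_const t q).union (MeasurableSet.biUnion hDc fun d _ => ?_)
  exact (measurable_drain hJ hS hW hR d measurableSet_Iio) q

theorem measurable_drainTime : Measurable (drainTime J S W R) := by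
  obtain ⟨D, hDc, hD⟩ := TopologicalSpace.exists_countable_dense ℝ≥0
  have hset : ∀ t : ℝ≥0, MeasurableSet {ω | drainTime J S W R ω < t} := by
    intro t
    have : {ω | drainTime J S W R ω < t} = ⋃ d ∈ {d ∈ D | d < t}, {ω | drain J S W R ω d < 0} := by
      ext ω
      simp only [mem_ofPred_eq, mem_iUnion, exists_prop,
        drainTime_lt_iff_dense hJ.right_continuous hD]
      exact ⟨fun ⟨d, h1, h2, h3⟩ => ⟨d, ⟨h1, h3⟩, h2⟩, fun ⟨d, ⟨h1, h3⟩, h2⟩ => ⟨d, h1, h2, h3⟩⟩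
    rw [this]
    refine MeasurableSet.biUnion (hDc.mono (sep_subset _ _)) fun d _ => ?_
    exact (hS.add_const d).measurableSpace_le _ (measurable_drain hJ hS hW hR d measurableSet_Iio)
  refine measurable_of_Iio fun a => ?_
  rcases eq_or_ne a ∞ with rfl | ha
  · have : drainTime J S W R ⁻¹' Iio ∞ = ⋃ n : ℕ, {ω | drainTime J S W R ω < (n : ℝ≥0)} := by
      ext ω
      simp only [mem_preimage, mem_Iio, mem_iUnion, mem_ofPred_eq, ENNReal.coe_natCast]
      exact ⟨fun h => ENNReal.exists_nat_gt h.ne, fun ⟨n, h⟩ => h.trans (ENNReal.natCast_lt_top n)⟩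
    rw [this]
    exact MeasurableSet.iUnion fun n => hset n
  · lift a to ℝ≥0 using ha
    exact hset a

variable [IsProbabilityMeasure P] {α η : ℝ} (hα : 0 ≤ α) (hη : 0 ≤ η)
  (hlst : ∀ t : ℝ≥0, ∫ ω, Real.exp (-(α * J t ω)) ∂P = Real.exp (-(η * t)))
  {G : Ω → ℝ≥0∞} (hG : Measurable[hS.measurableSpace] G)

include hα hη hlst hG

/-- Strong Markov property at `S` over the fixed length `t`; the remaining factor of the exponential
involves only `W` and `R`, which are known at `S`. -/
theorem lintegral_mul_exp_drain (t : ℝ≥0) :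
    ∫⁻ ω, G ω * ENNReal.ofReal (Real.exp (-(α * drain J S W R ω t))) ∂P
      = ∫⁻ ω, G ω * ENNReal.ofReal (Real.exp (-(α * W ω) + (α * R ω - η) * t)) ∂P := by
  have hG' : Measurable[hS.measurableSpace] fun ω =>
      G ω * ENNReal.ofReal (Real.exp (-(α * W ω) + α * R ω * t)) :=
    hG.mul ((((hW.const_mul α).neg).add ((hR.const_mul α).mul_const _)).exp.ennreal_ofReal)
  have h := hJ.lintegral_mul_exp_increment hα hη hlst hS (L := fun _ => t) measurable_const hG'
  calc _ = _ := lintegral_congr fun ω => ?_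
    _ = _ := h
    _ = _ := lintegral_congr fun ω => ?_
  · rw [mul_assoc, ← ENNReal.ofReal_mul (Real.exp_pos _).le, ← Real.exp_add]
    congr 3
    rw [drain]; ring
  · rw [mul_assoc, ← ENNReal.ofReal_mul (Real.exp_pos _).le, ← Real.exp_add]
    congr 3
    ring

/-- Strong Markov property at `S` plus the capped passage time, over the remaining length, which is
then known. At the passage the level restarts from zero, so the remaining input contributes `e^{-η
(t - T)}` and the drainage `e^{α R (t - T)}`. -/
theorem lintegral_mul_exp_drain_after (hW0 : ∀ ω, 0 ≤ W ω) (t : ℝ≥0) :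
    ∫⁻ ω in {ω | drainTime J S W R ω < t},
        G ω * ENNReal.ofReal (Real.exp (-(α * drain J S W R ω t))) ∂P
      = ∫⁻ ω in {ω | drainTime J S W R ω < t}, G ω * ENNReal.ofReal
          (Real.exp ((α * R ω - η) * (t - (drainTime J S W R ω).toReal))) ∂P := by
  have hT := measurable_drainTime hJ hS hW hR
  have hset : MeasurableSet {ω | drainTime J S W R ω < t} := measurableSet_lt hT measurable_const
  set M : Ω → ℝ≥0 := fun ω => (min (drainTime J S W R ω) t).toNNReal with hM
  have hσ : IsOptionalTime 𝓕 fun ω => S ω + M ω :=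
    isOptionalTime_add_min_drainTime hJ hS hW hR t
  have hle : hS.measurableSpace ≤ hσ.measurableSpace :=
    hS.measurableSpace_mono _ fun ω => le_self_add
  have hSσ : Measurable[hσ.measurableSpace] S := hS.measurable_self.mono hle le_rfl
  have hMσ : Measurable[hσ.measurableSpace] M := by
    convert hσ.measurable_self.sub hSσ using 1
    ext ω
    simp
  have hMt : ∀ ω, M ω ≤ t := fun ω => toNNReal_min_drainTime_le
  have hseteq : {ω | drainTime J S W R ω < t} = {ω | M ω < t} := by
    ext ω
    exact toNNReal_min_drainTime_lt_iff.symm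
  have hsetσ : MeasurableSet[hσ.measurableSpace] {ω | drainTime J S W R ω < t} := by
    rw [hseteq]
    exact measurableSet_lt hMσ measurable_const
  have hJσ := hJ.measurable_eval_optional hσ
  have hJS := (hJ.measurable_eval_optional hS).mono hle le_rfl
  -- This weight collects the factors of `e^{-α · level}` already determined at the capped passage,
  -- leaving only the later increment of `J`.
  have hG' : Measurable[hσ.measurableSpace] ({ω | drainTime J S W R ω < t}.indicator fun ω =>
      G ω * ENNReal.ofReal (Real.exp (-(α * W ω) + α * R ω * t
        + -(α * (J (S ω + M ω) ω - J (S ω) ω))))) := by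
    refine Measurable.indicator ?_ hsetσ
    refine (hG.mono hle le_rfl).mul (Measurable.ennreal_ofReal (Measurable.exp ?_))
    exact ((((hW.mono hle le_rfl).const_mul α).neg).add
      (((hR.mono hle le_rfl).const_mul α).mul_const _)).add ((hJσ.sub hJS).const_mul α).neg
  have h := hJ.lintegral_mul_exp_increment hα hη hlst hσ (L := fun ω => t - M ω)
    (measurable_const.sub hMσ) hG'
  rw [← lintegral_indicator hset, ← lintegral_indicator hset]
  calc _ = _ := lintegral_congr fun ω => ?_
    _ = _ := h
    _ = _ := lintegral_congr fun ω => ?_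
  · by_cases hω : ω ∈ {ω | drainTime J S W R ω < t}
    · simp only [indicator_of_mem hω]
      rw [mul_assoc, ← ENNReal.ofReal_mul (Real.exp_pos _).le, ← Real.exp_add, add_assoc (S ω),
        add_tsub_cancel_of_le (hMt ω)]
      congr 3
      rw [drain]; ring
    · simp only [indicator_of_notMem hω, zero_mul]
  · by_cases hω : ω ∈ {ω | drainTime J S W R ω < t}
    · simp only [indicator_of_mem hω]
      have hfin : drainTime J S W R ω ≠ ∞ := ne_top_of_lt hω
      have hMω : M ω = (drainTime J S W R ω).toNNReal := by
        rw [hM]; simp only; rw [min_eq_left (le_of_lt hω)]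
      have hreal : ((M ω : ℝ≥0) : ℝ) = (drainTime J S W R ω).toReal := by
        rw [hMω]; rfl
      have hzero := drain_drainTime hJ.mono hJ.right_continuous (hW0 ω)
        (ENNReal.coe_toNNReal hfin).symm
      rw [← hMω, drain] at hzero
      rw [mul_assoc, ← ENNReal.ofReal_mul (Real.exp_pos _).le, ← Real.exp_add,
        NNReal.coe_sub (hMt ω), ← hreal]
      congr 3
      linear_combination (-α) * hzero
    · simp only [indicator_of_notMem hω, zero_mul]

/-- Decomposition of the exponential functional of the level at `t` at the first passage. -/
theorem lintegral_mul_exp_drain_split (hW0 : ∀ ω, 0 ≤ W ω) (t : ℝ≥0) :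
    ∫⁻ ω in {ω | (t : ℝ≥0∞) ≤ drainTime J S W R ω},
        G ω * ENNReal.ofReal (Real.exp (-(α * drain J S W R ω t))) ∂P
      + ∫⁻ ω in {ω | drainTime J S W R ω < t}, G ω * ENNReal.ofReal
          (Real.exp ((α * R ω - η) * (t - (drainTime J S W R ω).toReal))) ∂P
      = ∫⁻ ω, G ω * ENNReal.ofReal (Real.exp (-(α * W ω) + (α * R ω - η) * t)) ∂P := by
  have hT := measurable_drainTime hJ hS hW hR
  have hset : MeasurableSet {ω | drainTime J S W R ω < t} := measurableSet_lt hT measurable_const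
  rw [← lintegral_mul_exp_drain_after hJ hS hW hR hα hη hlst hG hW0 t,
    ← lintegral_mul_exp_drain hJ hS hW hR hα hη hlst hG t, add_comm]
  have h := lintegral_add_compl (μ := P)
    (fun ω => G ω * ENNReal.ofReal (Real.exp (-(α * drain J S W R ω t)))) hset
  simpa only [compl_ofPred, not_lt] using h

omit hG

/-- The Laplace transform of the first passage time. -/
theorem lintegral_exp_drainTime (hW0 : ∀ ω, 0 ≤ W ω) (hφ : ∀ᵐ ω ∂P, 0 < α * R ω - η) :
    ∫⁻ ω in {ω | drainTime J S W R ω < ∞}, ENNReal.ofReal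
        (Real.exp (-((α * R ω - η) * (drainTime J S W R ω).toReal))) ∂P
      = ∫⁻ ω, ENNReal.ofReal (Real.exp (-(α * W ω))) ∂P := by
  have hT := measurable_drainTime hJ hS hW hR
  have hRm : Measurable R := hR.mono hS.measurableSpace_le le_rfl
  have hset : ∀ t : ℝ≥0∞, MeasurableSet {ω | drainTime J S W R ω < t} := fun t =>
    measurableSet_lt hT measurable_const
  have hset' : ∀ t : ℝ≥0∞, MeasurableSet {ω | t ≤ drainTime J S W R ω} := fun t =>
    measurableSet_le measurable_const hT
  have hdrain : ∀ t, Measurable fun ω => drain J S W R ω t := fun t =>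
    (measurable_drain hJ hS hW hR t).mono (hS.add_const t).measurableSpace_le le_rfl
  -- With the weight `e^{-φ n}` the right side of the decomposition no longer depends on `n`, and
  -- the part after the passage becomes `e^{-φ T}`.
  have hsplit : ∀ n : ℕ, (∫⁻ ω, {ω | (n : ℝ≥0∞) ≤ drainTime J S W R ω}.indicator (fun ω =>
        ENNReal.ofReal (Real.exp (-((α * R ω - η) * n)))
          * ENNReal.ofReal (Real.exp (-(α * drain J S W R ω n)))) ω ∂P)
      + ∫⁻ ω, {ω | drainTime J S W R ω < n}.indicator (fun ω => ENNReal.ofReal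
          (Real.exp (-((α * R ω - η) * (drainTime J S W R ω).toReal)))) ω ∂P
      = ∫⁻ ω, ENNReal.ofReal (Real.exp (-(α * W ω))) ∂P := by
    intro n
    have h := lintegral_mul_exp_drain_split hJ hS hW hR hα hη hlst
      (G := fun ω => ENNReal.ofReal (Real.exp (-((α * R ω - η) * n))))
      ((((hR.const_mul α).sub_const η).mul_const _).neg.exp.ennreal_ofReal) hW0 n
    rw [lintegral_indicator (hset' _), lintegral_indicator (hset _)]
    refine Eq.trans ?_ (h.trans ?_)
    · congr 1
      refine lintegral_congr fun ω => ?_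
      rw [← ENNReal.ofReal_mul (Real.exp_pos _).le, ← Real.exp_add]
      congr 2
      push_cast
      ring
    · refine lintegral_congr fun ω => ?_
      rw [← ENNReal.ofReal_mul (Real.exp_pos _).le, ← Real.exp_add]
      congr 2
      push_cast
      ring
  have lim1 : Tendsto (fun n : ℕ => ∫⁻ ω, {ω | (n : ℝ≥0∞) ≤ drainTime J S W R ω}.indicator
      (fun ω => ENNReal.ofReal (Real.exp (-((α * R ω - η) * n)))
          * ENNReal.ofReal (Real.exp (-(α * drain J S W R ω n)))) ω ∂P) atTop
      (𝓝 (∫⁻ _, 0 ∂P)) := by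
    -- Up to the passage the level is nonnegative, so the first term is at most `e^{-φ n}` and
    -- vanishes in the limit.
    have hbound : ∀ n : ℕ, ∀ ω, {ω | (n : ℝ≥0∞) ≤ drainTime J S W R ω}.indicator
        (fun ω => ENNReal.ofReal (Real.exp (-((α * R ω - η) * n)))
          * ENNReal.ofReal (Real.exp (-(α * drain J S W R ω n)))) ω
        ≤ ENNReal.ofReal (Real.exp (-((α * R ω - η) * n))) := by
      intro n ω
      by_cases hω : ω ∈ {ω | (n : ℝ≥0∞) ≤ drainTime J S W R ω}
      swap
      · rw [indicator_of_notMem hω]; exact zero_le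
      rw [indicator_of_mem hω]
      refine (mul_le_mul_right ?_ _).trans_eq (mul_one _)
      rw [ENNReal.ofReal_le_one, Real.exp_le_one_iff, neg_nonpos]
      exact mul_nonneg hα (drain_nonneg_of_le hJ.mono hJ.right_continuous (hW0 ω) hω)
    refine tendsto_lintegral_of_dominated_convergence (fun _ => 1) (fun n => ?_) (fun n => ?_)
      (by simp) ?_
    · have := hdrain n
      refine Measurable.indicator ?_ (hset' _)
      fun_prop
    · filter_upwards [hφ] with ω hω
      refine (hbound n ω).trans ?_
      rw [ENNReal.ofReal_le_one, Real.exp_le_one_iff, neg_nonpos]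
      positivity
    · filter_upwards [hφ] with ω hω
      refine tendsto_of_tendsto_of_tendsto_of_le_of_le tendsto_const_nhds ?_ (fun n => zero_le)
        (fun n => hbound n ω)
      rw [← ENNReal.ofReal_zero]
      refine ENNReal.tendsto_ofReal (Real.tendsto_exp_neg_atTop_nhds_zero.comp ?_)
      exact tendsto_natCast_atTop_atTop.const_mul_atTop hω
  have lim2 : Tendsto (fun n : ℕ => ∫⁻ ω, {ω | drainTime J S W R ω < n}.indicator
      (fun ω => ENNReal.ofReal
          (Real.exp (-((α * R ω - η) * (drainTime J S W R ω).toReal)))) ω ∂P) atTop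
      (𝓝 (∫⁻ ω, {ω | drainTime J S W R ω < ∞}.indicator (fun ω => ENNReal.ofReal
          (Real.exp (-((α * R ω - η) * (drainTime J S W R ω).toReal)))) ω ∂P)) := by
    refine lintegral_tendsto_of_tendsto_of_monotone (fun n => ?_) ?_ ?_
    · refine (Measurable.indicator ?_ (hset _)).aemeasurable
      fun_prop
    · refine Eventually.of_forall fun ω i j hij => ?_
      refine indicator_le_indicator_of_subset (fun ω hω => ?_) (fun _ => zero_le) ω
      have hω : drainTime J S W R ω < (i : ℝ≥0∞) := hω
      exact hω.trans_le (by exact_mod_cast hij)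
    · refine Eventually.of_forall fun ω => ?_
      by_cases hω : drainTime J S W R ω < ∞
      · obtain ⟨k, hk⟩ := ENNReal.exists_nat_gt hω.ne
        refine tendsto_const_nhds.congr' ?_
        filter_upwards [eventually_ge_atTop k] with n hn
        rw [indicator_of_mem (by exact hω), indicator_of_mem]
        exact lt_of_lt_of_le hk (by exact_mod_cast hn)
      · rw [indicator_of_notMem (by exact hω)]
        refine tendsto_const_nhds.congr fun n => ?_
        rw [indicator_of_notMem]
        exact fun h => hω (lt_of_lt_of_le h le_top)
  have lim := lim1.add lim2
  simp only [hsplit, lintegral_zero, zero_add] at lim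
  rw [← lintegral_indicator (hset _)]
  exact tendsto_nhds_unique lim tendsto_const_nhds

end Optional

end LevyStorage

namespace LevyStorage

/-! ### The occupation identity of Kella and Whitt -/

theorem lintegral_Ioc_exp_mul_sub {φ a b : ℝ} (hφ : 0 < φ) (hab : a ≤ b) :
    ∫⁻ s in Ioc a b, ENNReal.ofReal (Real.exp (φ * (s - a)))
      = ENNReal.ofReal ((Real.exp (φ * (b - a)) - 1) / φ) := by
  have hcont : Continuous fun s => Real.exp (φ * (s - a)) := by fun_prop
  have hintg : IntegrableOn (fun s => Real.exp (φ * (s - a))) (Ioc a b) :=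
    (hcont.integrableOn_Icc (a := a) (b := b)).mono_set Ioc_subset_Icc_self
  rw [← ofReal_integral_eq_lintegral_ofReal hintg
    (Eventually.of_forall fun s => (Real.exp_pos _).le), ← intervalIntegral.integral_of_le hab]
  have hderiv : ∀ s ∈ uIcc a b,
      HasDerivAt (fun s => Real.exp (φ * (s - a)) / φ) (Real.exp (φ * (s - a))) s := by
    intro s _
    have h1 : HasDerivAt (fun s : ℝ => φ * (s - a)) (φ * 1) s :=
      ((hasDerivAt_id s).sub_const a).const_mul φ
    have h2 := h1.exp.div_const φ
    rwa [mul_one, mul_div_assoc, div_self hφ.ne', mul_one] at h2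
  rw [intervalIntegral.integral_eq_sub_of_hasDerivAt hderiv (hcont.intervalIntegrable _ _)]
  congr 1
  simp [sub_div]

section Occupation

variable {Ω : Type*} {m : MeasurableSpace Ω} {P : Measure Ω} {𝓕 : Filtration ℝ≥0 m}
  {J : ℝ≥0 → Ω → ℝ} {S : Ω → ℝ≥0} {W R : Ω → ℝ}
  (hJ : IsSubordinator P 𝓕 J) (hS : IsOptionalTime 𝓕 S)
  (hW : Measurable[hS.measurableSpace] W) (hR : Measurable[hS.measurableSpace] R)

include hJ hW hR

theorem measurable_drain_uncurry :
    Measurable fun p : Ω × ℝ => drain J S W R p.1 p.2.toNNReal := by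
  have hSm : Measurable S := hS.measurable_self.mono hS.measurableSpace_le le_rfl
  have hWm : Measurable W := hW.mono hS.measurableSpace_le le_rfl
  have hRm : Measurable R := hR.mono hS.measurableSpace_le le_rfl
  have h1 : Measurable fun p : Ω × ℝ => J (S p.1 + p.2.toNNReal) p.1 :=
    hJ.measurable_uncurry.comp (measurable_fst.prodMk
      ((hSm.comp measurable_fst).add measurable_snd.real_toNNReal))
  have h2 : Measurable fun p : Ω × ℝ => J (S p.1) p.1 :=
    hJ.measurable_uncurry.comp (measurable_fst.prodMk (hSm.comp measurable_fst))
  exact ((hWm.comp measurable_fst).add (h1.sub h2)).sub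
    ((hRm.comp measurable_fst).mul measurable_snd.real_toNNReal.coe_nnreal_real)

variable [IsProbabilityMeasure P] {α η : ℝ} (hα : 0 ≤ α) (hη : 0 ≤ η)
  (hlst : ∀ t : ℝ≥0, ∫ ω, Real.exp (-(α * J t ω)) ∂P = Real.exp (-(η * t)))
  {G : Ω → ℝ≥0∞} (hG : Measurable[hS.measurableSpace] G)

include hα hη hlst hG

/-- Let `φ = α R - η`. Integrate the decomposition at `s` over `(0, t]` with weight `G`, and take
the decomposition at `t` with weight `G/φ`. Since `φ` times the integral of `e^{φ (s - a)}` over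
`(a, t]` is `e^{φ (t - a)} - 1`, their difference only involves the level up to the passage: it is
the Kella-Whitt martingale identity at the passage capped by `t`, arranged without subtraction. The
term to be cancelled must be finite, whence `hfin`. -/
theorem lintegral_mul_occupation_horizon (hW0 : ∀ ω, 0 ≤ W ω)
    (hφ : ∀ ω, G ω ≠ 0 → 0 < α * R ω - η) (t : ℝ≥0)
    (hfin : ∫⁻ ω in {ω | drainTime J S W R ω < t}, G ω * ENNReal.ofReal (1 / (α * R ω - η))
      * ENNReal.ofReal (Real.exp ((α * R ω - η) * (t - (drainTime J S W R ω).toReal))) ∂P ≠ ∞) :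
    (∫⁻ ω, G ω * (∫⁻ s in Ioc (0 : ℝ) t,
        {s : ℝ | ENNReal.ofReal s ≤ drainTime J S W R ω}.indicator
          (fun s => ENNReal.ofReal (Real.exp (-(α * drain J S W R ω s.toNNReal)))) s) ∂P)
      + ∫⁻ ω, G ω * ENNReal.ofReal (1 / (α * R ω - η))
          * ENNReal.ofReal (Real.exp (-(α * W ω))) ∂P
      = (∫⁻ ω in {ω | (t : ℝ≥0∞) ≤ drainTime J S W R ω}, G ω * ENNReal.ofReal (1 / (α * R ω - η))
          * ENNReal.ofReal (Real.exp (-(α * drain J S W R ω t))) ∂P)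
        + ∫⁻ ω in {ω | drainTime J S W R ω < t}, G ω * ENNReal.ofReal (1 / (α * R ω - η)) ∂P := by
  have hT := measurable_drainTime hJ hS hW hR
  have hWm : Measurable W := hW.mono hS.measurableSpace_le le_rfl
  have hRm : Measurable R := hR.mono hS.measurableSpace_le le_rfl
  have hGm : Measurable G := hG.mono hS.measurableSpace_le le_rfl
  have hdr := measurable_drain_uncurry hJ hS hW hR
  set T := drainTime J S W R with hTdef
  set H : Ω → ℝ≥0∞ := fun ω => G ω * ENNReal.ofReal (1 / (α * R ω - η)) with hH
  have hHm : Measurable H := by fun_prop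
  have hHS : Measurable[hS.measurableSpace] H :=
    hG.mul (((measurable_const.div ((hR.const_mul α).sub_const η))).ennreal_ofReal)
  have hlt : MeasurableSet {ω | T ω < t} := measurableSet_lt hT measurable_const
  let F1 : Ω → ℝ → ℝ≥0∞ := fun ω s => G ω * {s : ℝ | ENNReal.ofReal s ≤ T ω}.indicator
    (fun s => ENNReal.ofReal (Real.exp (-(α * drain J S W R ω s.toNNReal)))) s
  let F2 : Ω → ℝ → ℝ≥0∞ := fun ω s => G ω * {s : ℝ | T ω < ENNReal.ofReal s}.indicator
    (fun s => ENNReal.ofReal (Real.exp ((α * R ω - η) * (s - (T ω).toReal)))) s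
  let F3 : Ω → ℝ → ℝ≥0∞ := fun ω s =>
    G ω * ENNReal.ofReal (Real.exp (-(α * W ω) + (α * R ω - η) * s))
  have hF1 : Measurable (Function.uncurry F1) := by
    refine (hGm.comp measurable_fst).mul ?_
    have h1 : Measurable fun p : Ω × ℝ =>
        ENNReal.ofReal (Real.exp (-(α * drain J S W R p.1 p.2.toNNReal))) :=
      (hdr.const_mul α).neg.exp.ennreal_ofReal
    exact h1.indicator (s := {p : Ω × ℝ | ENNReal.ofReal p.2 ≤ T p.1})
      (measurableSet_le measurable_snd.ennreal_ofReal (hT.comp measurable_fst))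
  have hF2 : Measurable (Function.uncurry F2) := by
    refine (hGm.comp measurable_fst).mul ?_
    have h1 : Measurable fun p : Ω × ℝ =>
        ENNReal.ofReal (Real.exp ((α * R p.1 - η) * (p.2 - (T p.1).toReal))) := by fun_prop
    exact h1.indicator (s := {p : Ω × ℝ | T p.1 < ENNReal.ofReal p.2})
      (measurableSet_lt (hT.comp measurable_fst) measurable_snd.ennreal_ofReal)
  have hF3 : Measurable (Function.uncurry F3) := by
    simp only [F3, Function.uncurry_def]; fun_prop
  -- Tonelli's theorem, with the decomposition applied at each fixed time `s`.
  have hsum : ∫⁻ ω, (∫⁻ s in Ioc (0 : ℝ) t, F1 ω s) ∂P + ∫⁻ ω, (∫⁻ s in Ioc (0 : ℝ) t, F2 ω s) ∂P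
      = ∫⁻ ω, (∫⁻ s in Ioc (0 : ℝ) t, F3 ω s) ∂P := by
    rw [lintegral_lintegral_swap hF1.aemeasurable, lintegral_lintegral_swap hF2.aemeasurable,
      lintegral_lintegral_swap hF3.aemeasurable,
      ← lintegral_add_left (f := fun s => ∫⁻ ω, F1 ω s ∂P) hF1.lintegral_prod_left']
    refine setLIntegral_congr_fun measurableSet_Ioc fun s hs => ?_
    have h := lintegral_mul_exp_drain_split hJ hS hW hR hα hη hlst hG hW0 s.toNNReal
    have hs0 : ((s.toNNReal : ℝ≥0) : ℝ) = s := Real.coe_toNNReal s hs.1.le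
    rw [hs0] at h
    refine Eq.trans ?_ h
    congr 1
    · rw [← lintegral_indicator (measurableSet_le measurable_const hT)]
      refine lintegral_congr fun ω => ?_
      by_cases hω : ENNReal.ofReal s ≤ T ω
      · simp only [F1]
        rw [indicator_of_mem (by exact hω), indicator_of_mem (by exact hω)]
      · simp only [F1]
        rw [indicator_of_notMem (by exact hω), indicator_of_notMem (by exact hω), mul_zero]
    · rw [← lintegral_indicator (measurableSet_lt hT measurable_const)]
      refine lintegral_congr fun ω => ?_
      by_cases hω : T ω < ENNReal.ofReal s
      · simp only [F2]
        rw [indicator_of_mem (by exact hω), indicator_of_mem (by exact hω)]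
      · simp only [F2]
        rw [indicator_of_notMem (by exact hω), indicator_of_notMem (by exact hω), mul_zero]
  -- Exact integration of `e^{φ (s - T)}` over the time from the passage to the horizon.
  have h2 : ∫⁻ ω, (∫⁻ s in Ioc (0 : ℝ) t, F2 ω s) ∂P + ∫⁻ ω in {ω | T ω < t}, H ω ∂P
      = ∫⁻ ω in {ω | T ω < t}, H ω * ENNReal.ofReal
          (Real.exp ((α * R ω - η) * (t - (T ω).toReal))) ∂P := by
    rw [← lintegral_indicator hlt, ← lintegral_indicator hlt,
      ← lintegral_add_right _ (hHm.indicator hlt)]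
    refine lintegral_congr fun ω => ?_
    rcases eq_or_ne (G ω) 0 with hG0 | hG0
    · have hH0 : H ω = 0 := by simp [hH, hG0]
      simp [F2, hG0, Set.indicator, hH0]
    have hpos := hφ ω hG0
    have hinner : ∫⁻ s in Ioc (0 : ℝ) t, F2 ω s
        = G ω * ∫⁻ s in Ioc (0 : ℝ) t, {s : ℝ | T ω < ENNReal.ofReal s}.indicator
            (fun s => ENNReal.ofReal (Real.exp ((α * R ω - η) * (s - (T ω).toReal)))) s := by
      refine lintegral_const_mul _ (Measurable.indicator (by fun_prop)
        (measurableSet_lt measurable_const measurable_id.ennreal_ofReal))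
    rw [hinner]
    by_cases hω : T ω < t
    · rw [indicator_of_mem (by exact hω), indicator_of_mem (by exact hω)]
      have hne : T ω ≠ ∞ := ne_top_of_lt hω
      have hTt : (T ω).toReal ≤ t := by
        have := ENNReal.toReal_mono ENNReal.coe_ne_top hω.le
        simpa using this
      rw [setLIntegral_indicator (s := {s : ℝ | T ω < ENNReal.ofReal s})
        (measurableSet_lt measurable_const measurable_id.ennreal_ofReal)]
      have hset : {s : ℝ | T ω < ENNReal.ofReal s} ∩ Ioc (0 : ℝ) t = Ioc (T ω).toReal t := by
        ext s
        simp only [mem_inter_iff, mem_ofPred_eq, mem_Ioc]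
        rw [ENNReal.lt_ofReal_iff_toReal_lt hne]
        exact ⟨fun ⟨a, b, c⟩ => ⟨a, c⟩, fun ⟨a, c⟩ => ⟨a, ENNReal.toReal_nonneg.trans_lt a, c⟩⟩
      rw [hset, lintegral_Ioc_exp_mul_sub hpos hTt]
      simp only [hH]
      rw [← mul_add, mul_assoc, ← ENNReal.ofReal_mul (by positivity), ← ENNReal.ofReal_add]
      · congr 2
        field_simp
        ring
      · refine div_nonneg (sub_nonneg.2 (Real.one_le_exp ?_)) hpos.le
        exact mul_nonneg hpos.le (sub_nonneg.2 hTt)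
      · positivity
    · rw [indicator_of_notMem (by exact hω), indicator_of_notMem (by exact hω), add_zero]
      rw [setLIntegral_congr_fun (g := fun _ => 0) measurableSet_Ioc, lintegral_zero, mul_zero]
      intro s hs
      refine indicator_of_notMem (fun h => hω ?_) _
      refine lt_of_lt_of_le h ?_
      rw [← ENNReal.ofReal_coe_nnreal]
      exact ENNReal.ofReal_le_ofReal hs.2
  have h3 : ∫⁻ ω, (∫⁻ s in Ioc (0 : ℝ) t, F3 ω s) ∂P
        + ∫⁻ ω, H ω * ENNReal.ofReal (Real.exp (-(α * W ω))) ∂P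
      = ∫⁻ ω, H ω * ENNReal.ofReal (Real.exp (-(α * W ω) + (α * R ω - η) * t)) ∂P := by
    rw [← lintegral_add_right _ (by fun_prop)]
    refine lintegral_congr fun ω => ?_
    rcases eq_or_ne (G ω) 0 with hG0 | hG0
    · simp [F3, hG0, hH]
    have hpos := hφ ω hG0
    have hinner : ∫⁻ s in Ioc (0 : ℝ) t, F3 ω s = G ω * (ENNReal.ofReal (Real.exp (-(α * W ω)))
        * ∫⁻ s in Ioc (0 : ℝ) t, ENNReal.ofReal (Real.exp ((α * R ω - η) * (s - 0)))) := by
      rw [← lintegral_const_mul _ (by fun_prop), ← lintegral_const_mul _ (by fun_prop)]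
      refine lintegral_congr fun s => ?_
      rw [← ENNReal.ofReal_mul (Real.exp_pos _).le, ← Real.exp_add, sub_zero]
    rw [hinner, lintegral_Ioc_exp_mul_sub hpos t.coe_nonneg]
    simp only [hH]
    rw [mul_assoc, ← mul_add, mul_assoc, ← ENNReal.ofReal_mul (Real.exp_pos _).le,
      ← ENNReal.ofReal_mul (by positivity), ← ENNReal.ofReal_mul (by positivity),
      ← ENNReal.ofReal_add, Real.exp_add]
    · congr 2
      field_simp
      ring_nf
    · refine mul_nonneg (Real.exp_pos _).le (div_nonneg (sub_nonneg.2 (Real.one_le_exp ?_)) hpos.le)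
      exact mul_nonneg hpos.le (by simp)
    · positivity
  have h4 := lintegral_mul_exp_drain_split hJ hS hW hR hα hη hlst hHS hW0 t
  have h1 : ∀ ω, ∫⁻ s in Ioc (0 : ℝ) t, F1 ω s = G ω * ∫⁻ s in Ioc (0 : ℝ) t,
      {s : ℝ | ENNReal.ofReal s ≤ T ω}.indicator
        (fun s => ENNReal.ofReal (Real.exp (-(α * drain J S W R ω s.toNNReal)))) s := by
    intro ω
    refine lintegral_const_mul _ (Measurable.indicator ?_
      (measurableSet_le measurable_id.ennreal_ofReal measurable_const))
    exact ((hdr.comp (measurable_const.prodMk measurable_id)).const_mul α).neg.exp.ennreal_ofReal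
  simp only [h1] at hsum
  rw [← h4, ← hsum] at h3
  -- Add the exponential term after the passage to both sides; it is finite, so it can be cancelled.
  refine (ENNReal.add_left_inj hfin).1 ?_
  change _ + ∫⁻ ω in {ω | T ω < t}, H ω * ENNReal.ofReal
    (Real.exp ((α * R ω - η) * (t - (T ω).toReal))) ∂P = _ + ∫⁻ ω in {ω | T ω < t}, H ω *
      ENNReal.ofReal (Real.exp ((α * R ω - η) * (t - (T ω).toReal))) ∂P
  rw [add_right_comm _ (∫⁻ ω in {ω | T ω < t}, H ω ∂P), ← h3, ← h2]
  ring

end Occupation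

end LevyStorage

namespace LevyStorage

/-! ### The occupation identity over the whole period -/

section Mean

variable {Ω : Type*} {m : MeasurableSpace Ω} {P : Measure Ω} [IsProbabilityMeasure P]
  {𝓕 : Filtration ℝ≥0 m} {J : ℝ≥0 → Ω → ℝ} {S : Ω → ℝ≥0} {W R : Ω → ℝ} {c ρ : ℝ} {ν : Measure ℝ}
  (hJ : IsSubordinator P 𝓕 J) (hS : IsOptionalTime 𝓕 S)
  (hW : Measurable[hS.measurableSpace] W) (hR : Measurable[hS.measurableSpace] R)
  (hcν : HasLevyCharacteristics P J c ν) (hx : IntegrableOn (fun x : ℝ => x) (Ioi 0) ν)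
  (hρ : ρ = c + ∫ x in Ioi (0 : ℝ), x ∂ν) (hRρ : ∀ᵐ ω ∂P, ρ < R ω) (hW0 : ∀ ω, 0 ≤ W ω)

include hx hρ in
theorem mul_sub_levyExponent_pos {α r : ℝ} (hα : 0 < α) (hr : ρ < r) :
    0 < α * r - levyExponent c ν α := by
  have := levyExponent_le hx hρ hα.le
  nlinarith

include hJ hW hR hcν hx hρ hRρ hW0

/-- The transform of the passage time is at most `P (T < ∞)`, and it equals `E e^{-α W}`, which
tends to `1` as `α ↓ 0`. -/
theorem ae_drainTime_lt_top : ∀ᵐ ω ∂P, drainTime J S W R ω < ∞ := by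
  have hT := measurable_drainTime hJ hS hW hR
  have hWm : Measurable W := hW.mono hS.measurableSpace_le le_rfl
  have hset : MeasurableSet {ω | drainTime J S W R ω < ∞} := measurableSet_lt hT measurable_const
  have hle : ∀ α : ℝ, 0 < α → ∫⁻ ω, ENNReal.ofReal (Real.exp (-(α * W ω))) ∂P
      ≤ P {ω | drainTime J S W R ω < ∞} := by
    intro α hα
    rw [← lintegral_exp_drainTime hJ hS hW hR hα.le (levyExponent_nonneg hcν.drift_nonneg hα.le)
      (hcν.lst α hα.le) hW0 (hRρ.mono fun ω h => mul_sub_levyExponent_pos hx hρ hα h),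
      ← setLIntegral_one]
    refine lintegral_mono_ae (ae_restrict_of_ae ?_)
    filter_upwards [hRρ] with ω hω
    rw [ENNReal.ofReal_le_one, Real.exp_le_one_iff, neg_nonpos]
    exact mul_nonneg (mul_sub_levyExponent_pos hx hρ hα hω).le ENNReal.toReal_nonneg
  have hlim : Tendsto (fun α : ℝ => ∫⁻ ω, ENNReal.ofReal (Real.exp (-(α * W ω))) ∂P) (𝓝[>] 0)
      (𝓝 (∫⁻ _, 1 ∂P)) := by
    refine tendsto_lintegral_of_le_limit (fun α => by fun_prop) ?_ ?_
    · filter_upwards [self_mem_nhdsWithin] with α (hα : 0 < α)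
      refine Eventually.of_forall fun ω => ?_
      rw [ENNReal.ofReal_le_one, Real.exp_le_one_iff, neg_nonpos]
      exact mul_nonneg hα.le (hW0 ω)
    · refine Eventually.of_forall fun ω => ?_
      have h := (Real.continuous_exp.tendsto _).comp (tendsto_mul_nhdsGT_zero (W ω)).neg
      simpa using ENNReal.tendsto_ofReal h
  have h1 : 1 ≤ P {ω | drainTime J S W R ω < ∞} := by
    have := le_of_tendsto hlim (eventually_mem_nhdsWithin.mono fun α hα => hle α hα)
    simpa using this
  exact (mem_ae_iff_prob_eq_one hset).2 (le_antisymm prob_le_one h1)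

omit hx hρ hRρ in
-- On `A` both `1/φ` and, for a fixed horizon, `e^{φ n}` are bounded, so the cancellations in `ℝ≥0∞`
-- are legitimate; moreover `A` is known at `S`. As the horizon tends to infinity, finiteness of `T`
-- removes the term with the level at the horizon.
theorem lintegral_mul_occupation {α : ℝ} (hα : 0 < α)
    (hT : ∀ᵐ ω ∂P, drainTime J S W R ω < ∞) (K : ℕ) :
    let A := {ω | R ω ≤ K ∧ 1 / ((K : ℝ) + 1) ≤ α * R ω - levyExponent c ν α}
    ∫⁻ ω in A, (∫⁻ s in Ioi (0 : ℝ), {s : ℝ | ENNReal.ofReal s ≤ drainTime J S W R ω}.indicator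
          (fun s => ENNReal.ofReal (Real.exp (-(α * drain J S W R ω s.toNNReal)))) s) ∂P
      = ∫⁻ ω in A, ENNReal.ofReal
          ((1 - Real.exp (-(α * W ω))) / (α * R ω - levyExponent c ν α)) ∂P := by
  intro A
  have hη := levyExponent_nonneg (ν := ν) hcν.drift_nonneg hα.le
  set η := levyExponent c ν α with hηdef
  have hTm := measurable_drainTime hJ hS hW hR
  have hWm : Measurable W := hW.mono hS.measurableSpace_le le_rfl
  have hRm : Measurable R := hR.mono hS.measurableSpace_le le_rfl
  have hdr := measurable_drain_uncurry hJ hS hW hR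
  have hAS : MeasurableSet[hS.measurableSpace] A :=
    (measurableSet_le hR measurable_const).inter
      (measurableSet_le measurable_const ((hR.const_mul α).sub_const η))
  have hA : MeasurableSet A := hS.measurableSpace_le _ hAS
  have hpos : ∀ ω ∈ A, 0 < α * R ω - η := fun ω hω =>
    lt_of_lt_of_le (by positivity) hω.2
  have hinv : ∀ ω ∈ A, 1 / (α * R ω - η) ≤ (K : ℝ) + 1 := by
    intro ω hω
    have h := one_div_le_one_div_of_le (by positivity) hω.2
    rwa [one_div_one_div] at h
  set G : Ω → ℝ≥0∞ := A.indicator fun _ => 1 with hG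
  have hGS : Measurable[hS.measurableSpace] G := measurable_const.indicator hAS
  have hGA : ∀ f : Ω → ℝ≥0∞, ∀ B : Set Ω, MeasurableSet B →
      ∫⁻ ω in B, G ω * f ω ∂P = ∫⁻ ω in A, B.indicator f ω ∂P := by
    intro f B hB
    rw [← lintegral_indicator hB, ← lintegral_indicator hA]
    refine lintegral_congr fun ω => ?_
    by_cases h1 : ω ∈ A <;> by_cases h2 : ω ∈ B <;> simp [hG, h1, h2]
  set T := drainTime J S W R with hTdef
  have hlt : ∀ n : ℕ, MeasurableSet {ω | T ω < n} := fun n => measurableSet_lt hTm measurable_const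
  have hge : ∀ n : ℕ, MeasurableSet {ω | (n : ℝ≥0∞) ≤ T ω} := fun n =>
    measurableSet_le measurable_const hTm
  set f : Ω → ℝ → ℝ≥0∞ := fun ω => {s : ℝ | ENNReal.ofReal s ≤ T ω}.indicator
          (fun s => ENNReal.ofReal (Real.exp (-(α * drain J S W R ω s.toNNReal)))) with hf
  have hfm : Measurable (Function.uncurry f) := by
    have h1 : Measurable fun p : Ω × ℝ =>
        ENNReal.ofReal (Real.exp (-(α * drain J S W R p.1 p.2.toNNReal))) :=
      (hdr.const_mul α).neg.exp.ennreal_ofReal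
    exact h1.indicator (s := {p : Ω × ℝ | ENNReal.ofReal p.2 ≤ T p.1})
      (measurableSet_le measurable_snd.ennreal_ofReal (hTm.comp measurable_fst))
  set q : Ω → ℝ≥0∞ := fun ω => ENNReal.ofReal (1 / (α * R ω - η)) with hq
  have hqm : Measurable q := by fun_prop
  have hqint : ∫⁻ ω in A, q ω ∂P ≠ ∞ := by
    refine ((setLIntegral_mono' hA (g := fun _ => ENNReal.ofReal ((K : ℝ) + 1))
      fun ω hω => ENNReal.ofReal_le_ofReal (hinv ω hω)).trans_lt ?_).ne
    rw [setLIntegral_const]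
    exact ENNReal.mul_lt_top ENNReal.ofReal_lt_top (measure_lt_top _ _)
  have hKW : ∀ n : ℕ, (∫⁻ ω in A, (∫⁻ s in Ioc (0 : ℝ) n, f ω s) ∂P)
      + ∫⁻ ω in A, q ω * ENNReal.ofReal (Real.exp (-(α * W ω))) ∂P
      = (∫⁻ ω in A, {ω | (n : ℝ≥0∞) ≤ T ω}.indicator
          (fun ω => q ω * ENNReal.ofReal (Real.exp (-(α * drain J S W R ω n)))) ω ∂P)
        + ∫⁻ ω in A, {ω | T ω < n}.indicator q ω ∂P := by
    intro n
    have h := lintegral_mul_occupation_horizon hJ hS hW hR hα.le hη (hcν.lst α hα.le) hGS hW0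
      (fun ω hω => hpos ω (by by_contra h; exact hω (indicator_of_notMem h _))) n ?_
    · simp only [mul_assoc] at h
      rw [hGA _ _ (by exact_mod_cast hge n), hGA _ _ (by exact_mod_cast hlt n)] at h
      have hu : ∀ f : Ω → ℝ≥0∞, ∫⁻ ω, G ω * f ω ∂P = ∫⁻ ω in A, f ω ∂P := by
        intro f
        have := hGA f univ MeasurableSet.univ
        simpa using this
      rw [hu, hu] at h
      exact_mod_cast h
    · simp only [mul_assoc]
      rw [hGA _ _ (by exact_mod_cast hlt n)]
      -- On `A`, `1/φ ≤ K + 1`, and `φ ≤ α K` because `R ≤ K` and the exponent is nonnegative.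
      refine ((setLIntegral_mono' hA (g := fun _ => ENNReal.ofReal (((K : ℝ) + 1)
        * Real.exp (α * K * n))) fun ω hω => ?_).trans_lt ?_).ne
      · refine (indicator_le_self _ _ ω).trans ?_
        have hp := hpos ω hω
        rw [← ENNReal.ofReal_mul (by positivity)]
        refine ENNReal.ofReal_le_ofReal ?_
        refine mul_le_mul (hinv ω hω) (Real.exp_le_exp.2 ?_) (Real.exp_pos _).le (by positivity)
        have h0 : 0 ≤ (T ω).toReal := ENNReal.toReal_nonneg
        have hn : (0 : ℝ) ≤ n := Nat.cast_nonneg n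
        have h1 : α * R ω - η ≤ α * K := by nlinarith [hω.1]
        push_cast
        nlinarith [mul_nonneg hp.le h0, mul_le_mul_of_nonneg_right h1 hn]
      · rw [setLIntegral_const]
        exact ENNReal.mul_lt_top ENNReal.ofReal_lt_top (measure_lt_top _ _)
  have lim1 : Tendsto (fun n : ℕ => ∫⁻ ω in A, (∫⁻ s in Ioc (0 : ℝ) n, f ω s) ∂P) atTop
      (𝓝 (∫⁻ ω in A, (∫⁻ s in Ioi (0 : ℝ), f ω s) ∂P)) := by
    have hmono : Monotone fun n : ℕ => Ioc (0 : ℝ) n := fun i j hij =>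
      Ioc_subset_Ioc_right (by exact_mod_cast hij)
    refine lintegral_tendsto_of_tendsto_of_monotone (fun n => ?_) ?_ ?_
    · exact (Measurable.lintegral_prod_right' hfm).aemeasurable
    · exact Eventually.of_forall fun ω i j hij => lintegral_mono_set (hmono hij)
    · refine Eventually.of_forall fun ω => ?_
      have hU : Ioi (0 : ℝ) = ⋃ n : ℕ, Ioc (0 : ℝ) n := by
        ext s
        simp only [mem_Ioi, mem_iUnion, mem_Ioc]
        exact ⟨fun h => (exists_nat_ge s).imp fun n hn => ⟨h, hn⟩, fun ⟨n, h⟩ => h.1⟩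
      rw [hU, setLIntegral_iUnion_of_directed _ hmono.directed_le]
      exact tendsto_atTop_iSup fun i j hij => lintegral_mono_set (hmono hij)
  have lim2 : Tendsto (fun n : ℕ => ∫⁻ ω in A, {ω | (n : ℝ≥0∞) ≤ T ω}.indicator
          (fun ω => q ω * ENNReal.ofReal (Real.exp (-(α * drain J S W R ω n)))) ω ∂P) atTop
      (𝓝 (∫⁻ ω in A, 0 ∂P)) := by
    refine tendsto_lintegral_of_dominated_convergence q (fun n => ?_) (fun n => ?_) hqint ?_
    · have := (measurable_drain hJ hS hW hR n).mono (hS.add_const n).measurableSpace_le le_rfl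
      exact (hqm.mul (this.const_mul α).neg.exp.ennreal_ofReal).indicator (hge n)
    · refine Eventually.of_forall fun ω => ?_
      by_cases hω : (n : ℝ≥0∞) ≤ T ω
      · rw [indicator_of_mem (by exact hω)]
        refine (mul_le_mul_right ?_ _).trans_eq (mul_one _)
        rw [ENNReal.ofReal_le_one, Real.exp_le_one_iff, neg_nonpos]
        refine mul_nonneg hα.le (drain_nonneg_of_le hJ.mono hJ.right_continuous (hW0 ω) ?_)
        exact_mod_cast hω
      · rw [indicator_of_notMem (by exact hω)]
        exact zero_le
    · refine ae_restrict_of_ae ?_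
      filter_upwards [hT] with ω hω
      obtain ⟨k, hk⟩ := ENNReal.exists_nat_gt hω.ne
      refine tendsto_const_nhds.congr' ?_
      filter_upwards [eventually_ge_atTop k] with n hn
      rw [indicator_of_notMem]
      exact not_le.2 (hk.trans_le (by exact_mod_cast hn))
  have lim3 : Tendsto (fun n : ℕ => ∫⁻ ω in A, {ω | T ω < n}.indicator q ω ∂P) atTop
      (𝓝 (∫⁻ ω in A, q ω ∂P)) := by
    refine tendsto_lintegral_of_dominated_convergence q (fun n => hqm.indicator (hlt n))
      (fun n => Eventually.of_forall fun ω => indicator_le_self _ _ ω) hqint ?_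
    refine ae_restrict_of_ae ?_
    filter_upwards [hT] with ω hω
    obtain ⟨k, hk⟩ := ENNReal.exists_nat_gt hω.ne
    refine tendsto_const_nhds.congr' ?_
    filter_upwards [eventually_ge_atTop k] with n hn
    rw [indicator_of_mem]
    exact hk.trans_le (by exact_mod_cast hn)
  have hlim := tendsto_nhds_unique (lim1.add_const _) ((lim2.add lim3).congr fun n => (hKW n).symm)
  rw [lintegral_zero, zero_add] at hlim
  have hEint : ∫⁻ ω in A, q ω * ENNReal.ofReal (Real.exp (-(α * W ω))) ∂P ≠ ∞ := by
    refine ((lintegral_mono fun ω => ?_).trans_lt hqint.lt_top).ne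
    refine (mul_le_mul_right ?_ _).trans_eq (mul_one _)
    rw [ENNReal.ofReal_le_one, Real.exp_le_one_iff, neg_nonpos]
    exact mul_nonneg hα.le (hW0 ω)
  refine (ENNReal.add_left_inj hEint).1 (hlim.trans ?_)
  rw [← lintegral_add_right _ (by fun_prop)]
  refine setLIntegral_congr_fun hA fun ω hω => ?_
  have hp := hpos ω hω
  have he : Real.exp (-(α * W ω)) ≤ 1 :=
    Real.exp_le_one_iff.2 (neg_nonpos.2 (mul_nonneg hα.le (hW0 ω)))
  simp only [hq]
  rw [← ENNReal.ofReal_mul (by positivity), ← ENNReal.ofReal_add]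
  · congr 1
    field_simp
    ring
  · exact div_nonneg (by linarith) hp.le
  · positivity

/-- The expected exponential functional of the level over the period before the first passage. -/
theorem lintegral_occupation {α : ℝ} (hα : 0 < α) :
    ∫⁻ ω, (∫⁻ s in {s : ℝ | 0 ≤ s ∧ ENNReal.ofReal s < drainTime J S W R ω},
        ENNReal.ofReal (Real.exp (-(α * drain J S W R ω s.toNNReal)))) ∂P
      = ∫⁻ ω, ENNReal.ofReal
          ((1 - Real.exp (-(α * W ω))) / (α * R ω - levyExponent c ν α)) ∂P := by
  have hTm := measurable_drainTime hJ hS hW hR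
  have hT := ae_drainTime_lt_top hJ hS hW hR hcν hx hρ hRρ hW0
  have hWm : Measurable W := hW.mono hS.measurableSpace_le le_rfl
  have hRm : Measurable R := hR.mono hS.measurableSpace_le le_rfl
  have hdr := measurable_drain_uncurry hJ hS hW hR
  have hKW := lintegral_mul_occupation hJ hS hW hR hcν hW0 hα hT
  set T := drainTime J S W R with hTdef
  set f : Ω → ℝ → ℝ≥0∞ := fun ω => {s : ℝ | ENNReal.ofReal s ≤ T ω}.indicator
          (fun s => ENNReal.ofReal (Real.exp (-(α * drain J S W R ω s.toNNReal)))) with hf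
  have hfm : Measurable (Function.uncurry f) := by
    have h1 : Measurable fun p : Ω × ℝ =>
        ENNReal.ofReal (Real.exp (-(α * drain J S W R p.1 p.2.toNNReal))) :=
      (hdr.const_mul α).neg.exp.ennreal_ofReal
    exact h1.indicator (s := {p : Ω × ℝ | ENNReal.ofReal p.2 ≤ T p.1})
      (measurableSet_le measurable_snd.ennreal_ofReal (hTm.comp measurable_fst))
  -- The two time sets differ at most in the endpoints `0` and `T`, which have measure zero.
  have hinner : ∀ ω, ∫⁻ s in {s : ℝ | 0 ≤ s ∧ ENNReal.ofReal s < T ω},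
        ENNReal.ofReal (Real.exp (-(α * drain J S W R ω s.toNNReal)))
      = ∫⁻ s in Ioi (0 : ℝ), f ω s := by
    intro ω
    rw [hf, setLIntegral_indicator (s := {s : ℝ | ENNReal.ofReal s ≤ T ω})
      (measurableSet_le measurable_id.ennreal_ofReal measurable_const)]
    refine setLIntegral_congr ?_
    have h0 : ∀ᵐ s : ℝ, s ≠ 0 := Measure.ae_ne _ _
    have h1 : ∀ᵐ s : ℝ, s ≠ (T ω).toReal := Measure.ae_ne _ _
    filter_upwards [h0, h1] with s h0 h1
    refine propext ⟨fun h => ⟨h.2.le, lt_of_le_of_ne h.1 (Ne.symm h0)⟩, fun h => ?_⟩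
    refine ⟨le_of_lt h.2, lt_of_le_of_ne h.1 fun he => h1 ?_⟩
    rw [← he, ENNReal.toReal_ofReal (le_of_lt h.2)]
  simp only [hinner]
  -- Since `R > ρ` makes `α R - η(α)` positive, these events exhaust almost all of the space, and
  -- monotone convergence removes the localization.
  set A : ℕ → Set Ω := fun K => {ω | R ω ≤ K ∧ 1 / ((K : ℝ) + 1) ≤ α * R ω - levyExponent c ν α}
    with hA
  have hAm : ∀ K, MeasurableSet (A K) := fun K =>
    (measurableSet_le hRm measurable_const).inter
      (measurableSet_le measurable_const ((hRm.const_mul α).sub_const _))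
  have hmono : Monotone A := by
    intro i j hij ω hω
    have hij' : (i : ℝ) ≤ j := by exact_mod_cast hij
    refine ⟨hω.1.trans hij', le_trans ?_ hω.2⟩
    exact one_div_le_one_div_of_le (by positivity) (by linarith)
  have hsup : ∀ g : Ω → ℝ≥0∞, Measurable g → Tendsto (fun K => ∫⁻ ω in A K, g ω ∂P) atTop
      (𝓝 (∫⁻ ω, g ω ∂P)) := by
    intro g hg
    simp only [← lintegral_indicator (hAm _)]
    refine lintegral_tendsto_of_tendsto_of_monotone (fun n => (hg.indicator (hAm n)).aemeasurable)
      ?_ ?_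
    · exact Eventually.of_forall fun ω i j hij =>
        indicator_le_indicator_of_subset (hmono hij) (fun _ => zero_le) ω
    · filter_upwards [hRρ] with ω hω
      have hp := mul_sub_levyExponent_pos hx hρ hα hω
      obtain ⟨k, hk⟩ := exists_nat_ge (R ω)
      obtain ⟨l, hl⟩ := exists_nat_one_div_lt hp
      refine tendsto_const_nhds.congr' ?_
      filter_upwards [eventually_ge_atTop k, eventually_ge_atTop l] with n hn1 hn2
      rw [indicator_of_mem]
      have h1 : (k : ℝ) ≤ n := by exact_mod_cast hn1
      have h2 : (l : ℝ) ≤ n := by exact_mod_cast hn2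
      refine ⟨hk.trans h1, le_trans ?_ hl.le⟩
      exact one_div_le_one_div_of_le (by positivity) (by linarith)
  refine tendsto_nhds_unique (hsup _ (Measurable.lintegral_prod_right' hfm))
    ((hsup _ (by fun_prop)).congr fun K => (hKW K).symm)

end Mean

end LevyStorage

namespace LevyStorage

/-! ### Means over the period before the first passage -/

/-- The time-randomness measure of a random period of length `T`. -/
noncomputable def periodMeasure {Ω : Type*} {m : MeasurableSpace Ω} (P : Measure Ω)
    (T : Ω → ℝ≥0∞) : Measure (Ω × ℝ) :=
  (P.prod volume).restrict {p | 0 ≤ p.2 ∧ ENNReal.ofReal p.2 < T p.1}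

section Period

variable {Ω : Type*} {m : MeasurableSpace Ω} {P : Measure Ω} {T : Ω → ℝ≥0∞}

theorem measurableSet_period (hT : Measurable T) :
    MeasurableSet {p : Ω × ℝ | 0 ≤ p.2 ∧ ENNReal.ofReal p.2 < T p.1} :=
  (measurableSet_le measurable_const measurable_snd).inter
    (measurableSet_lt measurable_snd.ennreal_ofReal (hT.comp measurable_fst))

theorem measurableSet_period_section (t : ℝ≥0∞) :
    MeasurableSet {s : ℝ | 0 ≤ s ∧ ENNReal.ofReal s < t} :=
  (measurableSet_le measurable_const measurable_id).inter
    (measurableSet_lt measurable_id.ennreal_ofReal measurable_const)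

theorem lintegral_periodMeasure [SFinite P] (hT : Measurable T) {f : Ω × ℝ → ℝ≥0∞}
    (hf : Measurable f) :
    ∫⁻ p, f p ∂periodMeasure P T
      = ∫⁻ ω, (∫⁻ s in {s : ℝ | 0 ≤ s ∧ ENNReal.ofReal s < T ω}, f (ω, s)) ∂P := by
  rw [periodMeasure, ← lintegral_indicator (measurableSet_period hT),
    lintegral_prod _ (hf.indicator (measurableSet_period hT)).aemeasurable]
  refine lintegral_congr fun ω => ?_
  rw [← lintegral_indicator (measurableSet_period_section _)]
  refine lintegral_congr fun s => ?_
  by_cases h : 0 ≤ s ∧ ENNReal.ofReal s < T ω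
  · rw [indicator_of_mem (by exact h), indicator_of_mem (by exact h)]
  · rw [indicator_of_notMem (by exact h), indicator_of_notMem (by exact h)]

theorem volume_period_section (t : ℝ≥0∞) :
    volume {s : ℝ | 0 ≤ s ∧ ENNReal.ofReal s < t} = t := by
  rcases eq_or_ne t ∞ with rfl | ht
  · have : {s : ℝ | 0 ≤ s ∧ ENNReal.ofReal s < ∞} = Ici 0 := by
      ext s; simp
    rw [this, Real.volume_Ici]
  · have : {s : ℝ | 0 ≤ s ∧ ENNReal.ofReal s < t} = Ico 0 t.toReal := by
      ext s
      simp only [mem_ofPred_eq, mem_Ico, and_congr_right_iff]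
      intro hs
      rw [ENNReal.ofReal_lt_iff_lt_toReal hs ht]
    rw [this, Real.volume_Ico, sub_zero, ENNReal.ofReal_toReal ht]

theorem periodMeasure_univ [SFinite P] (hT : Measurable T) :
    periodMeasure P T univ = ∫⁻ ω, T ω ∂P := by
  rw [← lintegral_one, lintegral_periodMeasure hT measurable_const]
  refine lintegral_congr fun ω => ?_
  rw [setLIntegral_one, volume_period_section]

theorem ae_periodMeasure (hT : Measurable T) :
    ∀ᵐ p ∂periodMeasure P T, 0 ≤ p.2 ∧ ENNReal.ofReal p.2 < T p.1 :=
  ae_restrict_mem (measurableSet_period hT)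

end Period

/-! ### Mean length and mean area of an on period -/

section Mean

variable {Ω : Type*} {m : MeasurableSpace Ω} {P : Measure Ω} [IsProbabilityMeasure P]
  {𝓕 : Filtration ℝ≥0 m} {J : ℝ≥0 → Ω → ℝ} {S : Ω → ℝ≥0} {W R : Ω → ℝ} {c ρ : ℝ} {ν : Measure ℝ}
  (hJ : IsSubordinator P 𝓕 J) (hS : IsOptionalTime 𝓕 S)
  (hW : Measurable[hS.measurableSpace] W) (hR : Measurable[hS.measurableSpace] R)
  (hcν : HasLevyCharacteristics P J c ν) (hx : IntegrableOn (fun x : ℝ => x) (Ioi 0) ν)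
  (hρ : ρ = c + ∫ x in Ioi (0 : ℝ), x ∂ν) (hRρ : ∀ᵐ ω ∂P, ρ < R ω) (hW0 : ∀ ω, 0 ≤ W ω)

/-- Used with `D = R - ρ`, `φ = α R - η(α)` and `e = 1 - e^{-α w}`, so that `α (D + ρ) - φ = η(α)`.
The difference quotient splits into second order terms of `e^{-α w}` and of the exponent, both
nonnegative, whose limits are known separately. -/
theorem ratio_difference {α D φ e w ρ : ℝ} (hα : α ≠ 0) (hD : D ≠ 0) (hφ : φ ≠ 0) :
    (w / D - e / φ) / α
      = (w - e / α) / α / D + (ρ - (α * (D + ρ) - φ) / α) / α * (e / φ / D) := by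
  field_simp
  ring

include hx hρ in
-- The numerator is at most `α w` and the denominator at least `α (r - ρ)`. The bound is also the
-- limit as `α ↓ 0`, as the convergence lemma requires.
theorem one_sub_exp_div_exponent_le {α w r : ℝ} (hα : 0 < α) (hw : 0 ≤ w) (hr : ρ < r) :
    (1 - Real.exp (-(α * w))) / (α * r - levyExponent c ν α) ≤ w / (r - ρ) := by
  have h1 := levyExponent_le hx hρ hα.le
  have h2 : 0 < r - ρ := sub_pos.2 hr
  have h3 : 0 < α * r - levyExponent c ν α := mul_sub_levyExponent_pos hx hρ hα hr
  rw [div_le_div_iff₀ h3 h2]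
  have h4 := one_sub_exp_neg_le (α * w)
  calc (1 - Real.exp (-(α * w))) * (r - ρ) ≤ (α * w) * (r - ρ) :=
        mul_le_mul_of_nonneg_right h4 h2.le
    _ = w * (α * r - ρ * α) := by ring
    _ ≤ w * (α * r - levyExponent c ν α) := mul_le_mul_of_nonneg_left (by linarith) hw

include hx hρ in
theorem tendsto_one_sub_exp_div_exponent {w r : ℝ} (hw : 0 ≤ w) (hr : ρ < r) :
    Tendsto (fun α : ℝ => (1 - Real.exp (-(α * w))) / (α * r - levyExponent c ν α)) (𝓝[>] 0)
      (𝓝 (w / (r - ρ))) := by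
  have h := (tendsto_one_sub_exp_div hw).div ((tendsto_levyExponent_div hx hρ).const_sub r)
    (sub_pos.2 hr).ne'
  refine h.congr' ?_
  filter_upwards [self_mem_nhdsWithin] with α (hα : 0 < α)
  simp only [Pi.div_apply]
  rw [div_div, mul_sub, mul_div_cancel₀ _ hα.ne']

include hJ hW hR hcν hx hρ hRρ hW0

theorem lintegral_exp_periodMeasure {α : ℝ} (hα : 0 < α) :
    ∫⁻ p, ENNReal.ofReal (Real.exp (-(α * drain J S W R p.1 p.2.toNNReal)))
        ∂periodMeasure P (drainTime J S W R)
      = ∫⁻ ω, ENNReal.ofReal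
          ((1 - Real.exp (-(α * W ω))) / (α * R ω - levyExponent c ν α)) ∂P := by
  rw [lintegral_periodMeasure (measurable_drainTime hJ hS hW hR),
    lintegral_occupation hJ hS hW hR hcν hx hρ hRρ hW0 hα]
  exact ((measurable_drain_uncurry hJ hS hW hR).const_mul α).neg.exp.ennreal_ofReal

/-- The mean first passage time. -/
theorem lintegral_drainTime :
    ∫⁻ ω, drainTime J S W R ω ∂P = ∫⁻ ω, ENNReal.ofReal (W ω / (R ω - ρ)) ∂P := by
  have hWm : Measurable W := hW.mono hS.measurableSpace_le le_rfl
  have hRm : Measurable R := hR.mono hS.measurableSpace_le le_rfl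
  have hT := measurable_drainTime hJ hS hW hR
  have hdr := measurable_drain_uncurry hJ hS hW hR
  -- The total mass of the period measure is `E T`; it is the limit of its Laplace functionals,
  -- since the level is nonnegative during the period.
  have lim1 : Tendsto (fun α : ℝ =>
      ∫⁻ p, ENNReal.ofReal (Real.exp (-(α * drain J S W R p.1 p.2.toNNReal)))
        ∂periodMeasure P (drainTime J S W R)) (𝓝[>] 0)
      (𝓝 (∫⁻ _, 1 ∂periodMeasure P (drainTime J S W R))) := by
    refine tendsto_lintegral_of_le_limit
      (fun α => (hdr.const_mul α).neg.exp.ennreal_ofReal.aemeasurable) ?_ ?_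
    · filter_upwards [self_mem_nhdsWithin] with α (hα : 0 < α)
      filter_upwards [ae_periodMeasure hT] with p hp
      rw [ENNReal.ofReal_le_one, Real.exp_le_one_iff, neg_nonpos]
      exact mul_nonneg hα.le (drain_nonneg_of_lt hp.2)
    · refine Eventually.of_forall fun p => ?_
      have h := (Real.continuous_exp.tendsto _).comp
        (tendsto_mul_nhdsGT_zero (drain J S W R p.1 p.2.toNNReal)).neg
      simpa using ENNReal.tendsto_ofReal h
  have lim2 : Tendsto (fun α : ℝ => ∫⁻ ω, ENNReal.ofReal
      ((1 - Real.exp (-(α * W ω))) / (α * R ω - levyExponent c ν α)) ∂P) (𝓝[>] 0)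
      (𝓝 (∫⁻ ω, ENNReal.ofReal (W ω / (R ω - ρ)) ∂P)) := by
    refine tendsto_lintegral_of_le_limit (fun α => by fun_prop) ?_ ?_
    · filter_upwards [self_mem_nhdsWithin] with α (hα : 0 < α)
      filter_upwards [hRρ] with ω hω
      exact ENNReal.ofReal_le_ofReal (one_sub_exp_div_exponent_le hx hρ hα (hW0 ω) hω)
    · filter_upwards [hRρ] with ω hω
      exact ENNReal.tendsto_ofReal (tendsto_one_sub_exp_div_exponent hx hρ (hW0 ω) hω)
  rw [← periodMeasure_univ hT, ← lintegral_one]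
  refine tendsto_nhds_unique lim1 (lim2.congr' ?_)
  filter_upwards [self_mem_nhdsWithin] with α (hα : 0 < α)
  exact (lintegral_exp_periodMeasure hJ hS hW hR hcν hx hρ hRρ hW0 hα).symm

/-- The mean area under the level process before the first passage. -/
theorem lintegral_drain_periodMeasure (hWpos : ∀ᵐ ω ∂P, 0 < W ω)
    (hfin : ∫⁻ ω, ENNReal.ofReal (W ω / (R ω - ρ)) ∂P < ∞) :
    ∫⁻ p, ENNReal.ofReal (drain J S W R p.1 p.2.toNNReal) ∂periodMeasure P (drainTime J S W R)
      = ∫⁻ ω, (ENNReal.ofReal (W ω ^ 2 / (2 * (R ω - ρ)))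
          + (∫⁻ x in Ioi (0 : ℝ), ENNReal.ofReal (x ^ 2 / 2) ∂ν)
            * ENNReal.ofReal (W ω / (R ω - ρ) ^ 2)) ∂P := by
  have hWm : Measurable W := hW.mono hS.measurableSpace_le le_rfl
  have hRm : Measurable R := hR.mono hS.measurableSpace_le le_rfl
  have hT := measurable_drainTime hJ hS hW hR
  have hdr := measurable_drain_uncurry hJ hS hW hR
  have hET := lintegral_drainTime hJ hS hW hR hcν hx hρ hRρ hW0
  set T := drainTime J S W R with hTdef
  set κ := ∫⁻ x in Ioi (0 : ℝ), ENNReal.ofReal (x ^ 2 / 2) ∂ν with hκ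
  set η := levyExponent c ν with hη
  have h0 : ∀ᵐ p ∂periodMeasure P T, 0 ≤ drain J S W R p.1 p.2.toNNReal :=
    (ae_periodMeasure hT).mono fun p hp => drain_nonneg_of_lt hp.2
  have lim1 := tendsto_lintegral_one_sub_exp_div hdr.aemeasurable h0
  -- Formally this is `1/α` times the difference of `E T` and the occupation identity. The
  -- subtraction is avoided by adding the finite quantity `hEfin` to both sides.
  have heq : ∀ α : ℝ, 0 < α → ∫⁻ p, ENNReal.ofReal
        ((1 - Real.exp (-(α * drain J S W R p.1 p.2.toNNReal))) / α) ∂periodMeasure P T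
      = ∫⁻ ω, ENNReal.ofReal
          ((W ω / (R ω - ρ) - (1 - Real.exp (-(α * W ω))) / (α * R ω - η α)) / α) ∂P := by
    intro α hα
    have hexp := lintegral_exp_periodMeasure hJ hS hW hR hcν hx hρ hRρ hW0 hα
    have hEfin : ENNReal.ofReal (1 / α) * ∫⁻ ω, ENNReal.ofReal
        ((1 - Real.exp (-(α * W ω))) / (α * R ω - η α)) ∂P ≠ ∞ := by
      refine ENNReal.mul_ne_top ENNReal.ofReal_ne_top (lt_of_le_of_lt (lintegral_mono_ae ?_) hfin).ne
      filter_upwards [hRρ] with ω hω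
      exact ENNReal.ofReal_le_ofReal (one_sub_exp_div_exponent_le hx hρ hα (hW0 ω) hω)
    refine (ENNReal.add_left_inj hEfin).1 ?_
    trans ENNReal.ofReal (1 / α) * ∫⁻ ω, ENNReal.ofReal (W ω / (R ω - ρ)) ∂P
    · rw [← hexp, ← lintegral_const_mul _ (by exact (hdr.const_mul α).neg.exp.ennreal_ofReal),
        ← lintegral_add_right _
          (by exact ((hdr.const_mul α).neg.exp.ennreal_ofReal.const_mul _)), ← hET,
        ← periodMeasure_univ hT, ← lintegral_one, ← lintegral_const_mul _ measurable_const]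
      refine lintegral_congr_ae ?_
      filter_upwards [h0] with p hp
      rw [← ENNReal.ofReal_mul (by positivity), ← ENNReal.ofReal_add, mul_one]
      · congr 1
        field_simp
        ring
      · exact one_sub_exp_div_nonneg hp hα
      · positivity
    · rw [← lintegral_const_mul _ (by fun_prop), ← lintegral_const_mul _ (by fun_prop),
        ← lintegral_add_right _ (by fun_prop)]
      refine lintegral_congr_ae ?_
      filter_upwards [hRρ] with ω hω
      have hle := one_sub_exp_div_exponent_le hx hρ hα (hW0 ω) hω
      have hp := mul_sub_levyExponent_pos hx hρ hα hω
      have he : Real.exp (-(α * W ω)) ≤ 1 :=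
        Real.exp_le_one_iff.2 (neg_nonpos.2 (mul_nonneg hα.le (hW0 ω)))
      have hE0 : 0 ≤ (1 - Real.exp (-(α * W ω))) / (α * R ω - η α) :=
        div_nonneg (by linarith) hp.le
      rw [← ENNReal.ofReal_mul (by positivity), ← ENNReal.ofReal_mul (by positivity),
        ← ENNReal.ofReal_add (div_nonneg (sub_nonneg.2 hle) hα.le) (by positivity)]
      congr 1
      ring
  have hdecomp : ∀ α : ℝ, 0 < α → ∀ ω, ρ < R ω → ENNReal.ofReal
        ((W ω / (R ω - ρ) - (1 - Real.exp (-(α * W ω))) / (α * R ω - η α)) / α)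
      = ENNReal.ofReal ((W ω - (1 - Real.exp (-(α * W ω))) / α) / α / (R ω - ρ))
        + ENNReal.ofReal ((ρ - η α / α) / α) * ENNReal.ofReal
          ((1 - Real.exp (-(α * W ω))) / (α * R ω - η α) / (R ω - ρ)) := by
    intro α hα ω hω
    have hp := mul_sub_levyExponent_pos hx hρ hα hω
    have hD : 0 < R ω - ρ := sub_pos.2 hω
    have he : Real.exp (-(α * W ω)) ≤ 1 :=
      Real.exp_le_one_iff.2 (neg_nonpos.2 (mul_nonneg hα.le (hW0 ω)))
    have hκ0 : 0 ≤ (ρ - η α / α) / α := by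
      refine div_nonneg (sub_nonneg.2 ?_) hα.le
      rw [div_le_iff₀ hα]
      exact levyExponent_le hx hρ hα.le
    rw [← ENNReal.ofReal_mul hκ0, ← ENNReal.ofReal_add]
    · congr 1
      have h := ratio_difference (w := W ω) (e := 1 - Real.exp (-(α * W ω))) (ρ := ρ) hα.ne'
        hD.ne' hp.ne'
      rwa [sub_add_cancel, sub_sub_cancel] at h
    · exact div_nonneg (div_nonneg (sub_nonneg.2 (one_sub_exp_div_le _ hα)) hα.le) hD.le
    · exact mul_nonneg hκ0 (div_nonneg (div_nonneg (by linarith) hp.le) hD.le)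
  have lim2 : Tendsto (fun α : ℝ => ∫⁻ ω, ENNReal.ofReal
      ((W ω / (R ω - ρ) - (1 - Real.exp (-(α * W ω))) / (α * R ω - η α)) / α) ∂P) (𝓝[>] 0)
      (𝓝 (∫⁻ ω, (ENNReal.ofReal (W ω ^ 2 / (2 * (R ω - ρ)))
          + κ * ENNReal.ofReal (W ω / (R ω - ρ) ^ 2)) ∂P)) := by
    refine tendsto_lintegral_of_le_limit (fun α => by fun_prop) ?_ ?_
    · filter_upwards [self_mem_nhdsWithin] with α (hα : 0 < α)
      filter_upwards [hRρ] with ω hω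
      have hD : 0 < R ω - ρ := sub_pos.2 hω
      rw [hdecomp α hα ω hω]
      refine add_le_add (ENNReal.ofReal_le_ofReal ?_) (mul_le_mul' ?_ (ENNReal.ofReal_le_ofReal ?_))
      · rw [← div_div]
        exact div_le_div_of_nonneg_right (exp_second_order_le (hW0 ω) hα) hD.le
      · exact ofReal_mean_sub_levyExponent_div_le hx hρ hα
      · rw [sq, ← div_div]
        exact div_le_div_of_nonneg_right (one_sub_exp_div_exponent_le hx hρ hα (hW0 ω) hω) hD.le
    · filter_upwards [hRρ, hWpos] with ω hω hwpos
      have hD : 0 < R ω - ρ := sub_pos.2 hω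
      have hlim : Tendsto (fun α : ℝ =>
          ENNReal.ofReal ((W ω - (1 - Real.exp (-(α * W ω))) / α) / α / (R ω - ρ))
            + ENNReal.ofReal ((ρ - η α / α) / α) * ENNReal.ofReal
              ((1 - Real.exp (-(α * W ω))) / (α * R ω - η α) / (R ω - ρ))) (𝓝[>] 0)
          (𝓝 (ENNReal.ofReal (W ω ^ 2 / (2 * (R ω - ρ)))
            + κ * ENNReal.ofReal (W ω / (R ω - ρ) ^ 2))) := by
        -- The limit `κ` may be infinite, so the product converges only because the other factor has
        -- a nonzero limit; this is where `W > 0` enters.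
        refine Tendsto.add ?_ (ENNReal.Tendsto.mul
          (tendsto_ofReal_mean_sub_levyExponent_div hx hρ) (Or.inr ENNReal.ofReal_ne_top) ?_
          (Or.inl ?_))
        · rw [← div_div]
          exact ENNReal.tendsto_ofReal ((tendsto_exp_second_order (hW0 ω)).div_const _)
        · rw [sq, ← div_div]
          exact ENNReal.tendsto_ofReal
            ((tendsto_one_sub_exp_div_exponent hx hρ (hW0 ω) hω).div_const _)
        · exact (ENNReal.ofReal_pos.2 (by positivity)).ne'
      refine hlim.congr' ?_
      filter_upwards [self_mem_nhdsWithin] with α (hα : 0 < α)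
      exact (hdecomp α hα ω hω).symm
  refine tendsto_nhds_unique lim1 (lim2.congr' ?_)
  filter_upwards [self_mem_nhdsWithin] with α (hα : 0 < α)
  exact (heq α hα).symm

/-- Almost surely, the level does not return to zero before it becomes negative. -/
theorem ae_hitting_eq_drainTime (hWpos : ∀ᵐ ω ∂P, 0 < W ω) :
    ∀ᵐ ω ∂P, (⨅ (s : ℝ≥0) (_ : drain J S W R ω s = 0), (s : ℝ≥0∞)) = drainTime J S W R ω := by
  -- Start from a slightly smaller content. When the level from `W` is zero, the one from `Wn n` is
  -- negative, so the hitting time of zero lies between the passage times for `Wn n` and for `W`.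
  -- The transforms of these passage times at `α = 1` are `E e^{-Wn}` and `E e^{-W}`, which agree in
  -- the limit.
  set Wn : ℕ → Ω → ℝ := fun n ω => max (W ω - 1 / ((n : ℝ) + 1)) 0 with hWn
  have hWnS : ∀ n, Measurable[hS.measurableSpace] (Wn n) := fun n =>
    (hW.sub_const _).max measurable_const
  have hWn0 : ∀ n ω, 0 ≤ Wn n ω := fun n ω => le_max_right _ _
  have hRm : Measurable R := hR.mono hS.measurableSpace_le le_rfl
  have hα : (0 : ℝ) < 1 := one_pos
  set η := levyExponent c ν 1 with hηdef
  have hη : 0 ≤ η := levyExponent_nonneg hcν.drift_nonneg zero_le_one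
  have hφ : ∀ᵐ ω ∂P, 0 < 1 * R ω - η :=
    hRρ.mono fun ω h => mul_sub_levyExponent_pos hx hρ hα h
  have hlst : ∀ Z : Ω → ℝ, Measurable[hS.measurableSpace] Z → (∀ ω, 0 ≤ Z ω) →
      ∫⁻ ω, ENNReal.ofReal (Real.exp (-((1 * R ω - η) * (drainTime J S Z R ω).toReal))) ∂P
        = ∫⁻ ω, ENNReal.ofReal (Real.exp (-(1 * Z ω))) ∂P := by
    intro Z hZ hZ0
    rw [← lintegral_exp_drainTime hJ hS hZ hR hα.le hη (hcν.lst 1 hα.le) hZ0 hφ]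
    rw [Measure.restrict_eq_self_of_ae_mem (s := {ω | drainTime J S Z R ω < ∞})
      (ae_drainTime_lt_top hJ hS hZ hR hcν hx hρ hRρ hZ0)]
  have hfin := ae_drainTime_lt_top hJ hS hW hR hcν hx hρ hRρ hW0
  set T := drainTime J S W R with hTdef
  have hTm : Measurable T := measurable_drainTime hJ hS hW hR
  have hTn : ∀ n, Measurable (drainTime J S (Wn n) R) := fun n =>
    measurable_drainTime hJ hS (hWnS n) hR
  set f : Ω → ℝ≥0∞ := fun ω => ENNReal.ofReal (Real.exp (-((1 * R ω - η) * (T ω).toReal))) with hf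
  set g : ℕ → Ω → ℝ≥0∞ := fun n ω =>
    ENNReal.ofReal (Real.exp (-((1 * R ω - η) * (drainTime J S (Wn n) R ω).toReal))) with hg
  have hhit : ∀ᵐ ω ∂P, (⨅ (s : ℝ≥0) (_ : drain J S W R ω s = 0), (s : ℝ≥0∞)) ≤ T ω := by
    filter_upwards [hfin] with ω hω
    have h := drain_drainTime hJ.mono hJ.right_continuous (hW0 ω) (ENNReal.coe_toNNReal hω.ne).symm
    exact (iInf₂_le (T ω).toNNReal h).trans (ENNReal.coe_toNNReal hω.ne).le
  have hlow : ∀ᵐ ω ∂P, ∀ n, drainTime J S (Wn n) R ω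
      ≤ ⨅ (s : ℝ≥0) (_ : drain J S W R ω s = 0), (s : ℝ≥0∞) := by
    filter_upwards [hWpos] with ω hω n
    refine le_iInf₂ fun s hs => drainTime_le ?_
    have hlt : Wn n ω < W ω := by
      refine max_lt ?_ hω
      have : (0 : ℝ) < 1 / ((n : ℝ) + 1) := by positivity
      linarith
    rw [drain] at hs ⊢
    linarith
  have hfg : ∀ᵐ ω ∂P, f ω ≤ ⨅ n, g n ω := by
    filter_upwards [hhit, hlow, hφ, hfin] with ω h1 h2 h3 h4
    refine le_iInf fun n => ENNReal.ofReal_le_ofReal (Real.exp_le_exp.2 (neg_le_neg ?_))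
    exact mul_le_mul_of_nonneg_left (ENNReal.toReal_mono h4.ne ((h2 n).trans h1)) h3.le
  have hlim : Tendsto (fun n => ∫⁻ ω, g n ω ∂P) atTop (𝓝 (∫⁻ ω, f ω ∂P)) := by
    simp only [hf, hg]
    rw [hlst W hW hW0]
    simp only [hlst _ (hWnS _) (hWn0 _)]
    have hWm : ∀ n, Measurable (Wn n) := fun n => (hWnS n).mono hS.measurableSpace_le le_rfl
    refine tendsto_lintegral_of_dominated_convergence (fun _ => 1) (fun n => ?_) (fun n => ?_)
      (by simp) ?_
    · have := hWm n
      fun_prop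
    · refine Eventually.of_forall fun ω => ?_
      rw [ENNReal.ofReal_le_one, Real.exp_le_one_iff, neg_nonpos, one_mul]
      exact hWn0 n ω
    · refine Eventually.of_forall fun ω => ?_
      have h1 : Tendsto (fun n => Wn n ω) atTop (𝓝 (max (W ω - 0) 0)) :=
        (tendsto_one_div_add_atTop_nhds_zero_nat.const_sub (W ω)).max tendsto_const_nhds
      rw [sub_zero, max_eq_left (hW0 ω)] at h1
      exact ENNReal.tendsto_ofReal ((Real.continuous_exp.tendsto _).comp (h1.const_mul 1).neg)
  have hle : ∫⁻ ω, (⨅ n, g n ω) ∂P ≤ ∫⁻ ω, f ω ∂P :=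
    ge_of_tendsto' hlim fun n => lintegral_mono fun ω => iInf_le _ n
  have hffin : ∫⁻ ω, f ω ∂P ≠ ∞ := by
    rw [hf, hlst W hW hW0]
    refine ((lintegral_mono (g := fun _ => 1) fun ω => ?_).trans_lt (by simp)).ne
    rw [ENNReal.ofReal_le_one, Real.exp_le_one_iff, neg_nonpos, one_mul]
    exact hW0 ω
  have hgm : Measurable fun ω => ⨅ n, g n ω := by
    refine Measurable.iInf fun n => ?_
    have := hTn n
    fun_prop
  -- The pointwise order `f ≤ ⨅ n, g n` together with the reverse order of the integrals forces
  -- equality almost everywhere.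
  have hae := ae_eq_of_ae_le_of_lintegral_le hfg hffin hgm.aemeasurable hle
  filter_upwards [hae, hhit, hlow, hφ, hfin] with ω h0 h1 h2 h3 h4
  set H := ⨅ (s : ℝ≥0) (_ : drain J S W R ω s = 0), (s : ℝ≥0∞) with hH
  have hHfin : H ≠ ∞ := (h1.trans_lt h4).ne
  refine le_antisymm h1 ?_
  -- The transform at the hitting time is below every `g n`, hence below `f`; as the rate `R - η` is
  -- positive, the hitting time cannot precede `T`.
  have hHf : ENNReal.ofReal (Real.exp (-((1 * R ω - η) * H.toReal))) ≤ f ω := by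
    rw [h0]
    refine le_iInf fun n => ENNReal.ofReal_le_ofReal (Real.exp_le_exp.2 (neg_le_neg ?_))
    exact mul_le_mul_of_nonneg_left (ENNReal.toReal_mono hHfin (h2 n)) h3.le
  rw [hf] at hHf
  have h5 := (ENNReal.ofReal_le_ofReal_iff (Real.exp_pos _).le).1 hHf
  have h6 := le_of_mul_le_mul_left (neg_le_neg_iff.1 (Real.exp_le_exp.1 h5)) h3
  exact (ENNReal.toReal_le_toReal h4.ne hHfin).1 h6

end Mean

end LevyStorage

namespace LevyStorage

/-! ### Renewal reward -/

/-- The strong law of large numbers for the coordinates of an infinite product. -/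
theorem strong_law_infinitePi {Ω : Type*} {m : MeasurableSpace Ω} {P : Measure Ω}
    [IsProbabilityMeasure P] {f : Ω → ℝ} (hfm : Measurable f) (hf : Integrable f P) :
    ∀ᵐ ω ∂(Measure.infinitePi fun _ : ℕ => P),
      Tendsto (fun n : ℕ => (∑ i ∈ Finset.range n, f (ω i)) / n) atTop (𝓝 (∫ ω, f ω ∂P)) := by
  have hev : ∀ i : ℕ, MeasurePreserving (Function.eval i) (Measure.infinitePi fun _ : ℕ => P) P :=
    fun i => measurePreserving_eval_infinitePi (fun _ : ℕ => P) i
  have h := strong_law_ae_real (μ := Measure.infinitePi fun _ : ℕ => P)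
    (fun i ω => f (ω i)) ?_ ?_ ?_
  · rw [show ∫ ω, f ω ∂P = ∫ ω, f (ω 0) ∂(Measure.infinitePi fun _ : ℕ => P) from ?_]
    · exact h
    · have := integral_map (hev 0).measurable.aemeasurable
        (f := f) (by rw [(hev 0).map_eq]; exact hf.1)
      rw [(hev 0).map_eq] at this
      exact this
  · exact (hev 0).integrable_comp_of_integrable hf
  · intro i j hij
    exact (iIndepFun_infinitePi (P := fun _ : ℕ => P) (X := fun _ => f) fun _ => hfm).indepFun hij
  · intro i
    refine ⟨(hfm.comp (hev i).measurable).aemeasurable, (hfm.comp (hev 0).measurable).aemeasurable,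
      ?_⟩
    have h1 := Measure.map_map (μ := Measure.infinitePi fun _ : ℕ => P) hfm (hev i).measurable
    have h2 := Measure.map_map (μ := Measure.infinitePi fun _ : ℕ => P) hfm (hev 0).measurable
    rw [(hev i).map_eq] at h1
    rw [(hev 0).map_eq] at h2
    exact h1.symm.trans h2

/-! ### Long-run fractions along a fixed sequence of cycles -/

section Deterministic

variable {Ω : Type*} {J : ℝ≥0 → Ω → ℝ} {τ : Ω → ℝ≥0∞} {R : Ω → ℝ} {ω : ℕ → Ω} {B : Set ℝ}

theorem onStart_mono : Monotone (onStart J τ R ω) :=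
  monotone_nat_of_le_succ fun n => by
    rw [onStart, onStart, Finset.sum_range_succ]
    exact le_self_add

theorem onStart_ne_top (hfin : ∀ k, onDuration J τ R (ω k) ≠ ∞) (n : ℕ) :
    onStart J τ R ω n ≠ ∞ :=
  ENNReal.sum_ne_top.2 fun k _ => hfin k

theorem onIndex_eq {n : ℕ} {t : ℝ≥0} (h1 : onStart J τ R ω n ≤ t)
    (h2 : t < onStart J τ R ω (n + 1)) : onIndex J τ R ω t = n := by
  have : {k : ℕ | onStart J τ R ω k ≤ t} = Iic n := by
    ext k
    simp only [mem_ofPred_eq, mem_Iic]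
    refine ⟨fun h => ?_, fun h => (onStart_mono h).trans h1⟩
    by_contra hk
    exact absurd (h2.trans_le (onStart_mono (Nat.lt_of_not_le hk))) (not_lt.2 h)
  rw [onIndex, this, csSup_Iic]

/-- The time that a sequence of on periods spends in `B` during its first `n` periods. -/
theorem volume_onProcess_onStart (hfin : ∀ k, onDuration J τ R (ω k) ≠ ∞) (n : ℕ) :
    volume {s : ℝ | 0 ≤ s ∧ s < (onStart J τ R ω n).toReal
        ∧ onProcess J τ R s.toNNReal ω ∈ B}
      = ∑ k ∈ Finset.range n, volume {s : ℝ | 0 ≤ s ∧ ENNReal.ofReal s < onDuration J τ R (ω k)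
          ∧ onLevel J τ R (ω k) s.toNNReal ∈ B} := by
  induction n with
  | zero =>
    have : {s : ℝ | 0 ≤ s ∧ s < (onStart J τ R ω 0).toReal ∧ onProcess J τ R s.toNNReal ω ∈ B}
        = ∅ := by
      ext s
      simp only [onStart, Finset.range_zero, Finset.sum_empty, ENNReal.toReal_zero, mem_ofPred_eq,
        mem_empty_iff_false, iff_false]
      rintro ⟨h1, h2, -⟩
      exact absurd h1 (not_le.2 h2)
    rw [this]
    simp
  | succ n ih =>
    set a := (onStart J τ R ω n).toReal with ha
    set b := (onStart J τ R ω (n + 1)).toReal with hb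
    have hfa := onStart_ne_top hfin n
    have hfb := onStart_ne_top hfin (n + 1)
    have ha0 : 0 ≤ a := ENNReal.toReal_nonneg
    have hab : a ≤ b := ENNReal.toReal_mono hfb (onStart_mono n.le_succ)
    have hbd : b = a + (onDuration J τ R (ω n)).toReal := by
      rw [hb, ha, ← ENNReal.toReal_add hfa (hfin n), onStart, onStart, Finset.sum_range_succ]
    rw [Finset.sum_range_succ, ← ih, ← measure_inter_add_sdiff _ (measurableSet_Iio (a := a))]
    congr 1
    · congr 1
      ext s
      simp only [mem_inter_iff, mem_ofPred_eq, mem_Iio]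
      exact ⟨fun ⟨⟨h1, _, h3⟩, h4⟩ => ⟨h1, h4, h3⟩, fun ⟨h1, h2, h3⟩ =>
        ⟨⟨h1, h2.trans_le hab, h3⟩, h2⟩⟩
    -- On the clock of the on process, on period `n` occupies `[a, b)`; translation by `a` brings it
    -- back to its own clock.
    · rw [← measure_preimage_add_right volume (-a)
        {s : ℝ | 0 ≤ s ∧ ENNReal.ofReal s < onDuration J τ R (ω n)
          ∧ onLevel J τ R (ω n) s.toNNReal ∈ B}]
      congr 1
      ext s
      simp only [Set.mem_sdiff, mem_ofPred_eq, mem_Iio, not_lt, mem_preimage, ← sub_eq_add_neg,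
        sub_nonneg]
      have key : a ≤ s → s < b → onProcess J τ R s.toNNReal ω
          = onLevel J τ R (ω n) (s - a).toNNReal := by
        intro h1 h2
        have hs : (0 : ℝ) ≤ s := ha0.trans h1
        have hidx : onIndex J τ R ω s.toNNReal = n := by
          refine onIndex_eq ?_ ?_
          · rw [← ENNReal.ofReal_toReal hfa]
            exact ENNReal.ofReal_le_ofReal h1
          · exact (ENNReal.ofReal_lt_iff_lt_toReal hs hfb).2 h2
        rw [onProcess, hidx]
        congr 1
        rw [← NNReal.coe_inj, NNReal.coe_sub, Real.coe_toNNReal _ hs,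
          Real.coe_toNNReal _ (sub_nonneg.2 h1)]
        · rfl
        · rw [← NNReal.coe_le_coe, Real.coe_toNNReal _ hs]
          exact h1
      have hlt : a ≤ s → (s < b ↔ ENNReal.ofReal (s - a) < onDuration J τ R (ω n)) := by
        intro h1
        rw [ENNReal.ofReal_lt_iff_lt_toReal (sub_nonneg.2 h1) (hfin n), hbd,
          sub_lt_iff_lt_add']
      constructor
      · rintro ⟨⟨-, h2, h3⟩, h4⟩
        exact ⟨h4, (hlt h4).1 h2, key h4 h2 ▸ h3⟩
      · rintro ⟨h1, h2, h3⟩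
        have h2' := (hlt h1).2 h2
        exact ⟨⟨ha0.trans h1, h2', (key h1 h2').symm ▸ h3⟩, h1⟩

/-- A time inside an on period lies between two consecutive starts, so the bounds for the fraction
have indices off by one; the shift does not affect the limit. -/
theorem tendsto_ratio_shift {r s : ℕ → ℝ} {x y : ℝ} (hy : y ≠ 0)
    (hr : Tendsto (fun n : ℕ => r n / n) atTop (𝓝 x))
    (hs : Tendsto (fun n : ℕ => s n / n) atTop (𝓝 y)) :
    Tendsto (fun n => r n / s (n + 1)) atTop (𝓝 (x / y)) ∧
      Tendsto (fun n => r (n + 1) / s n) atTop (𝓝 (x / y)) := by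
  have hone : Tendsto (fun n : ℕ => (n : ℝ) / (n + 1)) atTop (𝓝 1) :=
    tendsto_natCast_div_add_atTop 1
  have hr' := hr.comp (tendsto_add_atTop_nat 1)
  have hs' := hs.comp (tendsto_add_atTop_nat 1)
  constructor
  · have h := (hr.mul hone).div hs' hy
    rw [mul_one] at h
    refine h.congr' ?_
    filter_upwards [eventually_ge_atTop 1] with n hn
    have hn : (n : ℝ) ≠ 0 := by positivity
    have hn1 : (n : ℝ) + 1 ≠ 0 := by positivity
    simp only [Pi.div_apply, Function.comp_apply]
    push_cast
    rw [div_mul_div_cancel₀ hn, div_div_div_cancel_right₀ hn1]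
  · have h := hr'.div (hs.mul hone) (by simpa using hy)
    rw [mul_one] at h
    refine h.congr' ?_
    filter_upwards [eventually_ge_atTop 1] with n hn
    have hn : (n : ℝ) ≠ 0 := by positivity
    have hn1 : (n : ℝ) + 1 ≠ 0 := by positivity
    simp only [Pi.div_apply, Function.comp_apply]
    push_cast
    rw [div_mul_div_cancel₀ hn, div_div_div_cancel_right₀ hn1]

/-- The long-run fraction of time spent in `B`, from the averages over the periods. -/
theorem tendsto_fraction_onProcess (hfin : ∀ k, onDuration J τ R (ω k) ≠ ∞) {x y : ℝ} (hy : 0 < y)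
    (hr : Tendsto (fun n : ℕ => (∑ k ∈ Finset.range n,
      (volume {s : ℝ | 0 ≤ s ∧ ENNReal.ofReal s < onDuration J τ R (ω k)
          ∧ onLevel J τ R (ω k) s.toNNReal ∈ B}).toReal) / n) atTop (𝓝 x))
    (hs : Tendsto (fun n : ℕ => (∑ k ∈ Finset.range n,
      (onDuration J τ R (ω k)).toReal) / n) atTop (𝓝 y)) :
    Tendsto (fun t : ℝ => volume {s : ℝ | 0 ≤ s ∧ s < t ∧ onProcess J τ R s.toNNReal ω ∈ B}
      / ENNReal.ofReal t) atTop (𝓝 (ENNReal.ofReal (x / y))) := by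
  set A : ℝ → ℝ≥0∞ := fun t =>
    volume {s : ℝ | 0 ≤ s ∧ s < t ∧ onProcess J τ R s.toNNReal ω ∈ B} with hA
  have hAle : ∀ t, A t ≤ ENNReal.ofReal t := by
    intro t
    refine (measure_mono (t := Ico 0 t) fun s hs => ⟨hs.1, hs.2.1⟩).trans ?_
    rw [Real.volume_Ico, sub_zero]
  have hAfin : ∀ t, A t ≠ ∞ := fun t => ((hAle t).trans_lt ENNReal.ofReal_lt_top).ne
  have hAmono : Monotone A := fun t u htu =>
    measure_mono fun s hs => ⟨hs.1, hs.2.1.trans_le htu, hs.2.2⟩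
  set S : ℕ → ℝ := fun n => (onStart J τ R ω n).toReal with hS
  have hSsum : ∀ n, S n = ∑ k ∈ Finset.range n, (onDuration J τ R (ω k)).toReal := fun n =>
    ENNReal.toReal_sum fun k _ => hfin k
  set Q : ℕ → ℝ := fun n => ∑ k ∈ Finset.range n,
      (volume {s : ℝ | 0 ≤ s ∧ ENNReal.ofReal s < onDuration J τ R (ω k)
          ∧ onLevel J τ R (ω k) s.toNNReal ∈ B}).toReal with hQ
  have hAS : ∀ n, (A (S n)).toReal = Q n := by
    intro n
    rw [hA, hQ]
    simp only
    rw [volume_onProcess_onStart hfin n, ENNReal.toReal_sum]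
    intro k _
    refine ((measure_mono (t := {s : ℝ | 0 ≤ s ∧ ENNReal.ofReal s < onDuration J τ R (ω k)})
      fun s hs => ⟨hs.1, hs.2.1⟩).trans_lt ?_).ne
    rw [volume_period_section]
    exact (hfin k).lt_top
  simp only [← hSsum] at hs
  have hStop : Tendsto S atTop atTop := by
    have h := hs.pos_mul_atTop hy tendsto_natCast_atTop_atTop
    refine h.congr' ?_
    filter_upwards [eventually_ge_atTop 1] with n hn
    have hn : (n : ℝ) ≠ 0 := by positivity
    rw [div_mul_cancel₀ _ hn]
  have hSmono : Monotone S := fun i j hij =>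
    ENNReal.toReal_mono (onStart_ne_top hfin j) (onStart_mono hij)
  have hbdd : ∀ t : ℝ, BddAbove {n : ℕ | S n ≤ t} := by
    intro t
    obtain ⟨k, hk⟩ := (hStop.eventually_gt_atTop t).exists
    refine ⟨k, fun n hn => ?_⟩
    by_contra h
    exact absurd (hk.trans_le (hSmono (le_of_not_ge h))) (not_lt.2 hn)
  -- The period running at `t`, characterized by `S (N t) ≤ t < S (N t + 1)`.
  set N : ℝ → ℕ := fun t => sSup {n : ℕ | S n ≤ t} with hN
  have hN1 : ∀ t, 0 ≤ t → S (N t) ≤ t := fun t ht =>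
    Nat.sSup_mem (s := {n : ℕ | S n ≤ t}) ⟨0, by simpa [hS, onStart] using ht⟩ (hbdd t)
  have hN2 : ∀ t, t < S (N t + 1) := by
    intro t
    by_contra h
    have := le_csSup (hbdd t) (not_lt.1 h : N t + 1 ∈ {n : ℕ | S n ≤ t})
    exact absurd this (Nat.not_succ_le_self _)
  have hNtop : Tendsto N atTop atTop := by
    rw [tendsto_atTop]
    intro k
    filter_upwards [eventually_ge_atTop (S k)] with t ht
    exact le_csSup (hbdd t) ht
  obtain ⟨h1, h2⟩ := tendsto_ratio_shift hy.ne' hr hs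
  have hlim : Tendsto (fun t => (A t).toReal / t) atTop (𝓝 (x / y)) := by
    -- Monotonicity in `t` gives `Q (N t) / S (N t + 1) ≤ A t / t ≤ Q (N t + 1) / S (N t)`.
    refine tendsto_of_tendsto_of_tendsto_of_le_of_le' (h1.comp hNtop) (h2.comp hNtop) ?_ ?_
    · filter_upwards [eventually_gt_atTop 0] with t ht
      have hle : Q (N t) ≤ (A t).toReal := by
        rw [← hAS]
        exact ENNReal.toReal_mono (hAfin t) (hAmono (hN1 t ht.le))
      exact div_le_div₀ ENNReal.toReal_nonneg hle ht (hN2 t).le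
    · have hSpos : ∀ᶠ t in atTop, 0 < S (N t) :=
        (hStop.comp hNtop).eventually_gt_atTop 0
      filter_upwards [eventually_gt_atTop 0, hSpos] with t ht hpos
      have hle : (A t).toReal ≤ Q (N t + 1) := by
        rw [← hAS]
        exact ENNReal.toReal_mono (hAfin _) (hAmono (hN2 t).le)
      exact div_le_div₀ (ENNReal.toReal_nonneg.trans hle) hle hpos (hN1 t ht.le)
  refine (ENNReal.tendsto_ofReal hlim).congr' ?_
  filter_upwards [eventually_gt_atTop 0] with t ht
  rw [ENNReal.ofReal_div_of_pos ht, ENNReal.ofReal_toReal (hAfin t)]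

end Deterministic

/-- The occupation law of an on period is the steady-state law of the on process. -/
theorem isSteadyStateLaw_onProcess {Ω : Type*} {m : MeasurableSpace Ω} {P : Measure Ω}
    [IsProbabilityMeasure P] {J : ℝ≥0 → Ω → ℝ} {τ : Ω → ℝ≥0∞} {R : Ω → ℝ} {T : Ω → ℝ≥0∞}
    (hT : Measurable T) (hX : Measurable fun p : Ω × ℝ => onLevel J τ R p.1 p.2.toNNReal)
    (hdur : ∀ᵐ ω ∂P, onDuration J τ R ω = T ω) (hfin : ∫⁻ ω, T ω ∂P ≠ ∞)
    (hpos : ∫⁻ ω, T ω ∂P ≠ 0) :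
    IsSteadyStateLaw (cycleMeasure P) (onProcess J τ R)
      ((∫⁻ ω, T ω ∂P)⁻¹ • (periodMeasure P T).map
        fun p => onLevel J τ R p.1 p.2.toNNReal) := by
  intro B hB
  have hTtop : ∀ᵐ ω ∂P, T ω ≠ ∞ := (ae_lt_top hT hfin).mono fun ω h => h.ne
  have hae : ∀ᵐ ω ∂cycleMeasure P, ∀ k : ℕ, onDuration J τ R (ω k) = T (ω k) ∧ T (ω k) ≠ ∞ := by
    rw [ae_all_iff]
    intro k
    exact (measurePreserving_eval_infinitePi (fun _ : ℕ => P) k).quasiMeasurePreserving.ae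
      (hdur.and hTtop)
  set r : Ω → ℝ≥0∞ := fun ω => volume {s : ℝ | 0 ≤ s ∧ ENNReal.ofReal s < T ω
    ∧ onLevel J τ R ω s.toNNReal ∈ B} with hr
  have hset : MeasurableSet ({p : Ω × ℝ | 0 ≤ p.2 ∧ ENNReal.ofReal p.2 < T p.1}
      ∩ (fun p => onLevel J τ R p.1 p.2.toNNReal) ⁻¹' B) :=
    (measurableSet_period hT).inter (hX hB)
  have hreq : ∀ ω, r ω = volume (Prod.mk ω ⁻¹' ({p : Ω × ℝ | 0 ≤ p.2 ∧ ENNReal.ofReal p.2 < T p.1}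
      ∩ (fun p => onLevel J τ R p.1 p.2.toNNReal) ⁻¹' B)) := by
    intro ω
    refine congrArg volume (Set.ext fun s => ?_)
    simp only [mem_ofPred_eq, mem_preimage, mem_inter_iff, and_assoc]
  have hrm : Measurable r := by
    rw [funext hreq]
    exact measurable_measure_prodMk_left hset
  have hrT : ∀ ω, r ω ≤ T ω := by
    intro ω
    rw [← volume_period_section (T ω)]
    exact measure_mono fun s hs => ⟨hs.1, hs.2.1⟩
  have hrfin : ∫⁻ ω, r ω ∂P ≠ ∞ := ((lintegral_mono hrT).trans_lt hfin.lt_top).ne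
  have hrint : ∫⁻ ω, r ω ∂P
      = (periodMeasure P T).map (fun p => onLevel J τ R p.1 p.2.toNNReal) B := by
    rw [Measure.map_apply hX hB, periodMeasure, Measure.restrict_apply (hX hB), inter_comm,
      Measure.prod_apply hset]
    exact lintegral_congr hreq
  -- The strong law is applied to the time spent in `B` during a period and then to its length; both
  -- are integrable because `E T` is finite.
  have h1 := strong_law_infinitePi hrm.ennreal_toReal
    (integrable_toReal_of_lintegral_ne_top hrm.aemeasurable hrfin)
  have h2 := strong_law_infinitePi hT.ennreal_toReal
    (integrable_toReal_of_lintegral_ne_top hT.aemeasurable hfin)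
  rw [integral_toReal hT.aemeasurable (ae_lt_top hT hfin)] at h2
  rw [integral_toReal hrm.aemeasurable (ae_lt_top hrm hrfin)] at h1
  have hETpos : 0 < (∫⁻ ω, T ω ∂P).toReal := ENNReal.toReal_pos hpos hfin
  filter_upwards [h1, h2, hae] with ω h1 h2 h3
  have h := tendsto_fraction_onProcess (J := J) (τ := τ) (R := R) (B := B) (ω := ω)
    (fun k => by rw [(h3 k).1]; exact (h3 k).2) hETpos
    (by simpa only [(h3 _).1] using h1) (by simpa only [(h3 _).1] using h2)
  rw [ENNReal.ofReal_div_of_pos hETpos, ENNReal.ofReal_toReal hfin, ENNReal.ofReal_toReal hrfin,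
    hrint, ENNReal.div_eq_inv_mul] at h
  simpa using h

end LevyStorage

namespace LevyStorage

/-! ### The auxiliary family -/

theorem lintegral_uniform_unit {Ω : Type*} {m : MeasurableSpace Ω} {P : Measure Ω} {U : Ω → ℝ}
    (hU : Measurable U) (hunif : P.map U = volume.restrict (Icc (0 : ℝ) 1)) :
    ∫⁻ ω, ENNReal.ofReal (U ω) ∂P = ENNReal.ofReal (1 / 2) := by
  have h1 : ∫⁻ ω, ENNReal.ofReal (U ω) ∂P = ∫⁻ u in Icc (0 : ℝ) 1, ENNReal.ofReal u := by
    rw [← hunif, lintegral_map (by fun_prop) hU]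
  rw [h1, ← ofReal_integral_eq_lintegral_ofReal (μ := volume.restrict (Icc (0 : ℝ) 1))
    (f := fun u : ℝ => u) continuous_id.integrableOn_Icc
    ((ae_restrict_mem measurableSet_Icc).mono fun u hu => hu.1), integral_Icc_eq_integral_Ioc,
    ← intervalIntegral.integral_of_le zero_le_one]
  simp

/-- Integration of a function known to `𝒢` over an event, through its conditional probability. -/
theorem setLIntegral_eq_lintegral_mul_condProb {Ω : Type*} {𝒢 m : MeasurableSpace Ω}
    {P : Measure Ω} [IsProbabilityMeasure P] (h𝒢 : 𝒢 ≤ m) {E : Set Ω} (hE : MeasurableSet E)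
    {w : Ω → ℝ} (hw : P⟦E | 𝒢⟧ =ᵐ[P] w) {d : Ω → ℝ≥0∞} (hd : Measurable[𝒢] d) :
    ∫⁻ ω in E, d ω ∂P = ∫⁻ ω, d ω * ENNReal.ofReal (w ω) ∂P := by
  set w' : Ω → ℝ := P⟦E | 𝒢⟧ with hw'
  have hw'm : Measurable w' := stronglyMeasurable_condExp.measurable.mono h𝒢 le_rfl
  have hw'0 : 0 ≤ᵐ[P] w' := condExp_nonneg (Eventually.of_forall fun ω =>
    indicator_nonneg (fun _ _ => zero_le_one) ω)
  have hintg : Integrable (E.indicator fun _ => (1 : ℝ)) P := (integrable_const 1).indicator hE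
  -- On events of `𝒢` the two measures agree by the defining property of conditional expectation,
  -- and a `𝒢`-measurable integrand only sees those events.
  have hmeas : (P.restrict E).trim h𝒢 = (P.withDensity fun ω => ENNReal.ofReal (w' ω)).trim h𝒢 := by
    refine @Measure.ext _ 𝒢 _ _ fun A hA => ?_
    rw [trim_measurableSet_eq h𝒢 hA, trim_measurableSet_eq h𝒢 hA, Measure.restrict_apply (h𝒢 A hA),
      withDensity_apply _ (h𝒢 A hA), ← ofReal_integral_eq_lintegral_ofReal
        integrable_condExp.integrableOn (ae_restrict_of_ae hw'0),
      setIntegral_condExp h𝒢 hintg hA, setIntegral_indicator hE]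
    simp
  calc ∫⁻ ω in E, d ω ∂P = ∫⁻ ω, d ω ∂((P.restrict E).trim h𝒢) := (lintegral_trim h𝒢 hd).symm
    _ = ∫⁻ ω, d ω ∂(P.withDensity fun ω => ENNReal.ofReal (w' ω)) := by
        rw [hmeas, lintegral_trim h𝒢 hd]
    _ = ∫⁻ ω, ENNReal.ofReal (w' ω) * d ω ∂P :=
        lintegral_withDensity_eq_lintegral_mul _ hw'm.ennreal_ofReal (hd.mono h𝒢 le_rfl)
    _ = ∫⁻ ω, d ω * ENNReal.ofReal (w ω) ∂P := by
        refine lintegral_congr_ae (hw.mono fun ω h => ?_)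
        simp only [h, mul_comm]

theorem tsum_geometric_mean {q : ℝ} (h0 : 0 ≤ q) (h1 : q < 1) :
    ∑' n : ℕ, (n : ℝ≥0∞) * ENNReal.ofReal ((1 - q) * q ^ n) = ENNReal.ofReal (q / (1 - q)) := by
  have hs := (hasSum_coe_mul_geometric_of_norm_lt_one (𝕜 := ℝ) (r := q)
    (by rwa [Real.norm_eq_abs, abs_of_nonneg h0])).mul_left (1 - q)
  have hq : 1 - q ≠ 0 := (sub_pos.2 h1).ne'
  have heq : (1 - q) * (q / (1 - q) ^ 2) = q / (1 - q) := by field_simp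
  rw [heq] at hs
  have hnn : ∀ n : ℕ, 0 ≤ (1 - q) * (n * q ^ n) := fun n =>
    mul_nonneg (sub_pos.2 h1).le (by positivity)
  rw [← hs.tsum_eq, ENNReal.ofReal_tsum_of_nonneg hnn hs.summable]
  refine tsum_congr fun n => ?_
  rw [← ENNReal.ofReal_natCast, ← ENNReal.ofReal_mul (Nat.cast_nonneg n)]
  congr 1
  ring

section Auxiliary

variable {Ω : Type*} {m : MeasurableSpace Ω} {P : Measure Ω} [IsProbabilityMeasure P] {ρ : ℝ}
  {η : ℝ → ℝ} {V R U : Ω → ℝ} {N : Ω → ℕ} {e : ℕ → Ω → ℝ}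
  (haux : IsAuxiliaryFamily P ρ η V R U N e) (hV : Measurable V) (hR : Measurable R)
  (hV0 : ∀ᵐ ω ∂P, 0 ≤ V ω) (hρ0 : 0 ≤ ρ) (hRρ : ∀ᵐ ω ∂P, ρ < R ω)

include haux hV hR hρ0 hRρ

/-- Given `(V, R)`, the variable `N` is geometric with ratio `ρ / R` and hence has mean `ρ / (R -
ρ)`. -/
theorem lintegral_mul_geometric {d : ℝ × ℝ → ℝ≥0∞} (hd : Measurable d) :
    ∫⁻ ω, d (V ω, R ω) * N ω ∂P
      = ∫⁻ ω, d (V ω, R ω) * ENNReal.ofReal (ρ / (R ω - ρ)) ∂P := by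
  have hVR : Measurable fun ω => (V ω, R ω) := hV.prodMk hR
  have hdm : Measurable fun ω => d (V ω, R ω) := hd.comp hVR
  have hNset : ∀ n, MeasurableSet (N ⁻¹' {n}) := fun n =>
    haux.measurable_N (measurableSet_singleton n)
  calc ∫⁻ ω, d (V ω, R ω) * N ω ∂P
      = ∫⁻ ω, ∑' n : ℕ, (N ⁻¹' {n}).indicator (fun ω => n * d (V ω, R ω)) ω ∂P := by
        refine lintegral_congr fun ω => ?_
        rw [tsum_eq_single (N ω)]
        · rw [indicator_of_mem (by exact rfl), mul_comm]
        · intro n hn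
          exact indicator_of_notMem (s := N ⁻¹' {n}) (fun h => hn (mem_singleton_iff.1 h).symm) _
    _ = ∑' n : ℕ, (n : ℝ≥0∞) * ∫⁻ ω in N ⁻¹' {n}, d (V ω, R ω) ∂P := by
        rw [lintegral_tsum fun n => ((hdm.const_mul _).indicator (hNset n)).aemeasurable]
        refine tsum_congr fun n => ?_
        rw [lintegral_indicator (hNset n), lintegral_const_mul _ hdm]
    _ = ∑' n : ℕ, ∫⁻ ω, d (V ω, R ω) * (n * ENNReal.ofReal
          ((1 - ρ / R ω) * (ρ / R ω) ^ n)) ∂P := by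
        refine tsum_congr fun n => ?_
        rw [setLIntegral_eq_lintegral_mul_condProb (d := fun ω => d (V ω, R ω)) hVR.comap_le
          (hNset n) (haux.geometric n) (hd.comp (comap_measurable _)), ← lintegral_const_mul _ (by fun_prop)]
        refine lintegral_congr fun ω => ?_
        ring
    _ = ∫⁻ ω, ∑' n : ℕ, d (V ω, R ω) * (n * ENNReal.ofReal
          ((1 - ρ / R ω) * (ρ / R ω) ^ n)) ∂P := by
        rw [lintegral_tsum fun n => by fun_prop]
    _ = _ := by
        refine lintegral_congr_ae ?_
        filter_upwards [hRρ] with ω hω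
        have hRpos : 0 < R ω := hρ0.trans_lt hω
        rw [ENNReal.tsum_mul_left, tsum_geometric_mean (div_nonneg hρ0 hRpos.le)
          ((div_lt_one hRpos).2 hω)]
        congr 2
        have : R ω - ρ ≠ 0 := (sub_pos.2 hω).ne'
        field_simp

include hV0

/-- The mean of `U V + e₁ + … + e_N` under the biased measure. -/
theorem lintegral_biasedMeasure {μ : ℝ≥0∞} (hμ : ∀ n, ∫⁻ ω, ENNReal.ofReal (e n ω) ∂P = μ) :
    ∫⁻ ω, ENNReal.ofReal (U ω * V ω + ∑ i ∈ Finset.range (N ω), e i ω)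
        ∂(biasedMeasure P V R ρ)
      = (∫⁻ ω, (ENNReal.ofReal (V ω ^ 2 / (2 * (R ω - ρ)))
          + μ * ENNReal.ofReal (ρ * V ω / (R ω - ρ) ^ 2)) ∂P)
            / ∫⁻ ω, ENNReal.ofReal (V ω / (R ω - ρ)) ∂P := by
  have hUm := haux.measurable_U
  have hNm := haux.measurable_N
  have hem := haux.measurable_e
  have hU0 : ∀ᵐ ω ∂P, 0 ≤ U ω := by
    have h : ∀ᵐ u ∂P.map U, 0 ≤ u := by
      rw [haux.uniform]
      exact (ae_restrict_mem measurableSet_Icc).mono fun u hu => hu.1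
    exact ae_of_ae_map hUm.aemeasurable h
  have he0 : ∀ᵐ ω ∂P, ∀ n, 0 ≤ e n ω := ae_all_iff.2 haux.nonneg
  set d : ℝ × ℝ → ℝ≥0∞ := fun x => ENNReal.ofReal (x.1 / (x.2 - ρ)) with hd
  have hdm : Measurable d := by fun_prop
  have hdVR : Measurable fun ω => d (V ω, R ω) := hdm.comp (hV.prodMk hR)
  have hNset : ∀ i : ℕ, MeasurableSet {ω | i < N ω} := fun i =>
    measurableSet_lt measurable_const hNm
  have hsum : Measurable fun ω => ∑ i ∈ Finset.range (N ω), e i ω := by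
    have h1 : Measurable fun p : Ω × ℕ => ∑ i ∈ Finset.range p.2, e i p.1 :=
      measurable_from_prod_countable_left fun n =>
        Finset.measurable_fun_sum (Finset.range n) fun i _ => hem i
    exact h1.comp (measurable_id.prodMk hNm)
  -- The random sum is written as a full series with indicators of `{i < N}`; each `e i` is then
  -- independent of the factor that multiplies it.
  have hexpand : ∀ᵐ ω ∂P, d (V ω, R ω)
        * ENNReal.ofReal (U ω * V ω + ∑ i ∈ Finset.range (N ω), e i ω)
      = ENNReal.ofReal (U ω) * (d (V ω, R ω) * ENNReal.ofReal (V ω))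
        + ∑' i : ℕ, ENNReal.ofReal (e i ω) * {ω | i < N ω}.indicator (fun ω => d (V ω, R ω)) ω := by
    filter_upwards [hU0, he0, hV0] with ω h1 h2 h3
    rw [ENNReal.ofReal_add (mul_nonneg h1 h3) (Finset.sum_nonneg fun i _ => h2 i),
      ENNReal.ofReal_mul h1, ENNReal.ofReal_sum_of_nonneg fun i _ => h2 i, mul_add]
    congr 1
    · ring
    · rw [tsum_eq_sum (s := Finset.range (N ω)), Finset.mul_sum]
      · refine Finset.sum_congr rfl fun i hi => ?_
        rw [indicator_of_mem (by exact Finset.mem_range.1 hi), mul_comm]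
      · intro i hi
        rw [indicator_of_notMem (s := {ω | i < N ω}) (fun h => hi (Finset.mem_range.2 h)), mul_zero]
  have hUpart : ∫⁻ ω, ENNReal.ofReal (U ω) * (d (V ω, R ω) * ENNReal.ofReal (V ω)) ∂P
      = ∫⁻ ω, ENNReal.ofReal (V ω ^ 2 / (2 * (R ω - ρ))) ∂P := by
    have hg : Measurable fun x : (ℕ → ℝ) × ℕ × ℝ × ℝ => d x.2.2 * ENNReal.ofReal x.2.2.1 := by
      fun_prop
    have hind := haux.indep_U.comp (φ := fun u => ENNReal.ofReal u) (by fun_prop) hg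
    have h := lintegral_mul_eq_lintegral_mul_lintegral_of_indepFun
      (f := fun ω => ENNReal.ofReal (U ω)) (g := fun ω => d (V ω, R ω) * ENNReal.ofReal (V ω))
      (by fun_prop) (hdVR.mul hV.ennreal_ofReal) hind
    refine h.trans ?_
    rw [lintegral_uniform_unit hUm haux.uniform,
      ← lintegral_const_mul (f := fun ω => d (V ω, R ω) * ENNReal.ofReal (V ω)) _
        (hdVR.mul hV.ennreal_ofReal)]
    refine lintegral_congr_ae ?_
    filter_upwards [hV0, hRρ] with ω h1 h2
    have h3 : 0 < R ω - ρ := sub_pos.2 h2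
    simp only [hd]
    rw [← ENNReal.ofReal_mul (by positivity), ← ENNReal.ofReal_mul (by positivity)]
    congr 1
    field_simp
  have hepart : ∀ i : ℕ, ∫⁻ ω, ENNReal.ofReal (e i ω)
        * {ω | i < N ω}.indicator (fun ω => d (V ω, R ω)) ω ∂P
      = μ * ∫⁻ ω, {ω | i < N ω}.indicator (fun ω => d (V ω, R ω)) ω ∂P := by
    intro i
    have hg : Measurable ({x : ℕ × ℝ × ℝ | i < x.1}.indicator fun x => d x.2) :=
      (hdm.comp measurable_snd).indicator (measurableSet_lt measurable_const measurable_fst)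
    have hind := haux.indep_e_NVR.comp (φ := fun x : ℕ → ℝ => ENNReal.ofReal (x i))
      (by fun_prop) hg
    have h := lintegral_mul_eq_lintegral_mul_lintegral_of_indepFun
      (f := fun ω => ENNReal.ofReal (e i ω))
      (g := {ω | i < N ω}.indicator (fun ω => d (V ω, R ω)))
      ((hem i).ennreal_ofReal) (hdVR.indicator (hNset i)) hind
    rw [← hμ i]
    exact h
  have hNpart : ∑' i : ℕ, ∫⁻ ω, {ω | i < N ω}.indicator (fun ω => d (V ω, R ω)) ω ∂P
      = ∫⁻ ω, d (V ω, R ω) * N ω ∂P := by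
    rw [← lintegral_tsum fun i => (hdVR.indicator (hNset i)).aemeasurable]
    refine lintegral_congr fun ω => ?_
    rw [tsum_eq_sum (s := Finset.range (N ω))]
    · have hterm : ∀ i ∈ Finset.range (N ω),
          {ω | i < N ω}.indicator (fun ω => d (V ω, R ω)) ω = d (V ω, R ω) := fun i hi =>
        indicator_of_mem (s := {ω | i < N ω}) (Finset.mem_range.1 hi) _
      rw [Finset.sum_congr rfl hterm]
      simp [mul_comm]
    · intro i hi
      exact indicator_of_notMem (s := {ω | i < N ω}) (fun h => hi (Finset.mem_range.2 h)) _
  have hmain : ∫⁻ ω, d (V ω, R ω)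
        * ENNReal.ofReal (U ω * V ω + ∑ i ∈ Finset.range (N ω), e i ω) ∂P
      = ∫⁻ ω, (ENNReal.ofReal (V ω ^ 2 / (2 * (R ω - ρ)))
          + μ * ENNReal.ofReal (ρ * V ω / (R ω - ρ) ^ 2)) ∂P := by
    rw [lintegral_congr_ae hexpand, lintegral_add_left
      (by exact hUm.ennreal_ofReal.mul (hdVR.mul hV.ennreal_ofReal)),
      lintegral_tsum (f := fun i ω => ENNReal.ofReal (e i ω)
        * {ω | i < N ω}.indicator (fun ω => d (V ω, R ω)) ω) fun i => ((hem i).ennreal_ofReal.mul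
        (hdVR.indicator (hNset i))).aemeasurable, hUpart]
    simp only [hepart]
    rw [ENNReal.tsum_mul_left, hNpart, lintegral_mul_geometric haux hV hR hρ0 hRρ hdm,
      lintegral_add_left (by fun_prop), lintegral_const_mul _ (by fun_prop)]
    congr 2
    refine lintegral_congr_ae ?_
    filter_upwards [hV0, hRρ] with ω h1 h2
    have h3 : 0 < R ω - ρ := sub_pos.2 h2
    simp only [hd]
    rw [← ENNReal.ofReal_mul (by positivity)]
    congr 1
    field_simp
  rw [biasedMeasure, lintegral_smul_measure, lintegral_withDensity_eq_lintegral_mul _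
    (by fun_prop) (by fun_prop), ENNReal.div_eq_inv_mul, smul_eq_mul, ← hmain]
  rfl

end Auxiliary

end LevyStorage

namespace LevyStorage

/-! ### The off period -/

section Off

variable {Ω : Type*} {m : MeasurableSpace Ω} {P : Measure Ω} {𝓕 : Filtration ℝ≥0 m}
  {τ : Ω → ℝ≥0∞}

/-- `toNNReal` turns an infinite `τ` into `0`, which alters the event only inside a null set. All
subsets of that set belong to `𝓕 0` by augmentation. -/
theorem measurableSet_inter_toNNReal_lt (h𝓕 : UsualConditions P 𝓕) (hτ : IsStoppingTime 𝓕 τ)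
    (hfin : ∀ᵐ ω ∂P, τ ω < ∞) {A : Set Ω} (hA : MeasurableSet[hτ.measurableSpace] A) (q : ℝ≥0) :
    MeasurableSet[𝓕 q] (A ∩ {ω | (τ ω).toNNReal < q}) := by
  have hnull : ∀ s ⊆ {ω | τ ω = ∞}, MeasurableSet[𝓕 q] s := by
    intro s hs
    refine 𝓕.mono zero_le _ (h𝓕.augmented s (measure_mono_null hs ?_))
    have : {ω | τ ω = ∞} = {ω | τ ω < ∞}ᶜ := by ext ω; simp
    rw [this]
    exact hfin
  have hset : A ∩ {ω | (τ ω).toNNReal < q}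
      = (((A ∩ {ω | τ ω ≤ q}) ∩ {ω | τ ω < q}) \ {ω | τ ω = ∞})
        ∪ (A ∩ {ω | (τ ω).toNNReal < q} ∩ {ω | τ ω = ∞}) := by
    ext ω
    simp only [mem_inter_iff, mem_ofPred_eq, mem_union, Set.mem_sdiff]
    by_cases hω : τ ω = ∞
    · simp [hω]
    · have hlt : τ ω < q ↔ (τ ω).toNNReal < q := by
        rw [← ENNReal.coe_lt_coe, ENNReal.coe_toNNReal hω]
      rw [← hlt]
      constructor
      · rintro ⟨h1, h2⟩
        exact Or.inl ⟨⟨⟨h1, h2.le⟩, h2⟩, hω⟩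
      · rintro (⟨⟨⟨h1, -⟩, h2⟩, -⟩ | ⟨-, h⟩)
        · exact ⟨h1, h2⟩
        · exact absurd h hω
  rw [hset]
  refine MeasurableSet.union (MeasurableSet.diff ?_ (hnull _ subset_rfl))
    (hnull _ inter_subset_right)
  exact (hA.2 q).inter (hτ.measurableSet_lt q)

theorem isOptionalTime_toNNReal (h𝓕 : UsualConditions P 𝓕) (hτ : IsStoppingTime 𝓕 τ)
    (hfin : ∀ᵐ ω ∂P, τ ω < ∞) : IsOptionalTime 𝓕 fun ω => (τ ω).toNNReal := by
  intro q
  have := measurableSet_inter_toNNReal_lt h𝓕 hτ hfin MeasurableSet.univ q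
  rwa [univ_inter] at this

/-- A subordinator that is positive at a finite random time has a positive mean. -/
theorem IsSubordinator.mean_pos [IsProbabilityMeasure P] {J : ℝ≥0 → Ω → ℝ}
    (hJ : IsSubordinator P 𝓕 J) (hmean : Integrable (J 1) P) {S : Ω → ℝ≥0}
    (hpos : ∀ᵐ ω ∂P, 0 < J (S ω) ω) : 0 < ∫ ω, J 1 ω ∂P := by
  refine lt_of_le_of_ne (integral_nonneg fun ω => hJ.nonneg 1 ω) fun h0 => ?_
  have hJ1 : J 1 =ᵐ[P] 0 :=
    (integral_eq_zero_iff_of_nonneg (fun ω => hJ.nonneg 1 ω) hmean).1 h0.symm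
  -- With mean zero, `J 1` vanishes almost surely, and by stationarity so do all unit increments.
  -- Monotone paths are then zero at every finite time, contradicting positivity at `S`.
  have hn : ∀ n : ℕ, ∀ᵐ ω ∂P, J n ω = 0 := by
    intro n
    induction n with
    | zero => exact Eventually.of_forall fun ω => by simpa using hJ.zero ω
    | succ n ih =>
      have hinc : ∀ᵐ ω ∂P, J (n + 1) ω - J n ω = 0 :=
        (hJ.stationary n 1).symm.ae_snd (p := fun x => x = 0) (measurableSet_singleton 0) hJ1
      filter_upwards [ih, hinc] with ω h1 h2
      push_cast
      linarith
  have hall : ∀ᵐ ω ∂P, ∀ n : ℕ, J n ω = 0 := ae_all_iff.2 hn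
  obtain ⟨ω, h1, h2⟩ := (hpos.and hall).exists
  obtain ⟨n, hn⟩ := exists_nat_ge (S ω)
  exact absurd ((hJ.mono ω hn).trans (h2 n).le) (not_le.2 h1)

end Off

end LevyStorage

/-! ### The mean workload in on periods -/

theorem corollary1 {Ω : Type*} {m : MeasurableSpace Ω} (P : Measure Ω) [IsProbabilityMeasure P]
    -- the input process and the off period
    (𝓕 : Filtration ℝ≥0 m) (h𝓕 : LevyStorage.UsualConditions P 𝓕)
    (J : ℝ≥0 → Ω → ℝ) (hJ : LevyStorage.IsSubordinator P 𝓕 J)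
    (hmean : Integrable (J 1) P) (ρ : ℝ) (hρ : ρ = ∫ ω, J 1 ω ∂P)
    (c : ℝ) (ν : Measure ℝ) (hcν : LevyStorage.HasLevyCharacteristics P J c ν)
    (τ : Ω → ℝ≥0∞) (hτ : IsStoppingTime 𝓕 τ) (hEτ : ∫⁻ ω, τ ω ∂P < ∞)
    (V : Ω → ℝ) (hV : V = LevyStorage.initialLoad J τ) (hVpos : ∀ᵐ ω ∂P, 0 < V ω)
    -- the output rate, chosen at the end of the off period
    (R : Ω → ℝ) (hR : Measurable[hτ.measurableSpace] R) (hRρ : ∀ᵐ ω ∂P, ρ < R ω)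
    (hVR : ∫⁻ ω, ENNReal.ofReal (V ω / (R ω - ρ)) ∂P < ∞)
    -- the auxiliary variables, on an extension of the probability space
    {Ω' : Type*} {m' : MeasurableSpace Ω'} (P' : Measure Ω') [IsProbabilityMeasure P']
    (p : Ω' → Ω) (hp : MeasurePreserving p P' P)
    (U : Ω' → ℝ) (N : Ω' → ℕ) (e : ℕ → Ω' → ℝ)
    (haux : LevyStorage.IsAuxiliaryFamily P' ρ (LevyStorage.levyExponent c ν)
      (V ∘ p) (R ∘ p) U N e)
    (μ : ℝ≥0∞)
    (hμ : μ = (∫⁻ x in Ioi (0 : ℝ), ENNReal.ofReal (x ^ 2) ∂ν) / ENNReal.ofReal (2 * ρ)) :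
    -- `μ = E e₁`
    (∀ n, ∫⁻ ω, ENNReal.ofReal (e n ω) ∂P' = μ) ∧
    -- `μ = - η''(0) / (2 ρ)`, with `η''(0)` a one-sided derivative, possibly infinite
    DifferentiableOn ℝ (LevyStorage.levyExponent c ν) (Ici 0) ∧
    Tendsto (fun α : ℝ => ENNReal.ofReal
        (-((derivWithin (LevyStorage.levyExponent c ν) (Ici 0) α
          - derivWithin (LevyStorage.levyExponent c ν) (Ici 0) 0) / α)) / ENNReal.ofReal (2 * ρ))
      (𝓝[>] 0) (𝓝 μ) ∧
    -- the steady-state law of the workload in on periods and its mean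
    ∃ Y : Measure ℝ, IsProbabilityMeasure Y ∧ Y (Iio 0) = 0 ∧
      LevyStorage.IsSteadyStateLaw (LevyStorage.cycleMeasure P)
        (LevyStorage.onProcess J τ R) Y ∧
      (∀ Y' : Measure ℝ, LevyStorage.IsSteadyStateLaw (LevyStorage.cycleMeasure P)
        (LevyStorage.onProcess J τ R) Y' → Y' = Y) ∧
      ∫⁻ y, ENNReal.ofReal y ∂Y
        = ∫⁻ ω, ENNReal.ofReal (U ω * V (p ω) + ∑ i ∈ Finset.range (N ω), e i ω)
            ∂(LevyStorage.biasedMeasure P' (V ∘ p) (R ∘ p) ρ) ∧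
      ∫⁻ ω, ENNReal.ofReal (U ω * V (p ω) + ∑ i ∈ Finset.range (N ω), e i ω)
            ∂(LevyStorage.biasedMeasure P' (V ∘ p) (R ∘ p) ρ)
        = (∫⁻ ω, (ENNReal.ofReal (V ω ^ 2 / (2 * (R ω - ρ)))
              + μ * ENNReal.ofReal (ρ * V ω / (R ω - ρ) ^ 2)) ∂P)
            / ∫⁻ ω, ENNReal.ofReal (V ω / (R ω - ρ)) ∂P := by
  have hVdef : V = fun ω => J (τ ω).toNNReal ω := hV
  subst hV
  have hτfin : ∀ᵐ ω ∂P, τ ω < ∞ :=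
    ae_lt_top' ((hτ.measurable'.aemeasurable)) hEτ.ne
  set S : Ω → ℝ≥0 := fun ω => (τ ω).toNNReal with hSdef
  have hS : LevyStorage.IsOptionalTime 𝓕 S := LevyStorage.isOptionalTime_toNNReal h𝓕 hτ hτfin
  have hVS : Measurable[hS.measurableSpace] (LevyStorage.initialLoad J τ) :=
    hJ.measurable_eval_optional hS
  have hRS : Measurable[hS.measurableSpace] R :=
    hR.mono (fun A hA q => LevyStorage.measurableSet_inter_toNNReal_lt h𝓕 hτ hτfin hA q) le_rfl
  set V := LevyStorage.initialLoad J τ with hVd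
  have hVm : Measurable V := hVS.mono hS.measurableSpace_le le_rfl
  have hRm : Measurable R := hRS.mono hS.measurableSpace_le le_rfl
  have hV0 : ∀ ω, 0 ≤ V ω := fun ω => hJ.nonneg _ ω
  obtain ⟨hx, hρ'⟩ := LevyStorage.mean_eq_drift_add_integral
    (Eventually.of_forall fun ω => hJ.nonneg 1 ω) hmean hcν
  rw [← hρ] at hρ'
  have hρpos : 0 < ρ := hρ ▸ hJ.mean_pos hmean (S := S) hVpos
  -- This links the second order coefficient of the exponent to `μ`; dividing by `ρ` in `ℝ≥0∞` is
  -- harmless since `0 < ρ < ∞`.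
  have hκ : ∫⁻ x in Ioi (0 : ℝ), ENNReal.ofReal (x ^ 2 / 2) ∂ν = μ * ENNReal.ofReal ρ := by
    have h2 : ENNReal.ofReal (2 * ρ) = 2 * ENNReal.ofReal ρ := by
      rw [ENNReal.ofReal_mul (by norm_num), ENNReal.ofReal_ofNat]
    have hr0 : ENNReal.ofReal ρ ≠ 0 := (ENNReal.ofReal_pos.2 hρpos).ne'
    rw [LevyStorage.lintegral_sq_div_two, hμ, h2, ENNReal.div_eq_inv_mul, ENNReal.div_eq_inv_mul,
      ENNReal.mul_inv (Or.inr ENNReal.ofReal_ne_top) (Or.inr hr0), mul_right_comm,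
      mul_assoc 2⁻¹, ENNReal.inv_mul_cancel hr0 ENNReal.ofReal_ne_top, mul_one]
  have he : ∀ n, ∫⁻ ω, ENNReal.ofReal (e n ω) ∂P' = μ := by
    intro n
    rw [LevyStorage.lintegral_of_equilibrium_transform hx hρ' (haux.measurable_e n)
      (haux.nonneg n) hρpos (haux.lst n), hκ, mul_div_assoc,
      ENNReal.div_self (ENNReal.ofReal_pos.2 hρpos).ne' ENNReal.ofReal_ne_top, mul_one]
  have hVRp : ∫⁻ ω, ENNReal.ofReal ((V ∘ p) ω / ((R ∘ p) ω - ρ)) ∂P'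
      = ∫⁻ ω, ENNReal.ofReal (V ω / (R ω - ρ)) ∂P :=
    hp.lintegral_comp (f := fun ω => ENNReal.ofReal (V ω / (R ω - ρ))) (by fun_prop)
  have hbias := LevyStorage.lintegral_biasedMeasure haux (hVm.comp hp.measurable)
    (hRm.comp hp.measurable) (Eventually.of_forall fun ω => hV0 (p ω)) hρpos.le
    (hp.quasiMeasurePreserving.ae hRρ) he
  rw [hVRp, show ∫⁻ ω, (ENNReal.ofReal ((V ∘ p) ω ^ 2 / (2 * ((R ∘ p) ω - ρ)))
        + μ * ENNReal.ofReal (ρ * (V ∘ p) ω / ((R ∘ p) ω - ρ) ^ 2)) ∂P'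
      = ∫⁻ ω, (ENNReal.ofReal (V ω ^ 2 / (2 * (R ω - ρ)))
        + μ * ENNReal.ofReal (ρ * V ω / (R ω - ρ) ^ 2)) ∂P from
    hp.lintegral_comp (f := fun ω => ENNReal.ofReal (V ω ^ 2 / (2 * (R ω - ρ)))
        + μ * ENNReal.ofReal (ρ * V ω / (R ω - ρ) ^ 2)) (by fun_prop)] at hbias
  -- With `S = τ` and initial content `V = J_τ`, the two values of `J` at `τ` cancel, so the level
  -- of the on period is an instance of `drain`.
  have hlevel : ∀ ω s, LevyStorage.onLevel J τ R ω s = LevyStorage.drain J S V R ω s := by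
    intro ω s
    rw [LevyStorage.onLevel, LevyStorage.drain, hVdef]
    ring
  set T := LevyStorage.drainTime J S V R with hTdef
  have hTm : Measurable T := LevyStorage.measurable_drainTime hJ hS hVS hRS
  have hdur : ∀ᵐ ω ∂P, LevyStorage.onDuration J τ R ω = T ω := by
    have h := LevyStorage.ae_hitting_eq_drainTime hJ hS hVS hRS hcν hx hρ' hRρ hV0 hVpos
    filter_upwards [h] with ω hω
    rw [LevyStorage.onDuration]
    simp only [hlevel]
    exact hω
  have hX : Measurable fun q : Ω × ℝ => LevyStorage.onLevel J τ R q.1 q.2.toNNReal := by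
    simp only [hlevel]
    exact LevyStorage.measurable_drain_uncurry hJ hS hVS hRS
  have hET : ∫⁻ ω, T ω ∂P = ∫⁻ ω, ENNReal.ofReal (V ω / (R ω - ρ)) ∂P :=
    LevyStorage.lintegral_drainTime hJ hS hVS hRS hcν hx hρ' hRρ hV0
  have hETfin : ∫⁻ ω, T ω ∂P ≠ ∞ := hET ▸ hVR.ne
  have hETpos : ∫⁻ ω, T ω ∂P ≠ 0 := by
    rw [hET, Ne, lintegral_eq_zero_iff (by fun_prop)]
    intro h
    obtain ⟨ω, h1, h2, h3⟩ := (h.and (hVpos.and hRρ)).exists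
    exact absurd h1 (ENNReal.ofReal_pos.2 (div_pos h2 (sub_pos.2 h3))).ne'
  have hsteady := LevyStorage.isSteadyStateLaw_onProcess hTm hX hdur hETfin hETpos
  refine ⟨he, fun α hα => (LevyStorage.hasDerivWithinAt_levyExponent hx
    hα).differentiableWithinAt, ?_, _, ?_, ?_, hsteady, ?_, ?_, hbias⟩
  · rw [hμ]
    refine ENNReal.Tendsto.div_const (LevyStorage.tendsto_second_derivative_levyExponent hx)
      (Or.inr ?_)
    exact (ENNReal.ofReal_pos.2 (by positivity)).ne'
  · refine ⟨?_⟩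
    rw [Measure.smul_apply, Measure.map_apply hX MeasurableSet.univ, preimage_univ,
      LevyStorage.periodMeasure_univ hTm, smul_eq_mul, ENNReal.inv_mul_cancel hETpos hETfin]
  · rw [Measure.smul_apply, Measure.map_apply hX measurableSet_Iio]
    have h0 : LevyStorage.periodMeasure P T
        ((fun q : Ω × ℝ => LevyStorage.onLevel J τ R q.1 q.2.toNNReal) ⁻¹' Iio 0) = 0 := by
      refine measure_mono_null (fun q hq => ?_) (LevyStorage.ae_periodMeasure (P := P) hTm)
      intro h
      have hneg : LevyStorage.onLevel J τ R q.1 q.2.toNNReal < 0 := hq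
      rw [hlevel] at hneg
      exact absurd (LevyStorage.drain_nonneg_of_lt h.2) (not_le.2 hneg)
    rw [h0, smul_zero]
  -- For each Borel set, both limits hold along a common path, because the cycle measure is not
  -- zero; hence they coincide.
  · intro Y' hY'
    refine Measure.ext fun B hB => ?_
    have : (ae (LevyStorage.cycleMeasure P)).NeBot := by
      rw [LevyStorage.cycleMeasure]
      infer_instance
    obtain ⟨ω, h1, h2⟩ := ((hY' B hB).and (hsteady B hB)).exists
    exact tendsto_nhds_unique h1 h2
  · rw [show ∫⁻ ω, ENNReal.ofReal (U ω * V (p ω) + ∑ i ∈ Finset.range (N ω), e i ω)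
        ∂(LevyStorage.biasedMeasure P' (V ∘ p) (R ∘ p) ρ) = _ from hbias,
      lintegral_smul_measure, lintegral_map (by fun_prop) hX, hET, ENNReal.div_eq_inv_mul,
      smul_eq_mul]
    simp only [hlevel]
    rw [LevyStorage.lintegral_drain_periodMeasure hJ hS hVS hRS hcν hx hρ' hRρ hV0 hVpos hVR, hκ]
    congr 1
    refine lintegral_congr fun ω => ?_
    rw [mul_assoc, ← ENNReal.ofReal_mul hρpos.le, mul_div_assoc]
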